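/- **Setting.** Consider free electromagnetism on $\mathbb R^3$ (Cartesian coordinates $x^i$, $r=|x|$, angles $x^A$, unit round metric $\bar\gamma_{AB}$ with covariant derivative $\bar D_A$). A configuration is a quadruple $z=(A_i,\pi^i,\Psi,\pi_\Psi)$ of smooth fields on $\mathbb R^3$ with $$A_i=\tfrac{\bar A_i}{r}+\tfrac{A^{(1)}_i}{r^2}+o(r^{-2}),\quad \pi^i=\tfrac{\bar\pi^i}{r^2}+\tfrac{\pi^{(1)i}}{r^3}+o(r^{-3}),\quad \Psi=\tfrac{\bar\Psi}{r}+\tfrac{\Psi^{(1)}}{r^2}+o(r^{-2}),\quad \pi_\Psi=\tfrac{\pi_\Psi^{(1)}}{r^3}+o(r^{-3}),$$ with coefficients smooth on the sphere and uniformly smooth remainders (each Cartesian derivative of a remainder $o(r^{-k})$ improves its decay by one power of $r$). Let $\bar A_r,\bar A_A$ be the leading radial and angular components of $A_i$ and $\bar\pi^r,\bar\pi^A$ those of $\pi^i$ (densities on the sphere). Impose $\bar A_r(-x)=-\bar A_r(x)$, $\bar\pi^r(-x)=\bar\pi^r(x)$, $\partial_A\bar\pi^A=0$ and one of the following two sets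 of angular conditions (parity of components, in the convention where $x^A\mapsto -x^A$ denotes the antipodal map): * (I) $\bar A_A(-x)=-\bar A_A(x)+\partial_A\bar\Phi$ for some smooth odd $\bar\Phi$, and $\bar\pi^A(-x)=\bar\pi^A(x)$; * (II) $\bar A_A=\bar A_A^{\rm even}+\partial_A\bar\Phi$ for some smooth $\bar\Phi$, and $\bar\pi^A(-x)=-\bar\pi^A(x)$. Bulk integrals $\int d^3x$ are limits of integrals over balls of radius $R\to\infty$. The symplectic form of the extended action is $$\Omega=\int d^3x\,(d_V\pi^i\,d_VA_i+d_V\pi_\Psi\,d_V\Psi)-\oint d^2x\sqrt{\bar\gamma}\,d_V\bar A_r\,d_V\bar\Psi .$$ A functional $F$ is *allowed* if there is a vector field $X_F$ preserving all the boundary conditions with $d_VF=-i_{X_F}\Omega$; the bracket of allowed functionals is $\{F_1,F_2\}=\Omega(X_{F_2},X_{F_1})=d_VF_1(X_{F_2})$. Put $F_{ij}=\partial_iA_j-\partial_jA_i$ and $\mathcal G=-\partial_i\pi^i$; the constraints are $\pi_\Psi\approx0$, $\mathcal G\approx0$. For a Poincaré transformation $\xi=b_ix^i+a^\perp=rb+T$,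 $\xi^i=b^i{}_jx^j+a^i$ ($b_{ij}=-b_{ji}$), with $Y^A$ the rotation Killing vector on the sphere defined by $b^i{}_j$, let $$P_{\xi,\xi^i}=\int d^3x\,(\xi\mathcal H+\xi^i\mathcal H_i)+\oint d^2x\Big(b(\bar\Psi\bar\pi^r+\sqrt{\bar\gamma}\,\bar A_A\bar D^A\bar A_r)+Y^A(\bar A_A\bar\pi^r+\sqrt{\bar\gamma}\,\bar\Psi\,\partial_A\bar A_r)\Big),$$ $$\mathcal H=-\Psi\partial_i\pi^i-A_i\nabla^i\pi_\Psi+\tfrac12\pi_i\pi^i+\tfrac14F_{ij}F^{ij},\qquad \mathcal H_i=F_{ij}\pi^j-A_i\partial_j\pi^j+\pi_\Psi\partial_i\Psi .$$ For field-independent smooth parameters $\mu=\bar\mu/r+\mu^{(1)}/r^2+o(r^{-2})$, $\epsilon=\bar\epsilon+\epsilon^{(1)}/r+o(r^{-1})$ (same regularity as above) let $$G_{\mu,\epsilon}=\int d^3x\,(\mu\pi_\Psi+\epsilon\mathcal G)+Q_{\bar\mu,\bar\epsilon},\qquad Q_{\bar\mu,\bar\epsilon}=\oint d^2x\,(\bar\epsilon\,\bar\pi^r-\sqrt{\bar\gamma}\,\bar\mu\,\bar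 A_r).$$ **Theorem.** For each of the boundary conditions (I) and (II): 1. $\Omega$ is finite on phase space. 2. For every Poincaré transformation, $P_{\xi,\xi^i}$ is finite and allowed. It generates $\delta A_i=\xi\pi_i+\partial_i(\xi\Psi)+\mathcal L_{\xi^k}A_i$, $\delta\pi^i=\partial_m(\xi F^{mi})+\xi\nabla^i\pi_\Psi+\mathcal L_{\xi^k}\pi^i$ (Lie derivative of a density), $\delta\Psi=\nabla^i(\xi A_i)+\xi^i\partial_i\Psi$, $\delta\pi_\Psi=\xi\partial_i\pi^i+\partial_i(\xi^i\pi_\Psi)$. Here $\delta A_i=\xi\pi_i+\xi^jF_{ji}+\partial_i\zeta$ with the admissible gauge parameter $\zeta=\xi\Psi+\xi^jA_j$, and on the constraint surface $\delta\pi^i=\partial_m(F^{mi}\xi)+\partial_m(\xi^m\pi^i)-(\partial_m\xi^i)\pi^m-\xi^i\partial_m\pi^m$. 3. $G_{\mu,\epsilon}$ is finite and allowed; it generates $\delta A_i=\partial_i\epsilon$, $\delta\Psi=\mu$, $\delta\pi^i=0=\delta\pi_\Psi$, and equals $Q_{\bar\mu,\bar\epsilon}$ on the constraint surface. It is conserved: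 with $E=\int d^3x(\frac12\pi_i\pi^i+\frac14F_{ij}F^{ij})$ (finite), $\{G_{\mu,\epsilon},E+G_{\lambda,A_t}\}=0$ for all admissible multipliers $(\lambda,A_t)$, and $\{G_{\mu,\epsilon},P_{1,0}\}\approx0$. 4. $Q_{\bar\mu,\bar\epsilon}$ vanishes identically on phase space if $\bar\epsilon$ is odd and $\bar\mu$ is even. If $\bar\epsilon$ is even, $\bar\mu$ is odd (both smooth) and they are not both zero, there is a configuration with $\pi_\Psi=0$ and with $\partial_i\pi^i=0$ outside a compact set for which $Q_{\bar\mu,\bar\epsilon}\neq0$; if moreover $\bar\mu\ne0$ or $\bar\epsilon$ is not constant, there is one that satisfies both constraints everywhere. 5. $\{P_{\xi_1,\xi_1^i},P_{\xi_2,\xi_2^i}\}=P_{\hat\xi,\hat\xi^i}$ with $\hat\xi=\xi_1^i\partial_i\xi_2-\xi_2^i\partial_i\xi_1$ and $\hat\xi^i=\xi_1^j\partial_j\xi_2^i-\xi_2^j\partial_j\xi_1^i+g^{ij}(\xi_1\partial_j\xi_2-\xi_2\partial_j\xi_1)$, which is the bracket of the Poincaré algebra $iso(1,3)$. 6. $\{G_{\mu,\epsilon},P_{\xi,\xi^i}\}=G_{\hat\mu,\hat\epsilon}$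 with $\hat\mu=-\nabla^i(\xi\partial_i\epsilon)-\xi^i\partial_i\mu$, $\hat\epsilon=-\xi\mu-\xi^i\partial_i\epsilon$. Equivalently, $\{G_{-\mu,\epsilon},P_{\xi,\xi^i}\}=G_{-\tilde\mu,\tilde\epsilon}$ with $\tilde\mu=\nabla^i(\xi\partial_i\epsilon)-\xi^i\partial_i\mu$, $\tilde\epsilon=\xi\mu-\xi^i\partial_i\epsilon$. Moreover $\{G_{\mu_1,\epsilon_1},G_{\mu_2,\epsilon_2}\}=0$. 7. Consequently the generators close into a semidirect sum: the Poincaré algebra acts by a Lie algebra homomorphism on the abelian Lie algebra of pairs ($\bar\epsilon$ even, $\bar\mu$ odd) of smooth functions on the sphere by $$\delta\bar\epsilon=Y^A\partial_A\bar\epsilon+b\bar\mu,\qquad \delta\bar\mu=Y^A\partial_A\bar\mu+\bar D_A(b\bar D^A\bar\epsilon),$$ that is, in terms of the pairs $(\bar\epsilon,\bar\mu')$ with $\bar\mu'=-\bar\mu$, by $\delta\bar\epsilon=Y^A\partial_A\bar\epsilon-b\bar\mu'$, $\delta\bar\mu'=Y^A\partial_A\bar\mu'-\bar D_A(b\bar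 D^A\bar\epsilon)$; and the bracket of two functionals $P+G$ whose parameters have boundary values in this semidirect sum is the functional $P+G$ of parameters whose boundary value is their bracket in the semidirect sum. -/

import Mathlib

open Filter Topology MeasureTheory Asymptotics Metric
open scoped ContDiff Gradient

noncomputable section

namespace EMInfinity

/-! ### Space, sphere at infinity, asymptotic expansions -/

/-- Euclidean three-space with Cartesian coordinates (so that `√g = 1`). -/
abbrev E3 : Type := EuclideanSpace ℝ (Fin 3)

/-- The unit sphere, whose points are the directions at spatial infinity. -/
abbrev S2 : Type := sphere (0 : E3) 1

/-- The surface integral `∮ d²x √γ f` over the round unit sphere. -/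
def sphereInt (f : S2 → ℝ) : ℝ := ∫ n, f n ∂((volume : Measure E3).toSphere)

/-- `f` is integrable on the round unit sphere. -/
def SphereIntegrable (f : S2 → ℝ) : Prop := Integrable f ((volume : Measure E3).toSphere)

/-- The extension of a function on the sphere that is constant along rays (`0` at the origin). -/
def radialExt {W : Type*} [Zero W] (c : S2 → W) (x : E3) : W :=
  open Classical in
  if h : x ≠ 0 then c ⟨‖x‖⁻¹ • x, by simp [norm_smul, h]⟩ else 0

/-- Smooth functions on the sphere. -/
def SphereSmooth {W : Type*} [NormedAddCommGroup W] [NormedSpace ℝ W] (c : S2 → W) : Prop :=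
  ContDiffOn ℝ ∞ (radialExt c) {0}ᶜ

/-- `f` is smooth on the whole space and
`f = c₀ / r ^ k + c₁ / r ^ (k + 1) + ⋯ + cₘ / r ^ (k + m) + o(r ^ (-(k + m)))` with smooth
functions `cⱼ` of the angles, where the remainder is uniformly smooth: every Cartesian derivative
of order `l` of the remainder is `o(r ^ (-(k + m + l)))`. -/
def HasExpansion {W : Type*} [NormedAddCommGroup W] [NormedSpace ℝ W]
    (k m : ℕ) (f : E3 → W) : Prop :=
  ContDiff ℝ ∞ f ∧ ∃ c : ℕ → S2 → W, (∀ j ≤ m, SphereSmooth (c j)) ∧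
    ∀ l : ℕ, (fun x : E3 => iteratedFDeriv ℝ l (fun y : E3 =>
        f y - ∑ j ∈ Finset.range (m + 1), (‖y‖ ^ (k + j))⁻¹ • radialExt (c j) y) x)
      =o[Bornology.cobounded E3] (fun x : E3 => (‖x‖ ^ (k + m + l))⁻¹)

/-- The coefficient of `r ^ (-k)`, a function of the angles: the limit of `r ^ k f` along rays. -/
def lead {W : Type*} [NormedAddCommGroup W] [NormedSpace ℝ W]
    (k : ℕ) (f : E3 → W) (n : S2) : W :=
  limUnder atTop (fun r : ℝ => r ^ k • f (r • (n : E3)))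

/-- The component of a vector along the sphere. -/
def tang (V : S2 → E3) (n : S2) : E3 := V n - inner ℝ (V n) (n : E3) • (n : E3)

/-- The gradient `D̄^A c` on the round sphere, as a tangent vector in `E3`. -/
def sgrad (c : S2 → ℝ) (n : S2) : E3 := ∇ (radialExt c) (n : E3)

/-- The divergence `D̄_A V^A` on the round sphere of a tangent vector field. -/
def sdiv (V : S2 → E3) (n : S2) : ℝ :=
  ∑ i : Fin 3, fderiv ℝ (radialExt V) (n : E3) (EuclideanSpace.single i 1) i

/-! ### Bulk calculus and bulk integrals -/

/-- The partial derivative `∂_i f`. -/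
def pd (i : Fin 3) (f : E3 → ℝ) (x : E3) : ℝ := fderiv ℝ f x (EuclideanSpace.single i 1)

/-- The divergence `∂_i V^i`. -/
def dvg (V : E3 → E3) (x : E3) : ℝ := ∑ i, pd i (fun y => V y i) x

/-- The field strength `F_{ij} = ∂_i A_j - ∂_j A_i`. -/
def fstr (A : E3 → E3) (i j : Fin 3) (x : E3) : ℝ :=
  pd i (fun y => A y j) x - pd j (fun y => A y i) x

/-- The improper integral `∫ d³x f` converges: the integral over the ball of radius `R` has a
limit as `R → ∞`. -/
def BulkConverges (f : E3 → ℝ) : Prop :=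
  ∃ L : ℝ, Tendsto (fun R : ℝ => ∫ x in ball (0 : E3) R, f x) atTop (𝓝 L)

/-- The improper integral `∫ d³x f`, as the limit of the integrals over balls. -/
def bulkInt (f : E3 → ℝ) : ℝ :=
  limUnder atTop (fun R : ℝ => ∫ x in ball (0 : E3) R, f x)

/-! ### Fields and boundary conditions -/

/-- Quadruples `(A_i, π^i, Ψ, π_Ψ)` of functions on space. -/
abbrev Config : Type := (E3 → E3) × (E3 → E3) × (E3 → ℝ) × (E3 → ℝ)

/-- The vector potential `A_i`. -/
def vecA (z : Config) : E3 → E3 := z.1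
/-- The electric field `π^i`. -/
def momA (z : Config) : E3 → E3 := z.2.1
/-- The additional field `Ψ`. -/
def psi (z : Config) : E3 → ℝ := z.2.2.1
/-- The momentum `π_Ψ` conjugate to `Ψ`. -/
def momPsi (z : Config) : E3 → ℝ := z.2.2.2

/-- The leading radial component `Ā_r`. -/
def barAr (z : Config) (n : S2) : ℝ := inner ℝ (lead 1 (vecA z) n) (n : E3)
/-- The leading angular components `Ā_A`, as a tangent vector. -/
def barAang (z : Config) : S2 → E3 := tang (lead 1 (vecA z))
/-- The leading radial component `π̄^r / √γ`. -/
def barPr (z : Config) (n : S2) : ℝ := inner ℝ (lead 2 (momA z) n) (n : E3)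
/-- The leading angular components `π̄^A / √γ`, as a tangent vector. -/
def barPang (z : Config) : S2 → E3 := tang (lead 2 (momA z))
/-- The leading term `Ψ̄`. -/
def barPsi (z : Config) : S2 → ℝ := lead 1 (psi z)

/-- The two sets of conditions on the angular components: the twisted parity conditions for
vanishing magnetic charge, and the conditions adapted to magnetic sources. -/
inductive AngularBC where
  | twisted
  | magnetic

/-- The parity conditions on the leading angular components. The statement
"`Ā_A(-x^B) = ± Ā_A(x^B)`" for the components of a one-form reads `Ā(-n) = ± Ā(n)` for the
corresponding tangent vector of `E3`, since the differential of the antipodal map is `-1`;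
similarly for `π̄^A`. -/
def AngularParity : AngularBC → Config → Prop
  | .twisted, z =>
      (∃ Φ : S2 → ℝ, SphereSmooth Φ ∧ (∀ n, Φ (-n) = -Φ n) ∧
        ∀ n, barAang z (-n) = -barAang z n + sgrad Φ n) ∧
      ∀ n, barPang z (-n) = barPang z n
  | .magnetic, z =>
      (∃ (Aeven : S2 → E3) (Φ : S2 → ℝ), SphereSmooth Φ ∧ (∀ n, Aeven (-n) = Aeven n) ∧
        ∀ n, barAang z n = Aeven n + sgrad Φ n) ∧
      ∀ n, barPang z (-n) = -barPang z n

/-- The phase space: fall-off, parity of the radial components, parity of the angular components,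
and the asymptotic Gauss law `∂_A π̄^A = 0`. -/
def phaseSpace (c : AngularBC) : Set Config :=
  {z | HasExpansion 1 1 (vecA z) ∧ HasExpansion 2 1 (momA z) ∧ HasExpansion 1 1 (psi z) ∧
    HasExpansion 3 0 (momPsi z) ∧
    (∀ n, barAr z (-n) = -barAr z n) ∧ (∀ n, barPr z (-n) = barPr z n) ∧
    AngularParity c z ∧ ∀ n, sdiv (barPang z) n = 0}

/-- The constraint surface `π_Ψ ≈ 0`, `𝒢 = -∂_i π^i ≈ 0`. -/
def OnShell (z : Config) : Prop := (∀ x, momPsi z x = 0) ∧ ∀ x, dvg (momA z) x = 0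

/-! ### The symplectic structure of the extended action -/

/-- Density of the bulk part `π^i ∂_t A_i + π_Ψ ∂_t Ψ` of the kinetic term, with `w = ∂_t z`. -/
def kinDensity (z w : Config) (x : E3) : ℝ :=
  inner ℝ (momA z x) (vecA w x) + momPsi z x * psi w x

/-- The kinetic term `∫ d³x (π^i ∂_t A_i + π_Ψ ∂_t Ψ) - ∮ d²x √γ Ā_r ∂_t Ψ̄` of the extended
action, with `w = ∂_t z`; as a one-form on phase space it is the symplectic potential. -/
def kinetic (z w : Config) : ℝ :=
  bulkInt (kinDensity z w) - sphereInt (fun n => barAr z n * barPsi w n)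

/-- The symplectic form
`Ω = ∫ d³x (d_V π^i d_V A_i + d_V π_Ψ d_V Ψ) - ∮ d²x √γ d_V Ā_r d_V Ψ̄`, the exterior derivative
of the symplectic potential. -/
def symp (v w : Config) : ℝ := kinetic v w - kinetic w v

/-- `X` is a hamiltonian vector field with generator `F`: it is tangent to phase space, that is,
it preserves the boundary conditions, and `d_V F = - i_X Ω`. -/
def IsHamiltonian (c : AngularBC) (F : Config → ℝ) (X : Config → Config) : Prop :=
  (∀ z ∈ phaseSpace c, X z ∈ phaseSpace c) ∧
  ∀ z ∈ phaseSpace c, ∀ w ∈ phaseSpace c,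
    HasDerivAt (fun t : ℝ => F (z + t • w)) (-symp (X z) w) 0

/-- `{F₁, F₂} = H` on phase space, where `{F₁, F₂} = i₁ i₂ Ω = Ω(X₂, X₁)` for allowed (i.e.
admitting a hamiltonian vector field) functionals `F₁` and `F₂`. -/
def PoissonEq (c : AngularBC) (F₁ F₂ H : Config → ℝ) : Prop :=
  (∃ X, IsHamiltonian c F₁ X) ∧ (∃ X, IsHamiltonian c F₂ X) ∧
  ∀ X₁ X₂, IsHamiltonian c F₁ X₁ → IsHamiltonian c F₂ X₂ →
    ∀ z ∈ phaseSpace c, symp (X₂ z) (X₁ z) = H z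

/-! ### The Poincaré algebra -/

/-- Indices of `5 × 5` matrices: time, space, and the affine direction. -/
abbrev PIdx : Type := Unit ⊕ Fin 3 ⊕ Unit

/-- The time index. -/
abbrev tm : PIdx := Sum.inl ()
/-- The space indices. -/
abbrev sp (i : Fin 3) : PIdx := Sum.inr (Sum.inl i)
/-- The affine index. -/
abbrev af : PIdx := Sum.inr (Sum.inr ())

/-- The Minkowski signature `(-,+,+,+)`, extended by `0` in the affine direction. -/
def eta : PIdx → ℝ
  | Sum.inl _ => -1
  | Sum.inr (Sum.inl _) => 1
  | Sum.inr (Sum.inr _) => 0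

section

attribute [local instance] LieRing.ofAssociativeRing

/-- The Poincaré algebra `iso(1,3)`, as a matrix Lie algebra: the infinitesimal affine isometries
`(t, x, 1) ↦ (t, x, 1) N` of Minkowski spacetime (acting on row vectors). -/
def poincareAlgebra : LieSubalgebra ℝ (Matrix PIdx PIdx ℝ) where
  carrier := {N | (∀ i, N i af = 0) ∧
    ∀ i j, i ≠ af → j ≠ af → N i j * eta j + N j i * eta i = 0}
  zero_mem' := by simp
  add_mem' := by
    rintro M N ⟨hM, hM'⟩ ⟨hN, hN'⟩
    refine ⟨fun i => by simp [hM i, hN i], fun i j hi hj => ?_⟩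
    have h1 := hM' i j hi hj
    have h2 := hN' i j hi hj
    simp only [Matrix.add_apply]
    linarith
  smul_mem' := by
    rintro a M ⟨hM, hM'⟩
    refine ⟨fun i => by simp [hM i], fun i j hi hj => ?_⟩
    have h1 := hM' i j hi hj
    simp only [Matrix.smul_apply, smul_eq_mul]
    linear_combination a * h1
  lie_mem' := by
    rintro M N ⟨hM, hM'⟩ ⟨hN, hN'⟩
    have sq : ∀ k : PIdx, k ≠ af → eta k * eta k = 1 := by
      rintro (_ | _ | _) hk <;> simp_all [eta]
    refine ⟨fun i => by simp [Ring.lie_def, Matrix.mul_apply, hM, hN], fun i j hi hj => ?_⟩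
    have key : ∀ k : PIdx,
        (M i k * N k j - N i k * M k j) * eta j + (M j k * N k i - N j k * M k i) * eta i = 0 := by
      intro k
      by_cases hk : k = af
      · subst hk
        simp [hM, hN]
      · have a1 := hM' i k hi hk
        have a2 := hM' j k hj hk
        have b1 := hN' i k hi hk
        have b2 := hN' j k hj hk
        have s := sq k hk
        have e1 : M i k = -(M k i * eta i * eta k) := by linear_combination eta k * a1 - M i k * s
        have e2 : M j k = -(M k j * eta j * eta k) := by linear_combination eta k * a2 - M j k * s
        have e3 : N i k = -(N k i * eta i * eta k) := by linear_combination eta k * b1 - N i k * s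
        have e4 : N j k = -(N k j * eta j * eta k) := by linear_combination eta k * b2 - N j k * s
        rw [e1, e2, e3, e4]
        ring
    have := Finset.sum_eq_zero (s := Finset.univ) (fun k _ => key k)
    simp only [Ring.lie_def, Matrix.sub_apply, Matrix.mul_apply]
    rw [← this]
    simp only [Finset.sum_add_distrib, ← Finset.sum_mul, Finset.sum_sub_distrib]

end

/-- The normal component `ξ = b_i x^i + a^⊥` (at `t = 0`) of a Poincaré transformation. -/
def lapse (p : poincareAlgebra) (x : E3) : ℝ := ∑ i, p.1 (sp i) tm * x i + p.1 af tm

/-- The tangential components `ξ^i = b^i_j x^j + a^i` (at `t = 0`) of a Poincaré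
transformation. -/
def shift (p : poincareAlgebra) (x : E3) : E3 :=
  WithLp.toLp 2 (fun j => ∑ i, p.1 (sp i) (sp j) * x i + p.1 af (sp j))

/-- The function `b` on the sphere, with `ξ = r b + T`. -/
def bfun (p : poincareAlgebra) (n : S2) : ℝ := ∑ i, p.1 (sp i) tm * (n : E3) i

/-- The rotation Killing vector field `Y^A` of the sphere, as a tangent vector field. -/
def yvec (p : poincareAlgebra) (n : S2) : E3 :=
  WithLp.toLp 2 (fun j => ∑ i, p.1 (sp i) (sp j) * (n : E3) i)

/-! ### Generators -/

/-- `ℋ^EM = -Ψ ∂_i π^i - A_i ∇^i π_Ψ + ½ π_i π^i + ¼ F_{ij} F^{ij}`. -/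
def hamDensity (z : Config) (x : E3) : ℝ :=
  -(psi z x * dvg (momA z) x) - ∑ i, vecA z x i * pd i (momPsi z) x
    + (1 / 2) * ∑ i, momA z x i ^ 2 + (1 / 4) * ∑ i, ∑ j, fstr (vecA z) i j x ^ 2

/-- `ℋ^EM_i = F_{ij} π^j - A_i ∂_j π^j + π_Ψ ∂_i Ψ`. -/
def momDensity (z : Config) (i : Fin 3) (x : E3) : ℝ :=
  ∑ j, fstr (vecA z) i j x * momA z x j - vecA z x i * dvg (momA z) x
    + momPsi z x * pd i (psi z) x

/-- Bulk density of the Poincaré generator. -/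
def poincareDensity (p : poincareAlgebra) (z : Config) (x : E3) : ℝ :=
  lapse p x * hamDensity z x + ∑ i, shift p x i * momDensity z i x

/-- Surface density of the Poincaré generator:
`b (Ψ̄ π̄^r + √γ Ā_A D̄^A Ā_r) + Y^A (Ā_A π̄^r + √γ Ψ̄ ∂_A Ā_r)`, divided by `√γ`. -/
def poincareSurface (p : poincareAlgebra) (z : Config) (n : S2) : ℝ :=
  bfun p n * (barPsi z n * barPr z n + inner ℝ (barAang z n) (sgrad (barAr z) n))
    + (inner ℝ (yvec p n) (barAang z n) * barPr z n
      + barPsi z n * inner ℝ (yvec p n) (sgrad (barAr z) n))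

/-- The Poincaré generator `P_{ξ, ξ^i}`. -/
def poincareGen (p : poincareAlgebra) (z : Config) : ℝ :=
  bulkInt (poincareDensity p z) + sphereInt (poincareSurface p z)

/-- The Poincaré transformation of the fields:
`δA_i = ξ π_i + ∂_i(ξ Ψ) + ℒ_{ξ^k} A_i`,
`δπ^i = ∂_m(ξ F^{mi}) + ξ ∇^i π_Ψ + ℒ_{ξ^k} π^i`,
`δΨ = ∇^i(ξ A_i) + ξ^i ∂_i Ψ`,
`δπ_Ψ = ξ ∂_i π^i + ∂_i(ξ^i π_Ψ)`. -/
def poincareVF (p : poincareAlgebra) (z : Config) : Config :=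
  (fun x => WithLp.toLp 2 (fun i =>
      lapse p x * momA z x i + pd i (fun y => lapse p y * psi z y) x
        + ∑ j, (shift p x j * pd j (fun y => vecA z y i) x
          + vecA z x j * pd i (fun y => shift p y j) x)),
   fun x => WithLp.toLp 2 (fun i =>
      ∑ m, pd m (fun y => lapse p y * fstr (vecA z) m i y) x + lapse p x * pd i (momPsi z) x
        + ∑ m, (pd m (fun y => shift p y m * momA z y i) x
          - pd m (fun y => shift p y i) x * momA z x m)),
   fun x => dvg (fun y => lapse p y • vecA z y) x + ∑ i, shift p x i * pd i (psi z) x,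
   fun x => lapse p x * dvg (momA z) x + dvg (fun y => momPsi z y • shift p y) x)

/-- Admissible (field-independent) `u(1)` parameters: `μ = μ̄/r + μ⁽¹⁾/r² + o(r⁻²)`,
`ε = ε̄ + ε⁽¹⁾/r + o(r⁻¹)`. -/
def IsGaugeParam (μ ε : E3 → ℝ) : Prop := HasExpansion 1 1 μ ∧ HasExpansion 0 1 ε

/-- Bulk density `μ π_Ψ + ε 𝒢`, with `𝒢 = -∂_i π^i`. -/
def gaugeDensity (μ ε : E3 → ℝ) (z : Config) (x : E3) : ℝ :=
  μ x * momPsi z x + ε x * (-dvg (momA z) x)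

/-- Density of the `u(1)` charges: `ε̄ π̄^r - √γ μ̄ Ā_r`, divided by `√γ`. -/
def chargeDensity (μbar εbar : S2 → ℝ) (z : Config) (n : S2) : ℝ :=
  εbar n * barPr z n - μbar n * barAr z n

/-- The angle-dependent `u(1)` charge `∮ d²x (ε̄ π̄^r - √γ μ̄ Ā_r)`. -/
def charge (μbar εbar : S2 → ℝ) (z : Config) : ℝ := sphereInt (chargeDensity μbar εbar z)

/-- The `u(1)` generator `G_{μ, ε}`. -/
def gaugeGen (μ ε : E3 → ℝ) (z : Config) : ℝ :=
  bulkInt (gaugeDensity μ ε z) + charge (lead 1 μ) (lead 0 ε) z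

/-- The `u(1)` transformation `δA_i = ∂_i ε`, `δΨ = μ`, `δπ^i = 0`, `δπ_Ψ = 0`. -/
def gaugeVF (μ ε : E3 → ℝ) (_ : Config) : Config :=
  (fun x => WithLp.toLp 2 (fun i => pd i ε x), fun _ => 0, μ, fun _ => 0)

/-- Density of the electromagnetic energy `½ π_i π^i + ¼ F_{ij} F^{ij}`. -/
def energyDensity (z : Config) (x : E3) : ℝ :=
  (1 / 2) * ∑ i, momA z x i ^ 2 + (1 / 4) * ∑ i, ∑ j, fstr (vecA z) i j x ^ 2

/-- The Hamiltonian of the extended action with Lagrange multipliers `A_t` and `lam`, completed by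
the surface terms at infinity associated with the multipliers. -/
def hamiltonian (lam At : E3 → ℝ) (z : Config) : ℝ :=
  bulkInt (energyDensity z) + gaugeGen lam At z

/-- The flat Laplacian-type operator `∇^i(ξ ∂_i ε)`. -/
def dxd (ξ ε : E3 → ℝ) (x : E3) : ℝ := ∑ i, pd i (fun y => ξ y * pd i ε y) x

/-- The derivative `ξ^i ∂_i f`. -/
def along (v : E3 → E3) (f : E3 → ℝ) (x : E3) : ℝ := ∑ i, v x i * pd i f x

/-! ### The abelian algebra of angle-dependent `u(1)` transformations -/

/-- Pairs `(ε̄, μ̄)` of smooth functions on the sphere, `ε̄` even and `μ̄` odd. -/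
def u1Algebra : Submodule ℝ ((S2 → ℝ) × (S2 → ℝ)) where
  carrier := {k | SphereSmooth k.1 ∧ SphereSmooth k.2 ∧ (∀ n, k.1 (-n) = k.1 n) ∧
    ∀ n, k.2 (-n) = -k.2 n}
  zero_mem' := by
    have h : SphereSmooth (0 : S2 → ℝ) := by
      have : radialExt (0 : S2 → ℝ) = fun _ => 0 := by
        ext x; unfold radialExt; split_ifs <;> rfl
      unfold SphereSmooth
      rw [this]
      exact contDiffOn_const
    exact ⟨h, h, by simp, by simp⟩
  add_mem' := by
    have h : ∀ f g : S2 → ℝ, SphereSmooth f → SphereSmooth g → SphereSmooth (f + g) := by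
      intro f g hf hg
      have : radialExt (f + g) = fun x => radialExt f x + radialExt g x := by
        ext x; unfold radialExt; split_ifs <;> simp
      unfold SphereSmooth
      rw [this]
      exact ContDiffOn.add hf hg
    rintro k l ⟨h1, h2, h3, h4⟩ ⟨g1, g2, g3, g4⟩
    refine ⟨h _ _ h1 g1, h _ _ h2 g2, fun n => ?_, fun n => ?_⟩
    · simp [h3 n, g3 n]
    · simp only [Prod.snd_add, Pi.add_apply, h4 n, g4 n]
      ring
  smul_mem' := by
    have h : ∀ (a : ℝ) (f : S2 → ℝ), SphereSmooth f → SphereSmooth (a • f) := by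
      intro a f hf
      have : radialExt (a • f) = fun x => a • radialExt f x := by
        ext x; unfold radialExt; split_ifs <;> simp
      unfold SphereSmooth
      rw [this]
      exact ContDiffOn.const_smul a hf
    rintro a k ⟨h1, h2, h3, h4⟩
    refine ⟨h _ _ h1, h _ _ h2, fun n => ?_, fun n => ?_⟩
    · simp [h3 n]
    · simp [h4 n]

/-- The `u(1)` algebra is abelian. -/
instance : LieRing u1Algebra where
  bracket _ _ := 0
  add_lie _ _ _ := by simp
  lie_add _ _ _ := by simp
  lie_self _ := rfl
  leibniz_lie _ _ _ := by simp

instance : LieAlgebra ℝ u1Algebra where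
  lie_smul a _ _ := (smul_zero a).symm

/-- The bulk parameters `(μ, ε)` are admissible with leading terms `(ε̄, μ̄) = k`. -/
def HasBoundaryValue (μ ε : E3 → ℝ) (k : u1Algebra) : Prop :=
  IsGaugeParam μ ε ∧ lead 0 ε = k.1.1 ∧ lead 1 μ = k.1.2

end EMInfinity

end

open EMInfinity LieAlgebra
open scoped ContDiff Gradient

noncomputable section

namespace EMInfinity

/-! ### Partial derivatives -/

/-! The theorem separates into algebra in the bulk and parity on the sphere at infinity. All
generators are at most quadratic in the fields and all vector fields are affine, so no functional
analysis is needed beyond convergence of integrals over balls.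

Leading coefficients on the sphere are replaced by homogeneous functions on punctured space.
Covariant calculus on the sphere then becomes Cartesian calculus with the commuting derivations `FD
i`, plus Euler's relation (`Homog.euler`), and an identity on the sphere can be checked in `Far`
(`Homog.ext_sph`). Parity is the algebra map `refl`, and the two boundary conditions differ only by
a sign `s` with `s * s = 1` (`LeadCond`).

Two analytic facts suffice. A density of order `r⁻³` whose leading term has zero average over the
sphere has a convergent integral (`bulkTendsto_of_lead1`), and a divergence integrates to its flux
at infinity (`bulkTendsto_div`). For `Ω` the leading average vanishes because the radial product is
odd, while the angular product is odd up to a gradient paired with a divergence-free field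
(`LeadCond.sInt_pairing`).

For a Poincaré transformation `X`, the polarized density of `P` plus the density of `Ω(X z, w)` is
an exact divergence, by an identity of differential polynomials (`Killing.polar_eq`). Its flux, the
surface term of `P` and the surface term of `Ω` add up to a divergence on the sphere with odd radial
part, hence to zero (`Lorentz.sInt_surface`). Therefore `P(z) = -½ Ω(X z, z)` with `Ω(X z, w)`
symmetric in `z` and `w`, and such a functional is Hamiltonian with vector field `X`
(`IsHamiltonian.of_quadratic`). Integrating by parts similarly gives `G = -Ω(X_G, z)` with a
constant vector field `X_G`.

The brackets follow formally. The maps `X` represent the Poincaré algebra exactly, without use of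
the constraints (`Killing.IsBracket.act_eq`), and send pure gauge directions to pure gauge
directions (`Killing.act_gaugeQuad`). By symmetry, `Ω(X_q z, X_p z) = -½ Ω([X_p, X_q] z, z)`, and
the mixed brackets come from moving `X` onto the gauge direction. The semidirect sum is the leading
part of this action on parameters.

For non-triviality, `μ̄` is detected by a radial vector potential with profile `μ̄`. An even `ε̄` is
detected by a radial electric field of profile `ε̄` with its sources in a ball, and a non-constant
one also by a boosted radial vector potential, which satisfies the constraints everywhere. -/

/-- The `i`-th vector of the standard basis. -/
abbrev ev (i : Fin 3) : E3 := EuclideanSpace.single i 1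

theorem isOpen_punctured : IsOpen ({0}ᶜ : Set E3) := isOpen_compl_singleton

theorem contDiffAt_of_punctured {f : E3 → ℝ} (hf : ContDiffOn ℝ ∞ f {0}ᶜ) {x : E3} (hx : x ≠ 0) :
    ContDiffAt ℝ ∞ f x := hf.contDiffAt (isOpen_punctured.mem_nhds hx)

theorem contDiff_pd {f : E3 → ℝ} (hf : ContDiff ℝ ∞ f) (i : Fin 3) : ContDiff ℝ ∞ (pd i f) :=
  (hf.fderiv_right (m := ∞) (by simp)).clm_apply contDiff_const

theorem contDiffOn_pd {f : E3 → ℝ} (hf : ContDiffOn ℝ ∞ f {0}ᶜ) (i : Fin 3) :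
    ContDiffOn ℝ ∞ (pd i f) {0}ᶜ :=
  (hf.fderiv_of_isOpen (m := ∞) isOpen_punctured (by simp)).clm_apply contDiffOn_const

theorem pd_congr {f g : E3 → ℝ} {x : E3} (h : f =ᶠ[𝓝 x] g) (i : Fin 3) : pd i f x = pd i g x := by
  unfold pd; rw [h.fderiv_eq]

theorem pd_congr_on {f g : E3 → ℝ} (h : ∀ x ≠ 0, f x = g x) (i : Fin 3) :
    ∀ x ≠ 0, pd i f x = pd i g x := fun x hx =>
  pd_congr (by filter_upwards [isOpen_punctured.mem_nhds hx] with y hy using h y hy) i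

theorem pd_add {f g : E3 → ℝ} {x : E3} (hf : ContDiffAt ℝ ∞ f x) (hg : ContDiffAt ℝ ∞ g x)
    (i : Fin 3) : pd i (fun y => f y + g y) x = pd i f x + pd i g x := by
  unfold pd
  rw [fderiv_fun_add (hf.differentiableAt (by simp)) (hg.differentiableAt (by simp))]
  rfl

theorem pd_mul {f g : E3 → ℝ} {x : E3} (hf : ContDiffAt ℝ ∞ f x) (hg : ContDiffAt ℝ ∞ g x)
    (i : Fin 3) : pd i (fun y => f y * g y) x = f x * pd i g x + g x * pd i f x := by
  unfold pd
  rw [fderiv_fun_mul (hf.differentiableAt (by simp)) (hg.differentiableAt (by simp))]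
  simp

theorem pd_const_mul (a : ℝ) {f : E3 → ℝ} {x : E3} (hf : ContDiffAt ℝ ∞ f x)
    (i : Fin 3) : pd i (fun y => a * f y) x = a * pd i f x := by
  unfold pd
  rw [fderiv_const_mul (hf.differentiableAt (by simp))]
  simp

/-- The `i`-th coordinate as a continuous linear map. -/
def coordL (i : Fin 3) : E3 →L[ℝ] ℝ := EuclideanSpace.proj i

@[simp] theorem coordL_apply (i : Fin 3) (x : E3) : coordL i x = x i := rfl

theorem pd_coord (i j : Fin 3) (x : E3) : pd i (fun y => y j) x = if i = j then 1 else 0 := by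
  have : fderiv ℝ (fun y : E3 => y j) x = coordL j :=
    (coordL j).fderiv
  unfold pd
  rw [this]
  simp [eq_comm]

theorem contDiff_coord (i : Fin 3) : ContDiff ℝ ∞ (fun y : E3 => y i) :=
  (coordL i).contDiff

theorem pd_pd {f : E3 → ℝ} {x : E3} (hf : ContDiffAt ℝ ∞ f x) (i j : Fin 3) :
    pd i (pd j f) x = fderiv ℝ (fderiv ℝ f) x (ev i) (ev j) := by
  unfold pd
  have h : DifferentiableAt ℝ (fderiv ℝ f) x :=
    (hf.fderiv_right (m := ∞) (by simp)).differentiableAt (by simp)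
  rw [fderiv_clm_apply h (differentiableAt_const _)]
  simp

theorem pd_comm {f : E3 → ℝ} {x : E3} (hf : ContDiffAt ℝ ∞ f x) (i j : Fin 3) :
    pd i (pd j f) x = pd j (pd i f) x := by
  rw [pd_pd hf, pd_pd hf]
  exact (hf.isSymmSndFDerivAt (by
    simpa using show ((2 : ℕ∞) : WithTop ℕ∞) ≤ ∞ from WithTop.coe_le_coe.2 le_top)).eq _ _

theorem fderiv_eq_sum {f : E3 → ℝ} (x v : E3) : fderiv ℝ f x v = ∑ i, v i * pd i f x := by
  have : v = ∑ i, v i • ev i := by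
    ext j; simp [Pi.single_apply]
  conv_lhs => rw [this]
  simp [pd]

/-! ### The algebra of smooth functions on space -/

/-- Smooth functions on the whole space. -/
def bulkAlgebra : Subalgebra ℝ (E3 → ℝ) where
  carrier := {f | ContDiff ℝ ∞ f}
  mul_mem' := fun hf hg => ContDiff.mul (Set.mem_ofPred.1 hf) (Set.mem_ofPred.1 hg)
  add_mem' := fun hf hg => ContDiff.add (Set.mem_ofPred.1 hf) (Set.mem_ofPred.1 hg)
  algebraMap_mem' := fun a => Set.mem_ofPred.2 (contDiff_const (c := a))

/-- Smooth functions on the whole space. -/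
abbrev Bulk : Type := bulkAlgebra

theorem Bulk.contDiff (f : Bulk) : ContDiff ℝ ∞ f.1 := Set.mem_ofPred.1 f.2

/-- A smooth function as an element of `Bulk`. -/
def Bulk.of (f : E3 → ℝ) (hf : ContDiff ℝ ∞ f) : Bulk := ⟨f, Set.mem_ofPred.2 hf⟩

@[simp] theorem Bulk.of_apply (f : E3 → ℝ) (hf : ContDiff ℝ ∞ f) (x : E3) :
    (Bulk.of f hf).1 x = f x := rfl

@[simp] theorem Bulk.add_apply (f g : Bulk) (x : E3) : (f + g).1 x = f.1 x + g.1 x := rfl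
@[simp] theorem Bulk.sub_apply (f g : Bulk) (x : E3) : (f - g).1 x = f.1 x - g.1 x := rfl
@[simp] theorem Bulk.neg_apply (f : Bulk) (x : E3) : (-f).1 x = -f.1 x := rfl
@[simp] theorem Bulk.mul_apply (f g : Bulk) (x : E3) : (f * g).1 x = f.1 x * g.1 x := rfl
@[simp] theorem Bulk.zero_apply (x : E3) : (0 : Bulk).1 x = 0 := rfl
@[simp] theorem Bulk.smul_apply (a : ℝ) (f : Bulk) (x : E3) : (a • f).1 x = a * f.1 x := rfl
@[simp] theorem Bulk.algebraMap_apply (a : ℝ) (x : E3) : (algebraMap ℝ Bulk a).1 x = a := rfl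
@[simp] theorem Bulk.sum_apply {ι : Type*} (s : Finset ι) (f : ι → Bulk) (x : E3) :
    (∑ i ∈ s, f i).1 x = ∑ i ∈ s, (f i).1 x := by
  rw [AddSubmonoidClass.coe_finsetSum, Finset.sum_apply]

theorem Bulk.ext_apply {f g : Bulk} (h : ∀ x, f.1 x = g.1 x) : f = g := Subtype.ext (funext h)

instance : CharZero Bulk :=
  charZero_of_injective_algebraMap (R := ℝ) (A := Bulk) fun _ _ h =>
    congrArg (fun f : Bulk => f.1 0) h

/-- The derivation `∂_i` of the algebra of smooth functions. -/
def BD (i : Fin 3) : Derivation ℝ Bulk Bulk :=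
  Derivation.mk'
    { toFun := fun f => Bulk.of (pd i f.1) (contDiff_pd f.contDiff i)
      map_add' := fun f g => Bulk.ext_apply fun _ => pd_add f.contDiff.contDiffAt g.contDiff.contDiffAt i
      map_smul' := fun a f => Bulk.ext_apply fun _ => pd_const_mul a f.contDiff.contDiffAt i }
    (fun f g => Bulk.ext_apply fun _ => pd_mul f.contDiff.contDiffAt g.contDiff.contDiffAt i)

@[simp] theorem BD_apply (i : Fin 3) (f : Bulk) (x : E3) : (BD i f).1 x = pd i f.1 x := rfl

theorem BD_comm (i j : Fin 3) (f : Bulk) : BD i (BD j f) = BD j (BD i f) :=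
  Bulk.ext_apply fun _ => pd_comm f.contDiff.contDiffAt i j

/-- The Cartesian coordinate `x^i` as a smooth function. -/
def BX (i : Fin 3) : Bulk := Bulk.of (fun x => x i) (contDiff_coord i)

@[simp] theorem BX_apply (i : Fin 3) (x : E3) : (BX i).1 x = x i := rfl

theorem BD_BX (i j : Fin 3) : BD i (BX j) = if i = j then 1 else 0 := by
  refine Bulk.ext_apply fun x => ?_
  rw [BD_apply]
  refine (pd_coord i j x).trans ?_
  split_ifs <;> rfl

/-! ### The algebra of smooth functions on punctured space -/

/-- Punctured space. -/
abbrev Punct : Type := {x : E3 // x ≠ 0}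

/-- Extension by zero of a function on punctured space. -/
def pext (f : Punct → ℝ) (x : E3) : ℝ :=
  open Classical in
  if h : x ≠ 0 then f ⟨x, h⟩ else 0

theorem pext_apply (f : Punct → ℝ) {x : E3} (hx : x ≠ 0) : pext f x = f ⟨x, hx⟩ := by
  simp [pext, hx]

theorem contDiffOn_pext {f : Punct → ℝ} {g : E3 → ℝ} (hg : ContDiffOn ℝ ∞ g {0}ᶜ)
    (h : ∀ x : Punct, f x = g x) : ContDiffOn ℝ ∞ (pext f) {0}ᶜ :=
  hg.congr fun x hx => by rw [pext_apply f hx, h]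

/-- Smooth functions on punctured space. -/
def farAlgebra : Subalgebra ℝ (Punct → ℝ) where
  carrier := {f | ContDiffOn ℝ ∞ (pext f) {0}ᶜ}
  mul_mem' := fun {f g} hf hg => Set.mem_ofPred.2 <|
    contDiffOn_pext (ContDiffOn.mul (Set.mem_ofPred.1 hf) (Set.mem_ofPred.1 hg)) fun x => by
      simp [pext_apply _ x.2]
  add_mem' := fun {f g} hf hg => Set.mem_ofPred.2 <|
    contDiffOn_pext (ContDiffOn.add (Set.mem_ofPred.1 hf) (Set.mem_ofPred.1 hg)) fun x => by
      simp [pext_apply _ x.2]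
  algebraMap_mem' := fun a => Set.mem_ofPred.2 <|
    contDiffOn_pext (g := fun _ => a) contDiffOn_const fun _ => rfl

/-- Smooth functions on punctured space. -/
abbrev Far : Type := farAlgebra

/-- The extension by zero of a smooth function on punctured space. -/
abbrev Far.ex (f : Far) : E3 → ℝ := pext f.1

theorem Far.contDiffOn (f : Far) : ContDiffOn ℝ ∞ f.ex {0}ᶜ := Set.mem_ofPred.1 f.2

theorem Far.contDiffAt (f : Far) (x : Punct) : ContDiffAt ℝ ∞ f.ex x.1 :=
  contDiffAt_of_punctured f.contDiffOn x.2

theorem Far.ex_apply (f : Far) (x : Punct) : f.ex x.1 = f.1 x := pext_apply _ x.2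

theorem Far.ex_of_ne (f : Far) {x : E3} (hx : x ≠ 0) : f.ex x = f.1 ⟨x, hx⟩ := pext_apply _ hx

@[simp] theorem Far.add_apply (f g : Far) (x : Punct) : (f + g).1 x = f.1 x + g.1 x := rfl
@[simp] theorem Far.sub_apply (f g : Far) (x : Punct) : (f - g).1 x = f.1 x - g.1 x := rfl
@[simp] theorem Far.neg_apply (f : Far) (x : Punct) : (-f).1 x = -f.1 x := rfl
@[simp] theorem Far.mul_apply (f g : Far) (x : Punct) : (f * g).1 x = f.1 x * g.1 x := rfl
@[simp] theorem Far.zero_apply (x : Punct) : (0 : Far).1 x = 0 := rfl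
@[simp] theorem Far.one_apply (x : Punct) : (1 : Far).1 x = 1 := rfl
@[simp] theorem Far.smul_apply (a : ℝ) (f : Far) (x : Punct) : (a • f).1 x = a * f.1 x := rfl
@[simp] theorem Far.algebraMap_apply (a : ℝ) (x : Punct) : (algebraMap ℝ Far a).1 x = a := rfl
@[simp] theorem Far.pow_apply (f : Far) (n : ℕ) (x : Punct) : (f ^ n).1 x = f.1 x ^ n := rfl
@[simp] theorem Far.sum_apply {ι : Type*} (s : Finset ι) (f : ι → Far) (x : Punct) :
    (∑ i ∈ s, f i).1 x = ∑ i ∈ s, (f i).1 x := by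
  rw [AddSubmonoidClass.coe_finsetSum, Finset.sum_apply]

theorem Far.ext_apply {f g : Far} (h : ∀ x, f.1 x = g.1 x) : f = g := Subtype.ext (funext h)

instance : CharZero Far :=
  charZero_of_injective_algebraMap (R := ℝ) (A := Far) fun _ _ h =>
    congrArg (fun f : Far => f.1 (⟨ev 0, by simp [ev]⟩ : Punct)) h

/-- The smooth function on punctured space given by a function that is smooth there. -/
def Far.of (g : E3 → ℝ) (hg : ContDiffOn ℝ ∞ g {0}ᶜ) : Far :=
  ⟨fun x => g x.1, Set.mem_ofPred.2 (contDiffOn_pext hg fun _ => rfl)⟩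

@[simp] theorem Far.of_apply (g : E3 → ℝ) (hg : ContDiffOn ℝ ∞ g {0}ᶜ) (x : Punct) :
    (Far.of g hg).1 x = g x.1 := rfl

theorem Far.pd_ex_congr {f : Far} {g : E3 → ℝ} (h : ∀ x : Punct, f.1 x = g x.1) (i : Fin 3)
    (x : Punct) : pd i f.ex x.1 = pd i g x.1 :=
  pd_congr_on (fun y hy => by rw [f.ex_of_ne hy, h]) i x.1 x.2

/-- The derivation `∂_i` of the algebra of smooth functions on punctured space. -/
def FD (i : Fin 3) : Derivation ℝ Far Far :=
  Derivation.mk'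
    { toFun := fun f => Far.of (pd i f.ex) (contDiffOn_pd f.contDiffOn i)
      map_add' := fun f g => Far.ext_apply fun x =>
        (Far.pd_ex_congr (fun y => by simp [Far.ex_apply]) i x).trans
          (pd_add (f.contDiffAt x) (g.contDiffAt x) i)
      map_smul' := fun a f => Far.ext_apply fun x =>
        (Far.pd_ex_congr (fun y => by simp [Far.ex_apply]) i x).trans
          (pd_const_mul a (f.contDiffAt x) i) }
    (fun f g => Far.ext_apply fun x =>
        ((Far.pd_ex_congr (fun y => by simp [Far.ex_apply]) i x).trans
          (pd_mul (f.contDiffAt x) (g.contDiffAt x) i)).trans (by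
            rw [f.ex_apply, g.ex_apply]; rfl))

theorem FD_apply (i : Fin 3) (f : Far) (x : Punct) : (FD i f).1 x = pd i f.ex x.1 := rfl

theorem FD_apply_of {f : Far} {g : E3 → ℝ} (h : ∀ x : Punct, f.1 x = g x.1) (i : Fin 3)
    (x : Punct) : (FD i f).1 x = pd i g x.1 := Far.pd_ex_congr h i x

theorem FD_comm (i j : Fin 3) (f : Far) : FD i (FD j f) = FD j (FD i f) :=
  Far.ext_apply fun x => by
    rw [FD_apply_of (g := pd j f.ex) (fun _ => rfl), FD_apply_of (g := pd i f.ex) (fun _ => rfl)]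
    exact pd_comm (f.contDiffAt x) i j

/-- Restriction of smooth functions to punctured space. -/
def restr : Bulk →ₐ[ℝ] Far where
  toFun f := Far.of f.1 f.contDiff.contDiffOn
  map_one' := rfl
  map_mul' _ _ := rfl
  map_zero' := rfl
  map_add' _ _ := rfl
  commutes' _ := rfl

@[simp] theorem restr_apply (f : Bulk) (x : Punct) : (restr f).1 x = f.1 x.1 := rfl

theorem FD_restr (i : Fin 3) (f : Bulk) : FD i (restr f) = restr (BD i f) :=
  Far.ext_apply fun x => FD_apply_of (fun _ => rfl) i x

/-- The Cartesian coordinate `x^i` on punctured space. -/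
def FX (i : Fin 3) : Far := restr (BX i)

@[simp] theorem FX_apply (i : Fin 3) (x : Punct) : (FX i).1 x = x.1 i := rfl

theorem FD_FX (i j : Fin 3) : FD i (FX j) = if i = j then 1 else 0 := by
  rw [FX, FD_restr, BD_BX]; split_ifs <;> simp

theorem norm_sq_eq (x : E3) : ‖x‖ ^ 2 = ∑ i, x i ^ 2 := by
  rw [EuclideanSpace.norm_sq_eq]; simp

/-- The function `1 / r` on punctured space. -/
def Fr : Far := Far.of (fun x => ‖x‖⁻¹) fun _ hx =>
  ((contDiffAt_norm ℝ hx).inv (norm_ne_zero_iff.2 hx)).contDiffWithinAt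

@[simp] theorem Fr_apply (x : Punct) : Fr.1 x = ‖x.1‖⁻¹ := rfl

/-- The relation between `Fr` and the coordinates, invisible to `ring`; later identities on
punctured space invoke it through `linear_combination`. -/
theorem Fr_sq : Fr ^ 2 * ∑ i, FX i ^ 2 = 1 := Far.ext_apply fun x => by
  have : ‖x.1‖ ≠ 0 := norm_ne_zero_iff.2 x.2
  simp only [Far.mul_apply, Far.pow_apply, Fr_apply, Far.sum_apply, FX_apply, Far.one_apply]
  rw [← norm_sq_eq]
  field_simp

/-- The derivative `∂_i (1 / r) = - x_i / r³`. -/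
theorem FD_Fr (i : Fin 3) : FD i Fr = -(FX i * Fr ^ 3) := by
  -- Differentiating the relation `r⁻² ∑ xⱼ² = 1` determines the derivative of `r⁻¹` algebraically.
  -- The resulting factor `2` is cancelled pointwise.
  have h := congrArg (FD i) Fr_sq
  have hX : FD i (∑ j, FX j ^ 2) = 2 * FX i := by
    simp only [map_sum, Derivation.leibniz_pow, FD_FX]
    simp
  rw [Derivation.leibniz, hX, Derivation.leibniz_pow] at h
  have h0 : FD i 1 = 0 := Derivation.map_one_eq_zero _
  rw [h0] at h
  simp only [smul_eq_mul, nsmul_eq_mul] at h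
  have h2 : (2 : Far) * (FX i * Fr ^ 3 + FD i Fr) = 0 := by
    linear_combination Fr * h - 2 * FD i Fr * Fr_sq
  refine Far.ext_apply fun x => ?_
  have h3 := congrArg (fun f : Far => f.1 x) h2
  have h2x : (2 : Far).1 x = 2 := rfl
  simp only [Far.mul_apply, Far.add_apply, Far.zero_apply, h2x, Far.neg_apply] at h3 ⊢
  linarith

/-- Pull back by the antipodal map. -/
def refl : Far →ₐ[ℝ] Far where
  toFun f := Far.of (fun x => f.ex (-x))
    (ContDiffOn.comp (s := {0}ᶜ) f.contDiffOn contDiff_neg.contDiffOn fun x hx => by simpa using hx)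
  map_one' := Far.ext_apply fun x => by
    simp [pext_apply _ (neg_ne_zero.2 x.2)]
  map_mul' f g := Far.ext_apply fun x => by
    simp [pext_apply _ (neg_ne_zero.2 x.2)]
  map_zero' := Far.ext_apply fun x => by
    simp [pext_apply _ (neg_ne_zero.2 x.2)]
  map_add' f g := Far.ext_apply fun x => by
    simp [pext_apply _ (neg_ne_zero.2 x.2)]
  commutes' a := Far.ext_apply fun x => by
    simp only [Far.of_apply]
    rw [Far.ex_of_ne _ (neg_ne_zero.2 x.2)]; rfl

/-- The antipode of a point of punctured space. -/
def Punct.antipode (x : Punct) : Punct := ⟨-x.1, neg_ne_zero.2 x.2⟩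

theorem refl_apply (f : Far) (x : Punct) : (refl f).1 x = f.1 x.antipode :=
  f.ex_of_ne (neg_ne_zero.2 x.2)

theorem refl_refl (f : Far) : refl (refl f) = f := Far.ext_apply fun x => by
  rw [refl_apply, refl_apply]
  exact congrArg f.1 (Subtype.ext (neg_neg x.1) : x.antipode.antipode = x)

theorem refl_FX (i : Fin 3) : refl (FX i) = -FX i := Far.ext_apply fun x => by
  rw [refl_apply]; rfl

theorem refl_Fr : refl Fr = Fr := Far.ext_apply fun x => by
  rw [refl_apply]; simp [Punct.antipode]

/-- Chain rule for `x ↦ -x`. Differentiation therefore reverses parity, the source of all signs in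
the parity bookkeeping. -/
theorem FD_refl (i : Fin 3) (f : Far) : FD i (refl f) = -refl (FD i f) :=
  Far.ext_apply fun x => by
    rw [Far.neg_apply, refl_apply, FD_apply_of (g := fun y => f.ex (-y))
      (fun y => (refl_apply f y).trans (f.ex_apply y.antipode).symm), FD_apply]
    have h : HasFDerivAt (fun y : E3 => -y) (-ContinuousLinearMap.id ℝ E3) x.1 :=
      (hasFDerivAt_id x.1).neg
    have h' := (((f.contDiffAt x.antipode).differentiableAt (by simp)).hasFDerivAt.comp
      (x := x.1) (f := fun y : E3 => -y) h).fderiv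
    unfold pd
    rw [show (fun y => f.ex (-y)) = f.ex ∘ (fun y : E3 => -y) from rfl, h']
    simp

/-! ### Homogeneous functions -/

/-- Dilation of a point of punctured space. -/
def Punct.scale (t : ℝ) (ht : 0 < t) (x : Punct) : Punct :=
  ⟨t • x.1, smul_ne_zero ht.ne' x.2⟩

/-- `F` is homogeneous of degree `d`. -/
def Homog (d : ℤ) (F : Far) : Prop :=
  ∀ (t : ℝ) (ht : 0 < t) (x : Punct), F.1 (x.scale t ht) = t ^ d * F.1 x

namespace Homog

variable {d e : ℤ} {F G : Far}

theorem add (hF : Homog d F) (hG : Homog d G) : Homog d (F + G) := fun t ht x => by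
  simp only [Far.add_apply, hF t ht x, hG t ht x]; ring

theorem neg (hF : Homog d F) : Homog d (-F) := fun t ht x => by
  simp only [Far.neg_apply, hF t ht x]; ring

theorem sub (hF : Homog d F) (hG : Homog d G) : Homog d (F - G) := by
  rw [sub_eq_add_neg]; exact hF.add hG.neg

theorem zero (d : ℤ) : Homog d 0 := fun t ht x => by simp

theorem mul (hF : Homog d F) (hG : Homog e G) {k : ℤ} (hk : d + e = k := by norm_num) :
    Homog k (F * G) := fun t ht x => by
  simp only [Far.mul_apply, hF t ht x, hG t ht x, ← hk, zpow_add₀ ht.ne']; ring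

theorem const (a : ℝ) : Homog 0 (algebraMap ℝ Far a) := fun t ht x => by simp

theorem smul (a : ℝ) (hF : Homog d F) : Homog d (a • F) := fun t ht x => by
  simp only [Far.smul_apply, hF t ht x]; ring

theorem sum {ι : Type*} (s : Finset ι) {f : ι → Far} (h : ∀ i ∈ s, Homog d (f i)) :
    Homog d (∑ i ∈ s, f i) := fun t ht x => by
  simp only [Far.sum_apply, Finset.mul_sum]
  exact Finset.sum_congr rfl fun i hi => h i hi t ht x

theorem coord (i : Fin 3) : Homog 1 (FX i) := fun t ht x => by
  simp [Punct.scale]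

theorem inv_norm : Homog (-1) Fr := fun t ht x => by
  simp [Punct.scale, norm_smul, abs_of_pos ht, mul_comm]

theorem pow_inv_norm (n : ℕ) : Homog (-n) (Fr ^ n) := fun t ht x => by
  rw [Far.pow_apply, inv_norm t ht x, mul_pow, Far.pow_apply]
  simp

theorem refl (hF : Homog d F) : Homog d (refl F) := fun t ht x => by
  rw [refl_apply, refl_apply, ← hF t ht]
  exact congrArg F.1 (Subtype.ext (smul_neg t x.1).symm)

/-- The equation `F(tx) = t ^ d F(x)` is differentiated in `x` on both sides, and one factor `t` is
cancelled. -/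
theorem deriv (hF : Homog d F) (i : Fin 3) {k : ℤ} (hk : k + 1 = d := by norm_num) :
    Homog k (FD i F) := fun t ht x => by
  have h1 : HasFDerivAt (fun y : E3 => t • y) (t • ContinuousLinearMap.id ℝ E3) x.1 :=
    (hasFDerivAt_id x.1).const_smul t
  have h2 := (((F.contDiffAt (x.scale t ht)).differentiableAt (by simp)).hasFDerivAt.comp
    (x := x.1) (f := fun y : E3 => t • y) h1).fderiv
  have h3 : pd i (fun y => F.ex (t • y)) x.1 = t * (FD i F).1 (x.scale t ht) := by
    unfold pd
    rw [show (fun y => F.ex (t • y)) = F.ex ∘ (fun y : E3 => t • y) from rfl, h2]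
    simp [FD_apply, pd, Punct.scale]
  have h4 : pd i (fun y => F.ex (t • y)) x.1 = t ^ d * (FD i F).1 x := by
    rw [FD_apply, ← pd_const_mul _ (F.contDiffAt x)]
    refine pd_congr_on (fun y hy => ?_) i x.1 x.2
    rw [F.ex_of_ne hy, ← hF t ht]
    exact F.ex_of_ne (smul_ne_zero ht.ne' hy)
  rw [h3, ← hk, zpow_add₀ ht.ne', zpow_one] at h4
  field_simp at h4
  linarith

/-- Here the homogeneity equation is differentiated in `t` at `t = 1`. -/
theorem euler (hF : Homog d F) : ∑ i, FX i * FD i F = (d : Far) * F := Far.ext_apply fun x => by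
  have h1 : HasDerivAt (fun t : ℝ => t • x.1) x.1 1 := by
    simpa using (hasDerivAt_id (1 : ℝ)).smul_const x.1
  have hd : DifferentiableAt ℝ F.ex ((1 : ℝ) • x.1) := by
    rw [one_smul]; exact (F.contDiffAt x).differentiableAt (by simp)
  have h2 := hd.hasFDerivAt.comp_hasDerivAt (1 : ℝ) h1
  have h3 : HasDerivAt (fun t : ℝ => t ^ d * F.1 x) (d * F.1 x) 1 := by
    simpa using (hasDerivAt_zpow d (1 : ℝ) (Or.inl one_ne_zero)).mul_const (F.1 x)
  have h4 : (fun t : ℝ => t ^ d * F.1 x) =ᶠ[𝓝 1] F.ex ∘ fun t : ℝ => t • x.1 := by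
    filter_upwards [lt_mem_nhds (zero_lt_one' ℝ)] with t ht
    rw [← hF t ht]
    exact (F.ex_of_ne (smul_ne_zero ht.ne' x.2)).symm
  have h5 := (h3.congr_of_eventuallyEq h4.symm).unique h2
  have hcast : ((d : Far)).1 x = d := by
    have : ((d : Far)) = algebraMap ℝ Far d := by simp
    rw [this]; rfl
  rw [one_smul, fderiv_eq_sum] at h5
  rw [Far.mul_apply, hcast, h5]
  simp [FD_apply]

/-- Scaling to norm one reduces everything to the sphere. This is how pointwise statements at
infinity become equations in the algebra `Far`. -/
theorem ext_unit (hF : Homog d F) (hG : Homog d G)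
    (h : ∀ x : Punct, ‖x.1‖ = 1 → F.1 x = G.1 x) : F = G := Far.ext_apply fun x => by
  have hx : 0 < ‖x.1‖⁻¹ := inv_pos.2 (norm_pos_iff.2 x.2)
  have := h (x.scale _ hx) (by
    simp [Punct.scale, norm_smul, x.2])
  rw [hF _ hx, hG _ hx] at this
  exact mul_left_cancel₀ (zpow_ne_zero d hx.ne') this

end Homog

/-! ### Symbol classes at infinity -/

/-- Iterated partial derivatives. -/
def iterD : List (Fin 3) → Far → Far
  | [], F => F
  | i :: L, F => iterD L (FD i F)

theorem iterD_add (L : List (Fin 3)) (F G : Far) : iterD L (F + G) = iterD L F + iterD L G := by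
  induction L generalizing F G with
  | nil => rfl
  | cons i L ih => simp only [iterD, map_add, ih]

theorem iterD_smul (L : List (Fin 3)) (a : ℝ) (F : Far) : iterD L (a • F) = a • iterD L F := by
  induction L generalizing F with
  | nil => rfl
  | cons i L ih => simp only [iterD, Derivation.map_smul, ih]

/-- `F = O(r ^ (-k))`, uniformly with all derivatives. -/
def Big (k : ℤ) (F : Far) : Prop := ∀ L : List (Fin 3),
  (iterD L F).ex =O[Bornology.cobounded E3] fun x => ‖x‖ ^ (-(k + L.length))

/-- `F = o(r ^ (-k))`, uniformly with all derivatives. -/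
def Small (k : ℤ) (F : Far) : Prop := ∀ L : List (Fin 3),
  (iterD L F).ex =o[Bornology.cobounded E3] fun x => ‖x‖ ^ (-(k + L.length))

theorem eventually_ne_zero : ∀ᶠ x in Bornology.cobounded E3, x ≠ 0 := by
  filter_upwards [eventually_cobounded_le_norm (E := E3) 1] with x hx h
  rw [h, norm_zero] at hx
  linarith

theorem eventually_ex_add (F G : Far) :
    (F + G).ex =ᶠ[Bornology.cobounded E3] fun x => F.ex x + G.ex x := by
  filter_upwards [eventually_ne_zero] with x hx
  simp [Far.ex_of_ne _ hx]

theorem eventually_ex_mul (F G : Far) :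
    (F * G).ex =ᶠ[Bornology.cobounded E3] fun x => F.ex x * G.ex x := by
  filter_upwards [eventually_ne_zero] with x hx
  simp [Far.ex_of_ne _ hx]

theorem eventually_ex_smul (a : ℝ) (F : Far) :
    (a • F).ex =ᶠ[Bornology.cobounded E3] fun x => a * F.ex x := by
  filter_upwards [eventually_ne_zero] with x hx
  simp [Far.ex_of_ne _ hx]

theorem eventually_zpow_mul {k l m : ℤ} (h : k + l = m) :
    (fun x : E3 => ‖x‖ ^ (-k) * ‖x‖ ^ (-l)) =ᶠ[Bornology.cobounded E3] fun x => ‖x‖ ^ (-m) := by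
  filter_upwards [eventually_ne_zero] with x hx
  rw [← zpow_add₀ (norm_ne_zero_iff.2 hx), ← h]
  congr 1; ring

theorem Small.big {k : ℤ} {F : Far} (h : Small k F) : Big k F := fun L => (h L).isBigO

theorem Big.deriv {k : ℤ} {F : Far} (h : Big k F) (i : Fin 3) : Big (k + 1) (FD i F) := fun L => by
  have := h (i :: L)
  simp only [iterD, List.length_cons] at this
  push_cast at this
  rwa [show k + 1 + (L.length : ℤ) = k + (L.length + 1) by ring]

theorem Small.deriv {k : ℤ} {F : Far} (h : Small k F) (i : Fin 3) : Small (k + 1) (FD i F) :=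
  fun L => by
    have := h (i :: L)
    simp only [iterD, List.length_cons] at this
    push_cast at this
    rwa [show k + 1 + (L.length : ℤ) = k + (L.length + 1) by ring]

theorem Small.add {k : ℤ} {F G : Far} (hF : Small k F) (hG : Small k G) : Small k (F + G) :=
  fun L => by
    rw [iterD_add]
    exact ((hF L).add (hG L)).congr' (eventually_ex_add _ _).symm EventuallyEq.rfl

theorem Small.smul {k : ℤ} {F : Far} (a : ℝ) (hF : Small k F) : Small k (a • F) :=
  fun L => by
    rw [iterD_smul]
    exact ((hF L).const_mul_left a).congr' (eventually_ex_smul _ _).symm EventuallyEq.rfl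

theorem Small.zero (k : ℤ) : Small k 0 := by
  intro L
  have : iterD L 0 = 0 := by simpa using iterD_smul L 0 0
  rw [this]
  have h : (0 : Far).ex = fun _ => 0 := by
    funext x; unfold Far.ex pext; split_ifs <;> rfl
  rw [h]
  exact isLittleO_zero _ _

/-- Induction on the list of derivatives: by Leibniz, one derivative of the product is a sum of two
products of the same kind whose total order is one higher. -/
theorem Big.mul_small {k l m : ℤ} {F G : Far} (hF : Big k F) (hG : Small l G)
    (hm : k + l = m := by norm_num) : Small m (F * G) := by
  intro L
  induction L generalizing k l m F G with
  | nil =>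
    have := (hF []).mul_isLittleO (hG [])
    exact this.congr' (eventually_ex_mul _ _).symm
      (eventually_zpow_mul (by simp; omega))
  | cons i L ih =>
    have h1 := ih hF (hG.deriv i) (m := m + 1) (by omega)
    have h2 := ih (hF.deriv i) hG (m := m + 1) (by omega)
    have h3 := (h1.add h2).congr' (eventually_ex_add _ _).symm EventuallyEq.rfl
    rw [← iterD_add] at h3
    simp only [iterD, Derivation.leibniz, smul_eq_mul, List.length_cons]
    push_cast
    rw [mul_comm G, show m + ((L.length : ℤ) + 1) = m + 1 + L.length by ring]
    exact h3

theorem Big.small {k l : ℤ} {F : Far} (h : Big k F) (hl : l < k) : Small l F := fun L => by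
  refine (h L).trans_isLittleO ?_
  obtain ⟨n, hn⟩ := Int.eq_ofNat_of_zero_le (show 0 ≤ k - l by omega)
  have hn0 : n ≠ 0 := by rintro rfl; simp at hn; omega
  have h1 : Tendsto (fun x : E3 => (‖x‖ ^ n)⁻¹) (Bornology.cobounded E3) (𝓝 0) :=
    ((tendsto_pow_atTop hn0).comp (tendsto_norm_cobounded_atTop (E := E3))).inv_tendsto_atTop
  have h2 := ((isLittleO_one_iff ℝ).2 h1).mul_isBigO
    (isBigO_refl (fun x : E3 => ‖x‖ ^ (-(l + (L.length : ℤ)))) (Bornology.cobounded E3))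
  refine h2.congr' ?_ ?_
  · refine EventuallyEq.trans ?_ (eventually_zpow_mul
      (show (n : ℤ) + (l + L.length) = k + L.length by omega))
    exact .of_forall fun x => by simp
  · exact .of_forall fun x => by simp

/-- The constant is the maximum of `F` on the compact unit sphere; homogeneity propagates the bound
along rays. -/
theorem Homog.isBigO {k : ℤ} {F : Far} (h : Homog (-k) F) :
    F.ex =O[Bornology.cobounded E3] fun x => ‖x‖ ^ (-k) := by
  obtain ⟨C, hC⟩ := (isCompact_sphere (0 : E3) 1).exists_bound_of_continuousOn
    (F.contDiffOn.continuousOn.mono fun x hx => by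
      rintro rfl; simp at hx)
  refine IsBigO.of_bound C ?_
  filter_upwards [eventually_ne_zero] with x hx
  have hx' : 0 < ‖x‖ := norm_pos_iff.2 hx
  have hu : ‖x‖⁻¹ • x ≠ 0 := smul_ne_zero (inv_ne_zero hx'.ne') hx
  have h1 := hC (‖x‖⁻¹ • x) (by simp [norm_smul, hx])
  have h2 := h ‖x‖ hx' ⟨‖x‖⁻¹ • x, hu⟩
  have h3 : Punct.scale ‖x‖ hx' ⟨‖x‖⁻¹ • x, hu⟩ = ⟨x, hx⟩ :=
    Subtype.ext (smul_inv_smul₀ hx'.ne' x)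
  rw [h3, ← F.ex_of_ne hx, ← F.ex_of_ne hu] at h2
  rw [h2, norm_mul, mul_comm]
  gcongr

theorem Homog.big {k : ℤ} {F : Far} (h : Homog (-k) F) : Big k F := by
  intro L
  induction L generalizing k F with
  | nil => simpa [iterD] using h.isBigO
  | cons i L ih =>
    have := ih (h.deriv i (k := -(k + 1)) (by ring))
    simp only [iterD, List.length_cons]
    push_cast
    rwa [show k + ((L.length : ℤ) + 1) = k + 1 + L.length by ring]

/-! ### Leading terms -/

/-- `F = F₀ + o(r ^ (-k))` with `F₀` homogeneous of degree `-k`. -/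
def Lead0 (k : ℤ) (F F0 : Far) : Prop := Homog (-k) F0 ∧ Small k (F - F0)

/-- `F = F₀ + F₁ + o(r ^ (-k - 1))` with `F₀` homogeneous of degree `-k` and `F₁` homogeneous of
degree `-k - 1`. -/
def Lead1 (k : ℤ) (F F0 : Far) : Prop :=
  Homog (-k) F0 ∧ ∃ F1, Homog (-(k + 1)) F1 ∧ Small (k + 1) (F - F0 - F1)

section Lead

variable {k l m : ℤ} {F G F0 G0 : Far}

theorem Lead1.homog (h : Lead1 k F F0) : Homog (-k) F0 := h.1

theorem Lead0.add (hF : Lead0 k F F0) (hG : Lead0 k G G0) : Lead0 k (F + G) (F0 + G0) :=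
  ⟨hF.1.add hG.1, by
    rw [show F + G - (F0 + G0) = (F - F0) + (G - G0) by ring]; exact hF.2.add hG.2⟩

theorem Lead0.smul (a : ℝ) (hF : Lead0 k F F0) : Lead0 k (a • F) (a • F0) :=
  ⟨hF.1.smul a, by rw [← smul_sub]; exact hF.2.smul a⟩

theorem Lead0.neg (hF : Lead0 k F F0) : Lead0 k (-F) (-F0) := by
  simpa using hF.smul (-1)

theorem Lead0.sub (hF : Lead0 k F F0) (hG : Lead0 k G G0) : Lead0 k (F - G) (F0 - G0) := by
  simpa only [sub_eq_add_neg] using hF.add hG.neg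

theorem Lead0.zero (k : ℤ) : Lead0 k 0 0 := ⟨Homog.zero _, by simpa using Small.zero k⟩

theorem Lead0.sum {ι : Type*} (s : Finset ι) {f f0 : ι → Far}
    (h : ∀ i ∈ s, Lead0 k (f i) (f0 i)) : Lead0 k (∑ i ∈ s, f i) (∑ i ∈ s, f0 i) := by
  classical
  induction s using Finset.induction_on with
  | empty => simpa using Lead0.zero k
  | insert a s ha ih =>
    rw [Finset.sum_insert ha, Finset.sum_insert ha]
    exact (h a (Finset.mem_insert_self a s)).add
      (ih fun i hi => h i (Finset.mem_insert_of_mem hi))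

theorem Lead0.deriv (h : Lead0 k F F0) (i : Fin 3) (hm : k + 1 = m := by norm_num) :
    Lead0 m (FD i F) (FD i F0) := by
  subst hm
  exact ⟨h.1.deriv i (by ring), by rw [← map_sub]; exact h.2.deriv i⟩

theorem Lead0.mul (hF : Lead0 k F F0) (hG : Lead0 l G G0) (hm : k + l = m := by norm_num) :
    Lead0 m (F * G) (F0 * G0) := by
  refine ⟨hF.1.mul hG.1 (by omega), ?_⟩
  rw [show F * G - F0 * G0 = F0 * (G - G0) + G0 * (F - F0) + (F - F0) * (G - G0) by ring]
  exact ((hF.1.big.mul_small hG.2 hm).add (hG.1.big.mul_small hF.2 (by omega))).add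
    (hF.2.big.mul_small hG.2 hm)

theorem Lead1.lead0 (h : Lead1 k F F0) : Lead0 k F F0 := by
  obtain ⟨h0, F1, h1, h2⟩ := h
  refine ⟨h0, ?_⟩
  rw [show F - F0 = F1 + (F - F0 - F1) by ring]
  exact (h1.big.small (by omega)).add (h2.big.small (by omega))

theorem Lead1.add (hF : Lead1 k F F0) (hG : Lead1 k G G0) : Lead1 k (F + G) (F0 + G0) := by
  obtain ⟨h0, F1, h1, h2⟩ := hF
  obtain ⟨g0, G1, g1, g2⟩ := hG
  refine ⟨h0.add g0, F1 + G1, h1.add g1, ?_⟩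
  rw [show F + G - (F0 + G0) - (F1 + G1) = (F - F0 - F1) + (G - G0 - G1) by ring]
  exact h2.add g2

theorem Lead1.smul (a : ℝ) (hF : Lead1 k F F0) : Lead1 k (a • F) (a • F0) := by
  obtain ⟨h0, F1, h1, h2⟩ := hF
  refine ⟨h0.smul a, a • F1, h1.smul a, ?_⟩
  rw [← smul_sub, ← smul_sub]
  exact h2.smul a

theorem Lead1.neg (hF : Lead1 k F F0) : Lead1 k (-F) (-F0) := by
  simpa using hF.smul (-1)

theorem Lead1.sub (hF : Lead1 k F F0) (hG : Lead1 k G G0) : Lead1 k (F - G) (F0 - G0) := by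
  simpa only [sub_eq_add_neg] using hF.add hG.neg

theorem Homog.lead1 (h : Homog (-k) F) : Lead1 k F F :=
  ⟨h, 0, Homog.zero _, by simpa using Small.zero _⟩

theorem Lead1.zero (k : ℤ) : Lead1 k 0 0 := (Homog.zero _).lead1

theorem Lead1.sum {ι : Type*} (s : Finset ι) {f f0 : ι → Far}
    (h : ∀ i ∈ s, Lead1 k (f i) (f0 i)) : Lead1 k (∑ i ∈ s, f i) (∑ i ∈ s, f0 i) := by
  classical
  induction s using Finset.induction_on with
  | empty => simpa using Lead1.zero k
  | insert a s ha ih =>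
    rw [Finset.sum_insert ha, Finset.sum_insert ha]
    exact (h a (Finset.mem_insert_self a s)).add
      (ih fun i hi => h i (Finset.mem_insert_of_mem hi))

theorem Lead1.deriv (h : Lead1 k F F0) (i : Fin 3) (hm : k + 1 = m := by norm_num) :
    Lead1 m (FD i F) (FD i F0) := by
  subst hm
  obtain ⟨h0, F1, h1, h2⟩ := h
  refine ⟨h0.deriv i (by ring), FD i F1, h1.deriv i (by ring), ?_⟩
  rw [← map_sub, ← map_sub]
  exact h2.deriv i

theorem Lead1.mul (hF : Lead1 k F F0) (hG : Lead1 l G G0) (hm : k + l = m := by norm_num) :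
    Lead1 m (F * G) (F0 * G0) := by
  obtain ⟨h0, F1, h1, h2⟩ := hF
  obtain ⟨g0, G1, g1, g2⟩ := hG
  refine ⟨h0.mul g0 (by omega), F0 * G1 + F1 * G0,
    (h0.mul g1 (by omega)).add (h1.mul g0 (by omega)), ?_⟩
  -- Every term with a remainder is small because a remainder multiplies a bounded-order factor. The
  -- last term `F1 * G1` contains no remainder, but its order `k + l + 2` is one better than needed.
  rw [show F * G - F0 * G0 - (F0 * G1 + F1 * G0) = F0 * (G - G0 - G1) + G0 * (F - F0 - F1)
    + F1 * (G - G0 - G1) + G1 * (F - F0 - F1) + (F - F0 - F1) * (G - G0 - G1) + F1 * G1 by ring]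
  refine (((((h0.big.mul_small g2 ?_).add (g0.big.mul_small h2 ?_)).add
    ((h1.big.mul_small g2 rfl).big.small ?_)).add
    ((g1.big.mul_small h2 rfl).big.small ?_)).add
    ((h2.big.mul_small g2 rfl).big.small ?_)).add
    ((h1.mul g1 (k := -(k + 1 + (l + 1))) (by ring)).big.small ?_) <;> omega

/-- A function that vanishes to leading order has an expansion with vanishing leading term. -/
theorem Lead0.shift (h : Lead0 m F F0) (hm : k + 1 = m := by norm_num) : Lead1 k F 0 := by
  subst hm
  exact ⟨Homog.zero _, F0, h.1, by simpa using h.2⟩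

theorem Lead1.shift (h : Lead1 m F F0) (hm : k + 1 = m := by norm_num) : Lead1 k F 0 :=
  h.lead0.shift hm

/-- Converse of `Lead0.shift`: once the leading coefficient vanishes, the next one takes its place.
This is how cancellations at leading order gain a power of `r`. -/
theorem Lead1.of_zero (h : Lead1 k F 0) (hm : k + 1 = m := by norm_num) :
    ∃ F1, Lead0 m F F1 := by
  subst hm
  obtain ⟨-, F1, h1, h2⟩ := h
  exact ⟨F1, h1, by simpa using h2⟩

theorem Lead0.shift_zero (h : Lead0 m F F0) (hm : k < m := by norm_num) : Lead0 k F 0 := by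
  refine ⟨Homog.zero _, ?_⟩
  rw [sub_zero, show F = F0 + (F - F0) by ring]
  exact (h.1.big.small hm).add (h.2.big.small hm)

end Lead

/-! ### Comparison with the expansions of the definitions -/

/-! ### Decay of iterated derivatives near infinity. -/

section Iterated

variable {W W' : Type*} [NormedAddCommGroup W] [NormedSpace ℝ W] [NormedAddCommGroup W']
  [NormedSpace ℝ W'] {l : ℕ} {h : E3 → ℝ}

/-- Only a neighbourhood of infinity matters, so different conventions for the value at the origin
are interchangeable. -/
theorem iterated_congr {f g : E3 → W} (hfg : ∀ x ≠ 0, f x = g x)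
    (hf : (fun x => iteratedFDeriv ℝ l f x) =o[Bornology.cobounded E3] h) :
    (fun x => iteratedFDeriv ℝ l g x) =o[Bornology.cobounded E3] h := by
  refine hf.congr' ?_ EventuallyEq.rfl
  filter_upwards [eventually_ne_zero] with x hx
  have : f =ᶠ[𝓝 x] g := by
    filter_upwards [isOpen_punctured.mem_nhds hx] with y hy using hfg y hy
  exact (this.iteratedFDeriv (𝕜 := ℝ) l).eq_of_nhds

theorem iterated_clm {f : E3 → W} (L : W →L[ℝ] W') (hfs : ContDiffOn ℝ ∞ f {0}ᶜ)
    (hf : (fun x => iteratedFDeriv ℝ l f x) =o[Bornology.cobounded E3] h) :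
    (fun x => iteratedFDeriv ℝ l (L ∘ f) x) =o[Bornology.cobounded E3] h := by
  refine IsBigO.trans_isLittleO (IsBigO.of_bound ‖L‖ ?_) hf
  filter_upwards [eventually_ne_zero] with x hx
  exact L.norm_iteratedFDeriv_comp_left (hfs.contDiffAt (isOpen_punctured.mem_nhds hx))
    (by exact_mod_cast le_top)

theorem iterated_add {f g : E3 → W} (hfs : ContDiffOn ℝ ∞ f {0}ᶜ) (hgs : ContDiffOn ℝ ∞ g {0}ᶜ)
    (hf : (fun x => iteratedFDeriv ℝ l f x) =o[Bornology.cobounded E3] h)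
    (hg : (fun x => iteratedFDeriv ℝ l g x) =o[Bornology.cobounded E3] h) :
    (fun x => iteratedFDeriv ℝ l (f + g) x) =o[Bornology.cobounded E3] h := by
  refine (hf.add hg).congr' ?_ EventuallyEq.rfl
  filter_upwards [eventually_ne_zero] with x hx
  have hl : (l : WithTop ℕ∞) ≤ ∞ := by exact_mod_cast le_top
  exact (iteratedFDeriv_add_apply
    ((hfs.contDiffAt (isOpen_punctured.mem_nhds hx)).of_le hl)
    ((hgs.contDiffAt (isOpen_punctured.mem_nhds hx)).of_le hl)).symm

theorem iterated_sum {ι : Type*} (s : Finset ι) {f : ι → E3 → W}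
    (hfs : ∀ i ∈ s, ContDiffOn ℝ ∞ (f i) {0}ᶜ)
    (hf : ∀ i ∈ s, (fun x => iteratedFDeriv ℝ l (f i) x) =o[Bornology.cobounded E3] h) :
    (fun x => iteratedFDeriv ℝ l (fun y => ∑ i ∈ s, f i y) x) =o[Bornology.cobounded E3] h := by
  classical
  induction s using Finset.induction_on with
  | empty =>
    have h0 : (fun _ : E3 => (0 : W)) = 0 := rfl
    simp [h0]
  | insert a s ha ih =>
    have h1 := iterated_add (hfs a (Finset.mem_insert_self a s))
      (ContDiffOn.sum fun i hi => hfs i (Finset.mem_insert_of_mem hi))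
      (hf a (Finset.mem_insert_self a s))
      (ih (fun i hi => hfs i (Finset.mem_insert_of_mem hi))
        fun i hi => hf i (Finset.mem_insert_of_mem hi))
    refine iterated_congr (fun x _ => ?_) h1
    simp [Finset.sum_insert ha]

end Iterated

theorem FD_ex (i : Fin 3) (F : Far) {x : E3} (hx : x ≠ 0) : (FD i F).ex x = pd i F.ex x := by
  rw [Far.ex_of_ne _ hx]; rfl

theorem contDiffOn_fderiv_ex (F : Far) : ContDiffOn ℝ ∞ (fderiv ℝ F.ex) {0}ᶜ :=
  F.contDiffOn.fderiv_of_isOpen (m := ∞) isOpen_punctured (by simp)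

/-- Each entry of the list of partial derivatives consumes one order: the norm of the iterated
derivative of order `l + 1` of `F` is that of order `l` of `fderiv F`, and evaluation on a basis
vector is continuous and linear. -/
theorem small_of_iterated {k : ℤ} {F : Far}
    (h : ∀ l : ℕ, (fun x => iteratedFDeriv ℝ l F.ex x) =o[Bornology.cobounded E3]
      fun x => ‖x‖ ^ (-(k + l))) : Small k F := by
  intro L
  induction L generalizing k F with
  | nil => exact (isLittleO_norm_left.1 ((h 0).norm_left.congr_left
      fun x => by rw [norm_iteratedFDeriv_zero]; rfl))
  | cons i L ih =>
    have := ih (k := k + 1) (F := FD i F) fun l => by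
      have h1 : (fun x => iteratedFDeriv ℝ l (fderiv ℝ F.ex) x) =o[Bornology.cobounded E3]
          fun x => ‖x‖ ^ (-(k + 1 + l)) := by
        have h2 := (h (l + 1)).norm_left
        simp only [← norm_iteratedFDeriv_fderiv] at h2
        refine isLittleO_norm_left.1 (h2.congr_right fun x => ?_)
        congr 2; push_cast; ring
      exact iterated_congr (fun x hx => (FD_ex i F hx).symm)
        (iterated_clm (ContinuousLinearMap.apply ℝ ℝ (ev i)) (contDiffOn_fderiv_ex F) h1)
    simp only [iterD, List.length_cons]
    push_cast
    rwa [show k + ((L.length : ℤ) + 1) = k + 1 + L.length by ring]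

/-- The converse direction rebuilds `fderiv F` as the finite sum of the partial derivatives times
the coordinate forms, and inducts on the order. -/
theorem Small.iterated {k : ℤ} {F : Far} (h : Small k F) (l : ℕ) :
    (fun x => iteratedFDeriv ℝ l F.ex x) =o[Bornology.cobounded E3]
      fun x => ‖x‖ ^ (-(k + l)) := by
  induction l generalizing k F with
  | zero =>
    refine isLittleO_norm_left.1 ((h []).norm_left.congr_left fun x => ?_)
    rw [norm_iteratedFDeriv_zero]; rfl
  | succ l ih =>
    have h1 : (fun x => iteratedFDeriv ℝ l (fun y => ∑ i, ((ContinuousLinearMap.id ℝ ℝ).smulRight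
        (coordL i)) ((FD i F).ex y)) x) =o[Bornology.cobounded E3]
          fun x => ‖x‖ ^ (-(k + 1 + l)) :=
      iterated_sum Finset.univ
        (fun i _ => ((ContinuousLinearMap.id ℝ ℝ).smulRight (coordL i)).contDiff.comp_contDiffOn
          (FD i F).contDiffOn)
        (fun i _ => iterated_clm _ (FD i F).contDiffOn (ih (h.deriv i)))
    have h2 : (fun x => iteratedFDeriv ℝ l (fderiv ℝ F.ex) x) =o[Bornology.cobounded E3]
          fun x => ‖x‖ ^ (-(k + 1 + l)) := by
      refine iterated_congr (fun x hx => ?_) h1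
      ext v
      rw [fderiv_eq_sum]
      simp [FD_ex _ _ hx, mul_comm]
    have h3 := h2.norm_left
    simp only [norm_iteratedFDeriv_fderiv] at h3
    refine isLittleO_norm_left.1 (h3.congr_right fun x => ?_)
    congr 2; push_cast; ring

/-! ### Restriction to the sphere -/

theorem sphere_ne_zero (n : S2) : (n : E3) ≠ 0 := by
  have := n.2
  rintro h
  simp [h] at this

/-- A point of the sphere as a point of punctured space. -/
def toPunct (n : S2) : Punct := ⟨n, sphere_ne_zero n⟩

/-- Restriction to the unit sphere. -/
def sph (F : Far) (n : S2) : ℝ := F.1 (toPunct n)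

@[simp] theorem sph_add (F G : Far) (n : S2) : sph (F + G) n = sph F n + sph G n := rfl
@[simp] theorem sph_sub (F G : Far) (n : S2) : sph (F - G) n = sph F n - sph G n := rfl
@[simp] theorem sph_neg (F : Far) (n : S2) : sph (-F) n = -sph F n := rfl
@[simp] theorem sph_mul (F G : Far) (n : S2) : sph (F * G) n = sph F n * sph G n := rfl
@[simp] theorem sph_zero (n : S2) : sph 0 n = 0 := rfl
@[simp] theorem sph_smul (a : ℝ) (F : Far) (n : S2) : sph (a • F) n = a * sph F n := rfl
@[simp] theorem sph_sum {ι : Type*} (s : Finset ι) (f : ι → Far) (n : S2) :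
    sph (∑ i ∈ s, f i) n = ∑ i ∈ s, sph (f i) n := Far.sum_apply s f _
@[simp] theorem sph_FX (i : Fin 3) (n : S2) : sph (FX i) n = (n : E3) i := rfl
@[simp] theorem norm_sphere (n : S2) : ‖(n : E3)‖ = 1 := by simp
@[simp] theorem sph_Fr (n : S2) : sph Fr n = 1 := by
  change ‖(n : E3)‖⁻¹ = 1
  simp
@[simp] theorem sph_pow (F : Far) (k : ℕ) (n : S2) : sph (F ^ k) n = sph F n ^ k := rfl

theorem sph_refl (F : Far) (n : S2) : sph (refl F) n = sph F (-n) := refl_apply F _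

theorem Homog.ext_sph {d : ℤ} {F G : Far} (hF : Homog d F) (hG : Homog d G)
    (h : ∀ n, sph F n = sph G n) : F = G :=
  hF.ext_unit hG fun x hx => h ⟨x.1, by simpa using hx⟩

/-- The direction of a point of punctured space. -/
def dir (x : Punct) : S2 := ⟨‖x.1‖⁻¹ • x.1, by simp [norm_smul, x.2]⟩

theorem radialExt_apply {W : Type*} [Zero W] (c : S2 → W) (x : Punct) :
    radialExt c x.1 = c (dir x) := by
  simp [radialExt, x.2, dir]

theorem dir_sphere (n : S2) : dir (toPunct n) = n := Subtype.ext (by simp [dir, toPunct])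

@[simp] theorem radialExt_sphere {W : Type*} [Zero W] (c : S2 → W) (n : S2) :
    radialExt c (n : E3) = c n := by
  rw [show (n : E3) = (toPunct n).1 from rfl, radialExt_apply, dir_sphere]

theorem norm_pos (x : Punct) : 0 < ‖x.1‖ := norm_pos_iff.2 x.2

theorem scale_dir (x : Punct) : (toPunct (dir x)).scale ‖x.1‖ (norm_pos x) = x :=
  Subtype.ext (smul_inv_smul₀ (norm_pos x).ne' x.1)

theorem Homog.apply_eq {d : ℤ} {F : Far} (h : Homog d F) (x : Punct) :
    F.1 x = ‖x.1‖ ^ d * sph F (dir x) := by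
  conv_lhs => rw [← scale_dir x]
  rw [h]; rfl

theorem Homog.apply_eq_inv {k : ℕ} {F : Far} (h : Homog (-k) F) (x : Punct) :
    F.1 x = (‖x.1‖ ^ k)⁻¹ * radialExt (sph F) x.1 := by
  rw [h.apply_eq, radialExt_apply, zpow_neg, zpow_natCast]

theorem SphereSmooth.contDiffOn {c : S2 → ℝ} (hc : SphereSmooth c) :
    ContDiffOn ℝ ∞ (radialExt c) {0}ᶜ := hc

/-- The homogeneous extension of degree `-k` of a smooth function on the sphere. -/
def hom (k : ℕ) (c : S2 → ℝ) (hc : SphereSmooth c) : Far :=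
  Fr ^ k * Far.of (radialExt c) hc.contDiffOn

theorem hom_apply {k : ℕ} {c : S2 → ℝ} (hc : SphereSmooth c) (x : Punct) :
    (hom k c hc).1 x = (‖x.1‖ ^ k)⁻¹ * radialExt c x.1 := by simp [hom]

theorem homog_hom (k : ℕ) {c : S2 → ℝ} (hc : SphereSmooth c) : Homog (-k) (hom k c hc) := by
  refine (Homog.pow_inv_norm k).mul (e := 0) (fun t ht x => ?_) (by ring)
  have : dir (x.scale t ht) = dir x := Subtype.ext (by
    simp only [dir, Punct.scale, norm_smul, Real.norm_eq_abs, abs_of_pos ht, smul_smul]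
    congr 1
    have := (norm_pos x).ne'
    field_simp)
  simp only [Far.of_apply, radialExt_apply, this, zpow_zero, one_mul]

@[simp] theorem sph_hom (k : ℕ) {c : S2 → ℝ} (hc : SphereSmooth c) : sph (hom k c hc) = c := by
  funext n
  rw [sph, hom_apply]
  simp [toPunct]

theorem sphereSmooth_sph (F : Far) : SphereSmooth (sph F) := by
  have h1 : ContDiffOn ℝ ∞ (fun x : E3 => ‖x‖⁻¹ • x) {0}ᶜ := fun x hx =>
    (((contDiffAt_norm ℝ hx).inv (norm_ne_zero_iff.2 hx)).smul contDiffAt_id).contDiffWithinAt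
  have h2 := F.contDiffOn.comp h1 fun x hx =>
    smul_ne_zero (inv_ne_zero (norm_ne_zero_iff.2 hx)) hx
  refine h2.congr fun x hx => ?_
  rw [show x = (⟨x, hx⟩ : Punct).1 from rfl, radialExt_apply]
  exact (F.ex_apply (toPunct (dir ⟨x, hx⟩))).symm

theorem SphereSmooth.clm {W W' : Type*} [NormedAddCommGroup W] [NormedSpace ℝ W]
    [NormedAddCommGroup W'] [NormedSpace ℝ W'] {c : S2 → W} (hc : SphereSmooth c)
    (L : W →L[ℝ] W') : SphereSmooth (fun n => L (c n)) := by
  refine (L.contDiff.comp_contDiffOn hc).congr fun x hx => ?_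
  rw [show x = (⟨x, hx⟩ : Punct).1 from rfl, Function.comp_apply, radialExt_apply, radialExt_apply]

theorem contDiffOn_term {W : Type*} [NormedAddCommGroup W] [NormedSpace ℝ W] {c : S2 → W}
    (hc : SphereSmooth c) (k : ℕ) :
    ContDiffOn ℝ ∞ (fun y : E3 => (‖y‖ ^ k)⁻¹ • radialExt c y) {0}ᶜ := by
  refine ContDiffOn.smul (fun x hx => ?_) hc
  exact (((contDiffAt_norm ℝ hx).pow k).inv
    (pow_ne_zero k (norm_ne_zero_iff.2 hx))).contDiffWithinAt

theorem radialExt_clm {W W' : Type*} [NormedAddCommGroup W] [NormedSpace ℝ W]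
    [NormedAddCommGroup W'] [NormedSpace ℝ W'] (c : S2 → W) (L : W →L[ℝ] W') (x : E3) :
    radialExt (fun n => L (c n)) x = L (radialExt c x) := by
  unfold radialExt; split_ifs <;> simp

theorem HasExpansion.clm {W W' : Type*} [NormedAddCommGroup W] [NormedSpace ℝ W]
    [NormedAddCommGroup W'] [NormedSpace ℝ W'] {k m : ℕ} {f : E3 → W} (h : HasExpansion k m f)
    (L : W →L[ℝ] W') : HasExpansion k m (fun x => L (f x)) := by
  obtain ⟨hf, c, hc, ho⟩ := h
  refine ⟨L.contDiff.comp hf, fun j n => L (c j n), fun j hj => (hc j hj).clm L, fun l => ?_⟩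
  refine iterated_congr (fun x _ => ?_) (iterated_clm L ?_ (ho l))
  · simp [radialExt_clm]
  · exact hf.contDiffOn.sub (ContDiffOn.sum fun j hj =>
      contDiffOn_term (hc j (Nat.lt_succ_iff.1 (Finset.mem_range.1 hj))) _)

theorem HasExpansion.sum {W : Type*} [NormedAddCommGroup W] [NormedSpace ℝ W] {ι : Type*}
    [Fintype ι] {k m : ℕ} {f : ι → E3 → W} (h : ∀ i, HasExpansion k m (f i)) :
    HasExpansion k m (fun x => ∑ i, f i x) := by
  choose hf c hc ho using h
  have hr : ∀ j x, radialExt (fun n => ∑ i, c i j n) x = ∑ i, radialExt (c i j) x := by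
    intro j x; unfold radialExt; split_ifs <;> simp
  refine ⟨ContDiff.sum fun i _ => hf i, fun j n => ∑ i, c i j n, fun j hj => ?_, fun l => ?_⟩
  · exact (ContDiffOn.sum fun i _ => hc i j hj).congr fun x _ => hr j x
  · refine iterated_congr (fun x _ => ?_) (iterated_sum Finset.univ (fun i _ => ?_)
      fun i _ => ho i l)
    · simp only [hr, Finset.sum_sub_distrib, Finset.smul_sum]
      rw [Finset.sum_comm]
    · exact (hf i).contDiffOn.sub (ContDiffOn.sum fun j hj =>
        contDiffOn_term (hc i j (Nat.lt_succ_iff.1 (Finset.mem_range.1 hj))) _)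

theorem hasExpansion_vector_iff {k m : ℕ} {V : E3 → E3} :
    HasExpansion k m V ↔ ∀ i : Fin 3, HasExpansion k m (fun x => V x i) := by
  refine ⟨fun h i => h.clm (coordL i), fun h => ?_⟩
  have h1 := HasExpansion.sum fun i =>
    (h i).clm ((ContinuousLinearMap.id ℝ ℝ).smulRight (ev i))
  convert h1 using 2 with x
  ext j
  simp [Pi.single_apply]

theorem zpow_cast_eq {k l : ℕ} (x : E3) : (‖x‖ ^ (k + l))⁻¹ = ‖x‖ ^ (-((k : ℤ) + l)) := by
  rw [zpow_neg]; norm_cast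

/-- The dictionary between coefficient functions on the sphere and homogeneous functions: `hom` in
one direction, restriction `sph` in the other. -/
theorem hasExpansion_zero_iff {k : ℕ} {f : Bulk} :
    HasExpansion k 0 f.1 ↔ ∃ F0, Lead0 k (restr f) F0 := by
  constructor
  · rintro ⟨-, c, hc, ho⟩
    refine ⟨hom k (c 0) (hc 0 le_rfl), homog_hom k _, small_of_iterated fun l => ?_⟩
    refine (iterated_congr (fun x hx => ?_) (ho l)).congr_right fun x => ?_
    · rw [Far.ex_of_ne _ hx]
      simp [hom_apply]
    · rw [add_zero, zpow_cast_eq]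
  · rintro ⟨F0, h1, h2⟩
    -- Only the coefficient of index `0` enters the expansion, so a constant family is enough.
    refine ⟨f.contDiff, fun _ => sph F0, fun _ _ => sphereSmooth_sph F0, fun l => ?_⟩
    refine (iterated_congr (fun x hx => ?_) (h2.iterated l)).congr_right fun x => ?_
    · rw [Far.ex_of_ne _ hx]
      simp [h1.apply_eq_inv]
    · rw [add_zero, zpow_cast_eq]

theorem hasExpansion_one_iff {k : ℕ} {f : Bulk} :
    HasExpansion k 1 f.1 ↔ ∃ F0, Lead1 k (restr f) F0 := by
  constructor
  · rintro ⟨-, c, hc, ho⟩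
    refine ⟨hom k (c 0) (hc 0 (by norm_num)), homog_hom k _,
      hom (k + 1) (c 1) (hc 1 le_rfl), homog_hom (k + 1) _, small_of_iterated fun l => ?_⟩
    refine (iterated_congr (fun x hx => ?_) (ho l)).congr_right fun x => ?_
    · rw [Far.ex_of_ne _ hx]
      simp [hom_apply, Finset.sum_range_succ, sub_add_eq_sub_sub]
    · rw [zpow_cast_eq]; push_cast; rfl
  · rintro ⟨F0, h1, F1, h2, h3⟩
    refine ⟨f.contDiff, fun j => if j = 0 then sph F0 else sph F1,
      fun j _ => by dsimp only; split_ifs <;> exact sphereSmooth_sph _, fun l => ?_⟩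
    have h2' : Homog (-((k + 1 : ℕ) : ℤ)) F1 := by exact_mod_cast h2
    refine (iterated_congr (fun x hx => ?_) (h3.iterated l)).congr_right fun x => ?_
    · rw [Far.ex_of_ne _ hx]
      simp [h1.apply_eq_inv, h2'.apply_eq_inv, Finset.sum_range_succ, sub_add_eq_sub_sub]
    · rw [zpow_cast_eq]; push_cast; rfl

/-- The leading coefficient is the restriction of the leading term to the sphere. -/
theorem Lead0.tendsto {k : ℕ} {f : Bulk} {F0 : Far} (h : Lead0 k (restr f) F0) (n : S2) :
    Tendsto (fun r : ℝ => r ^ k • f.1 (r • (n : E3))) atTop (𝓝 (sph F0 n)) := by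
  have h1 : Tendsto (fun r : ℝ => r • (n : E3)) atTop (Bornology.cobounded E3) := by
    rw [← tendsto_norm_atTop_iff_cobounded]
    refine (tendsto_abs_atTop_atTop (G := ℝ)).congr fun r => ?_
    simp [norm_smul]
  have h2 := (h.2 []).comp_tendsto h1
  have h3 := h2.tendsto_div_nhds_zero
  have h4 := h3.add_const (sph F0 n)
  rw [zero_add] at h4
  refine h4.congr' ?_
  filter_upwards [eventually_gt_atTop 0] with r hr
  have hx : r • (n : E3) ≠ 0 := smul_ne_zero hr.ne' (sphere_ne_zero n)
  have h5 := h.1 r hr (toPunct n)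
  simp only [Function.comp_apply, iterD]
  rw [Far.ex_of_ne _ hx, Far.sub_apply, restr_apply,
    show (⟨r • (n : E3), hx⟩ : Punct) = (toPunct n).scale r hr from rfl, h5]
  simp only [toPunct, Punct.scale, norm_smul, norm_sphere, Real.norm_eq_abs, abs_of_pos hr]
  have : r ^ k ≠ 0 := pow_ne_zero k hr.ne'
  simp only [List.length_nil, Nat.cast_zero, add_zero, mul_one, zpow_neg, zpow_natCast, sph,
    toPunct, smul_eq_mul]
  field_simp
  ring

theorem Lead0.lead_eq {k : ℕ} {f : Bulk} {F0 : Far} (h : Lead0 k (restr f) F0) :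
    lead k f.1 = sph F0 := funext fun n => (h.tendsto n).limUnder_eq

theorem lead_vector {k : ℕ} {f : Fin 3 → Bulk} {F0 : Fin 3 → Far}
    (h : ∀ i, Lead0 k (restr (f i)) (F0 i)) :
    lead k (fun x => WithLp.toLp 2 fun i => (f i).1 x) = fun n => WithLp.toLp 2 fun i =>
      sph (F0 i) n := funext fun n => by
  refine Tendsto.limUnder_eq ?_
  have h1 : Tendsto (fun r : ℝ => fun i => r ^ k • (f i).1 (r • (n : E3))) atTop
      (𝓝 fun i => sph (F0 i) n) := tendsto_pi_nhds.2 fun i => (h i).tendsto n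
  exact ((PiLp.continuous_toLp 2 _).tendsto _).comp h1

/-! ### Extension into the interior -/

/-- A smooth function that vanishes in the unit ball and is `1` outside the ball of radius `2`. -/
def cutoff (x : E3) : ℝ := Real.smoothTransition (‖x‖ ^ 2 - 1)

theorem cutoff_of_le {x : E3} (h : ‖x‖ ≤ 1) : cutoff x = 0 :=
  Real.smoothTransition.zero_of_nonpos (by nlinarith [norm_nonneg x])

theorem cutoff_of_ge {x : E3} (h : 2 ≤ ‖x‖) : cutoff x = 1 :=
  Real.smoothTransition.one_of_one_le (by nlinarith [norm_nonneg x])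

theorem contDiff_cutoff : ContDiff ℝ ∞ cutoff :=
  Real.smoothTransition.contDiff.comp ((contDiff_norm_sq ℝ).sub contDiff_const)

/-- A smooth function on space that agrees with `F` outside a ball. -/
def fill (F : Far) : Bulk := Bulk.of (fun x => cutoff x * F.ex x) (by
  refine contDiff_iff_contDiffAt.2 fun x => ?_
  by_cases hx : x = 0
  · subst hx
    refine (contDiffAt_const (c := (0 : ℝ))).congr_of_eventuallyEq ?_
    filter_upwards [ball_mem_nhds (0 : E3) one_pos] with y hy
    rw [cutoff_of_le (by simpa using (mem_ball_zero_iff.1 hy).le), zero_mul]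
  · exact contDiff_cutoff.contDiffAt.mul (contDiffAt_of_punctured F.contDiffOn hx))

theorem fill_apply_of_ge (F : Far) (x : Punct) (h : 2 ≤ ‖x.1‖) : (fill F).1 x.1 = F.1 x := by
  simp [fill, cutoff_of_ge h, F.ex_apply]

theorem FD_eq_of_eq_far {F G : Far} (h : ∀ x : Punct, 2 < ‖x.1‖ → F.1 x = G.1 x) (i : Fin 3)
    (x : Punct) (hx : 2 < ‖x.1‖) : (FD i F).1 x = (FD i G).1 x := by
  rw [FD_apply, FD_apply]
  refine pd_congr ?_ i
  filter_upwards [(continuous_norm.tendsto x.1).eventually_const_lt hx] with y hy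
  have hy0 : y ≠ 0 := by rintro rfl; norm_num at hy
  rw [F.ex_of_ne hy0, G.ex_of_ne hy0, h ⟨y, hy0⟩ hy]

theorem small_of_eq_zero_far (k : ℤ) {F : Far} (h : ∀ x : Punct, 2 < ‖x.1‖ → F.1 x = 0) :
    Small k F := by
  intro L
  induction L generalizing k F with
  | nil =>
    refine (isLittleO_zero (E' := ℝ) _ _).congr' ?_ EventuallyEq.rfl
    filter_upwards [eventually_ne_zero, eventually_cobounded_le_norm (E := E3) 3] with x hx hx'
    rw [iterD, Far.ex_of_ne _ hx, h _ (by simpa using by linarith)]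
  | cons i L ih =>
    have := ih (k + 1) (F := FD i F) fun x hx => by
      rw [FD_eq_of_eq_far (G := 0) h i x hx, map_zero]; rfl
    simp only [iterD, List.length_cons]
    push_cast
    rwa [show k + ((L.length : ℤ) + 1) = k + 1 + L.length by ring]

/-- The function and its filling agree beyond radius `2`, so the remainder vanishes there and
satisfies every decay condition. Any homogeneous leading term is thus realized by a smooth field on
the whole space. -/
theorem lead1_fill {k : ℤ} {F : Far} (h : Homog (-k) F) : Lead1 k (restr (fill F)) F :=
  ⟨h, 0, Homog.zero _, small_of_eq_zero_far _ fun x hx => by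
    simp [fill_apply_of_ge F x hx.le]⟩

/-! ### Integration over the sphere -/

theorem continuous_sph (F : Far) : Continuous (sph F) := by
  have h : Continuous (fun n : S2 => F.ex n) :=
    F.contDiffOn.continuousOn.comp_continuous continuous_subtype_val fun n => sphere_ne_zero n
  exact h.congr fun n => F.ex_apply (toPunct n)

theorem integrable_of_continuous_sphere {f : S2 → ℝ} (hf : Continuous f) :
    Integrable f ((volume : Measure E3).toSphere) :=
  hf.integrable_of_hasCompactSupport (HasCompactSupport.of_compactSpace f)

theorem sphereIntegrable_sph (F : Far) : SphereIntegrable (sph F) :=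
  integrable_of_continuous_sphere (continuous_sph F)

/-- The integral over the unit sphere. -/
def sInt : Far →ₗ[ℝ] ℝ where
  toFun F := sphereInt (sph F)
  map_add' F G := integral_add (sphereIntegrable_sph F) (sphereIntegrable_sph G)
  map_smul' a F := integral_const_mul a (sph F)

theorem sInt_apply (F : Far) : sInt F = sphereInt (sph F) := rfl

-- The measure of a subset of the sphere is defined through the volume of the cone over it; the
-- antipodal map reflects this cone, and volume is invariant under reflection.
open scoped Pointwise in
theorem measurePreserving_neg_sphere :
    MeasurePreserving (fun n : S2 => -n) (volume : Measure E3).toSphere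
      (volume : Measure E3).toSphere := by
  refine ⟨continuous_neg.measurable, ?_⟩
  ext s hs
  rw [Measure.map_apply continuous_neg.measurable hs,
    Measure.toSphere_apply' _ (continuous_neg.measurable hs), Measure.toSphere_apply' _ hs]
  congr 1
  rw [← Measure.measure_neg (volume : Measure E3) (Set.Ioo (0 : ℝ) 1 • ((↑) '' s : Set E3))]
  congr 1
  ext x
  simp only [Set.mem_smul, Set.mem_image, Set.mem_preimage, Set.mem_neg]
  constructor
  · rintro ⟨t, ht, _, ⟨n, hn, rfl⟩, rfl⟩
    exact ⟨t, ht, _, ⟨-n, hn, rfl⟩, by simp⟩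
  · rintro ⟨t, ht, _, ⟨n, hn, rfl⟩, h⟩
    exact ⟨t, ht, _, ⟨-n, by simpa using hn, rfl⟩, by simp [h]⟩

theorem sphereInt_neg (f : S2 → ℝ) : sphereInt (fun n => f (-n)) = sphereInt f :=
  measurePreserving_neg_sphere.integral_comp
    (Homeomorph.neg S2).measurableEmbedding f

theorem sphereInt_eq_zero_of_odd {f : S2 → ℝ} (h : ∀ n, f (-n) = -f n) : sphereInt f = 0 := by
  have h1 := sphereInt_neg f
  simp only [h] at h1
  have h2 : sphereInt (fun n => -f n) = -sphereInt f := integral_neg f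
  linarith

theorem sInt_refl (F : Far) : sInt (refl F) = sInt F := by
  rw [sInt_apply, sInt_apply, ← sphereInt_neg (sph F)]
  congr 1
  funext n
  exact sph_refl F n

theorem sInt_eq_zero_of_odd {F : Far} (h : refl F = -F) : sInt F = 0 := by
  have h1 := sInt_refl F
  rw [h, map_neg] at h1
  linarith

theorem sInt_congr_sph {F G : Far} (h : ∀ n, sph F n = sph G n) : sInt F = sInt G := by
  rw [sInt_apply, sInt_apply, funext h]

theorem sInt_sq_pos {F : Far} {n : S2} (h : sph F n ≠ 0) : 0 < sInt (F * F) := by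
  refine (continuous_sph (F * F)).integral_pos_of_hasCompactSupport_nonneg_nonzero (x := n)
    (HasCompactSupport.of_compactSpace _) (fun m => ?_) ?_
  · exact mul_self_nonneg (sph F m)
  · simpa using h

/-! ### Polar coordinates -/

/-- Removing the origin, a null set, leaves the product of the sphere with the half line carrying `r
^ 2 dr`; Fubini's theorem does the rest. -/
theorem polar_integrable {f : E3 → ℝ} (hf : Integrable f) :
    ∫ x, f x = ∫ r in Set.Ioi (0 : ℝ), r ^ 2 * sphereInt (fun n => f (r • (n : E3))) := by
  have hmp := (volume : Measure E3).measurePreserving_homeomorphUnitSphereProd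
  have hdim : Module.finrank ℝ E3 - 1 = 2 := by simp
  rw [hdim] at hmp
  have hemb := (homeomorphUnitSphereProd E3).measurableEmbedding
  have hf1 : Integrable (fun x : ({0}ᶜ : Set E3) => f x.1)
      ((volume : Measure E3).comap Subtype.val) := by
    exact (integrableOn_iff_comap_subtypeVal (f := f)
      (measurableSet_singleton (0 : E3)).compl).1 hf.integrableOn
  have hcomp : (fun x : ({0}ᶜ : Set E3) => f x.1)
      = (fun p : S2 × Set.Ioi (0 : ℝ) => f (p.2.1 • (p.1 : E3))) ∘ homeomorphUnitSphereProd E3 := by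
    funext x
    have h0 : ‖x.1‖ ≠ 0 := norm_ne_zero_iff.2 x.2
    simp [smul_smul, h0]
  have hf2 : Integrable (fun p : S2 × Set.Ioi (0 : ℝ) => f (p.2.1 • (p.1 : E3)))
      ((volume : Measure E3).toSphere.prod (Measure.volumeIoiPow 2)) := by
    rw [hcomp] at hf1
    exact (hmp.integrable_comp_emb hemb).1 hf1
  calc ∫ x, f x = ∫ x : ({0}ᶜ : Set E3), f x.1 ∂((volume : Measure E3).comap Subtype.val) := by
        rw [integral_subtype_comap (measurableSet_singleton _).compl f, restrict_compl_singleton]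
    _ = ∫ p, f (p.2.1 • (p.1 : E3)) ∂((volume : Measure E3).toSphere.prod
          (Measure.volumeIoiPow 2)) := by
        exact (congrArg (fun g => ∫ x, g x ∂((volume : Measure E3).comap Subtype.val)) hcomp).trans
          (hmp.integral_comp hemb (fun p : S2 × Set.Ioi (0 : ℝ) => f (p.2.1 • (p.1 : E3))))
    _ = ∫ r : Set.Ioi (0 : ℝ), sphereInt (fun n => f (r.1 • (n : E3)))
          ∂(Measure.volumeIoiPow 2) := integral_prod_symm _ hf2
    _ = _ := by
        simp only [Measure.volumeIoiPow, ENNReal.ofReal]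
        rw [integral_withDensity_eq_integral_smul,
          integral_subtype_comap measurableSet_Ioi fun r : ℝ =>
            Real.toNNReal (r ^ 2) • sphereInt (fun n => f (r • (n : E3)))]
        · refine setIntegral_congr_fun measurableSet_Ioi fun r hr => ?_
          simp only [NNReal.smul_def, smul_eq_mul]
          rw [Real.coe_toNNReal _ (sq_nonneg r)]
        · exact (measurable_subtype_coe.pow_const _).real_toNNReal

/-- Polar coordinates for the indicator of the ball times `f`, which is integrable although `f` need
not be. -/
theorem polar_ball {f : E3 → ℝ} (hf : Continuous f) {R : ℝ} (hR : 0 ≤ R) :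
    ∫ x in ball (0 : E3) R, f x
      = ∫ r in (0 : ℝ)..R, r ^ 2 * sphereInt (fun n => f (r • (n : E3))) := by
  have hint : Integrable ((ball (0 : E3) R).indicator f) := by
    rw [integrable_indicator_iff measurableSet_ball]
    exact (hf.continuousOn.integrableOn_compact (isCompact_closedBall 0 R)).mono_set
      ball_subset_closedBall
  rw [← integral_indicator measurableSet_ball, polar_integrable hint,
    intervalIntegral.integral_of_le hR, integral_Ioc_eq_integral_Ioo]
  rw [← integral_indicator measurableSet_Ioi, ← integral_indicator measurableSet_Ioo]
  congr 1
  funext r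
  by_cases hr : 0 < r
  · rw [Set.indicator_of_mem (Set.mem_Ioi.2 hr)]
    by_cases hrR : r < R
    · rw [Set.indicator_of_mem (Set.mem_Ioo.2 ⟨hr, hrR⟩)]
      congr 2
      funext n
      rw [Set.indicator_of_mem]
      simpa [norm_smul, abs_of_pos hr] using hrR
    · rw [Set.indicator_of_notMem (by simp [hrR])]
      have : (fun n : S2 => (ball (0 : E3) R).indicator f (r • (n : E3))) = fun _ => 0 := by
        funext n
        rw [Set.indicator_of_notMem]
        simpa [norm_smul, abs_of_pos hr] using hrR
      simp [this, sphereInt]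
  · rw [Set.indicator_of_notMem (by simpa using hr),
      Set.indicator_of_notMem (by simp [hr])]

/-! ### The divergence theorem on the sphere -/

/-- Integration by parts against the constant function `1`. -/
theorem integral_pd_eq_zero {f : E3 → ℝ} (hf : ContDiff ℝ ∞ f) (hc : HasCompactSupport f)
    (i : Fin 3) : ∫ x, pd i f x = 0 := by
  have h := integral_mul_fderiv_eq_neg_fderiv_mul_of_integrable (μ := (volume : Measure E3))
    (f := fun _ => (1 : ℝ)) (g := f) (v := ev i) (by simp)
    (by
      simp only [one_mul]
      exact (contDiff_pd hf i).continuous.integrable_of_hasCompactSupport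
        (hc.fderiv_apply (𝕜 := ℝ) (ev i)))
    (by simpa using hf.continuous.integrable_of_hasCompactSupport hc)
    (fun _ _ => differentiableAt_const _)
    (fun x _ => hf.contDiffAt.differentiableAt (by simp))
  simpa [pd] using h

/-- A bump function on the half line, centred at `1`. -/
def radialBump : ContDiffBump (1 : ℝ) := ⟨1 / 4, 1 / 2, by norm_num, by norm_num⟩

theorem radialBump_of_le {r : ℝ} (h : r ≤ 1 / 2) : radialBump r = 0 :=
  radialBump.zero_of_le_dist (by
    rw [Real.dist_eq, abs_of_nonpos (by linarith)]
    simp only [radialBump]; linarith)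

theorem radialBump_of_ge {r : ℝ} (h : 2 ≤ r) : radialBump r = 0 :=
  radialBump.zero_of_le_dist (by
    rw [Real.dist_eq, abs_of_nonneg (by linarith)]
    simp only [radialBump]; linarith)

/-- A radial test function on punctured space. -/
def farBump : Far := Far.of (fun x => radialBump ‖x‖) fun _ hx =>
  (radialBump.contDiff.contDiffAt.comp _ (contDiffAt_norm ℝ hx)).contDiffWithinAt

@[simp] theorem farBump_apply (x : Punct) : farBump.1 x = radialBump ‖x.1‖ := rfl

/-- The radius on punctured space. -/
def Frad : Far := Far.of (fun x => ‖x‖) fun _ hx => (contDiffAt_norm ℝ hx).contDiffWithinAt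

theorem Frad_eq : Frad = Fr * ∑ i, FX i ^ 2 := Far.ext_apply fun x => by
  have : ‖x.1‖ ≠ 0 := norm_ne_zero_iff.2 x.2
  simp only [Far.mul_apply, Fr_apply, Far.sum_apply, Far.pow_apply, FX_apply, ← norm_sq_eq]
  change ‖x.1‖ = _
  field_simp

theorem FD_Frad (i : Fin 3) : FD i Frad = FX i * Fr := by
  have hX : FD i (∑ j, FX j ^ 2) = 2 * FX i := by
    simp only [map_sum, Derivation.leibniz_pow, FD_FX]
    simp
  rw [Frad_eq, Derivation.leibniz, hX, FD_Fr]
  simp only [smul_eq_mul]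
  linear_combination -FX i * Fr * Fr_sq

theorem FD_farBump (i : Fin 3) (x : Punct) :
    (FD i farBump).1 x = deriv radialBump ‖x.1‖ * (x.1 i * ‖x.1‖⁻¹) := by
  have h1 : pd i (fun y : E3 => ‖y‖) x.1 = x.1 i * ‖x.1‖⁻¹ := by
    have := congrArg (fun F : Far => F.1 x) (FD_Frad i)
    rw [← FD_apply_of (f := Frad) (fun _ => rfl)]
    simpa using this
  rw [FD_apply_of (g := fun y => radialBump ‖y‖) (fun _ => rfl), ← h1]
  have hn : HasFDerivAt (fun y : E3 => ‖y‖) (fderiv ℝ (fun y : E3 => ‖y‖) x.1) x.1 :=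
    ((contDiffAt_norm ℝ x.2).differentiableAt (n := ∞) (by simp)).hasFDerivAt
  have hb : HasDerivAt radialBump (deriv radialBump ‖x.1‖) ‖x.1‖ :=
    (radialBump.contDiff (n := ⊤)).contDiffAt.differentiableAt (by simp) |>.hasDerivAt
  have := (hb.comp_hasFDerivAt x.1 hn).fderiv
  unfold pd
  rw [show (fun y : E3 => radialBump ‖y‖) = radialBump ∘ (fun y : E3 => ‖y‖) from rfl, this]
  simp

/-- The extension by zero of the product of a radial test function with a function on punctured
space. -/
def bumpMul (F : Far) : Bulk := Bulk.of (farBump * F).ex (by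
  refine contDiff_iff_contDiffAt.2 fun x => ?_
  by_cases hx : x = 0
  · subst hx
    refine (contDiffAt_const (c := (0 : ℝ))).congr_of_eventuallyEq ?_
    filter_upwards [ball_mem_nhds (0 : E3) (show (0 : ℝ) < 1 / 2 by norm_num)] with y hy
    have hy' := (mem_ball_zero_iff.1 hy).le
    by_cases h0 : y = 0
    · simp [Far.ex, pext, h0]
    · rw [Far.ex_of_ne _ h0, Far.mul_apply]
      simp [radialBump_of_le hy']
  · exact contDiffAt_of_punctured (farBump * F).contDiffOn hx)

theorem hasCompactSupport_bumpMul (F : Far) : HasCompactSupport (bumpMul F).1 := by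
  refine HasCompactSupport.intro (isCompact_closedBall (0 : E3) 2) fun x hx => ?_
  have hx' : 2 ≤ ‖x‖ := by simpa using (not_le.1 (by simpa using hx)).le
  have h0 : x ≠ 0 := by rintro rfl; norm_num at hx'
  change (farBump * F).ex x = 0
  rw [Far.ex_of_ne _ h0, Far.mul_apply]
  simp [radialBump_of_ge hx']

theorem integrable_BD_bumpMul (F : Far) (i : Fin 3) : Integrable (BD i (bumpMul F)).1 :=
  (BD i (bumpMul F)).contDiff.continuous.integrable_of_hasCompactSupport
    ((hasCompactSupport_bumpMul F).fderiv_apply (𝕜 := ℝ) (ev i))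

theorem BD_bumpMul_apply (F : Far) (i : Fin 3) (x : Punct) : (BD i (bumpMul F)).1 x.1 =
    radialBump ‖x.1‖ * (FD i F).1 x
      + deriv radialBump ‖x.1‖ * (‖x.1‖⁻¹ * (x.1 i * F.1 x)) := by
  have h : restr (bumpMul F) = farBump * F := Far.ext_apply fun x => Far.ex_apply _ x
  rw [← restr_apply, ← FD_restr, h, Derivation.leibniz]
  simp only [smul_eq_mul, Far.add_apply, Far.mul_apply, FD_farBump, farBump_apply]
  ring

/-- For a radial cutoff `χ`, `div (χ W) = χ div W + χ' (x · W) / r`. With `W` of degree `-2`, the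
two terms scale on the sphere of radius `r` like `χ r⁻³` and `χ' r⁻²`, which separates the angular
integrals from the radial ones. -/
theorem sphereInt_BD_bumpMul {W : Fin 3 → Far} (hW : ∀ i, Homog (-2) (W i)) {r : ℝ} (hr : 0 < r) :
    r ^ 2 * sphereInt (fun n => ∑ i, (BD i (bumpMul (W i))).1 (r • (n : E3)))
      = sInt (∑ i, FD i (W i)) * (radialBump r * r⁻¹)
        + sInt (∑ i, FX i * W i) * deriv radialBump r := by
  have hdiv : Homog (-3) (∑ i, FD i (W i)) := Homog.sum _ fun i _ => (hW i).deriv i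
  have hrad : Homog (-1) (∑ i, FX i * W i) := Homog.sum _ fun i _ => (Homog.coord i).mul (hW i)
  have h3 : (fun n : S2 => ∑ i, (BD i (bumpMul (W i))).1 (r • (n : E3))) = sph
      ((radialBump r * r ^ (-3 : ℤ)) • (∑ i, FD i (W i))
        + (deriv radialBump r * r⁻¹ * r ^ (-1 : ℤ)) • ∑ i, FX i * W i) := by
    funext n
    have hnorm : ‖((toPunct n).scale r hr).1‖ = r := by
      simp [Punct.scale, toPunct, norm_smul, abs_of_pos hr]
    have h5 := hdiv r hr (toPunct n)
    have h6 := hrad r hr (toPunct n)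
    have h4 : ∀ i, (BD i (bumpMul (W i))).1 (r • (n : E3)) =
        radialBump r * (FD i (W i)).1 ((toPunct n).scale r hr)
          + deriv radialBump r * (r⁻¹ * (FX i * W i).1 ((toPunct n).scale r hr)) := by
      intro i
      have := BD_bumpMul_apply (W i) i ((toPunct n).scale r hr)
      rw [hnorm] at this
      exact this
    simp only [h4, Finset.sum_add_distrib, ← Finset.mul_sum, ← Far.sum_apply, h5, h6, sph_add,
      sph_smul]
    simp only [sph]
    ring
  rw [h3, ← sInt_apply, map_add, map_smul, map_smul]
  simp only [smul_eq_mul]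
  have := hr.ne'
  rw [zpow_neg, zpow_neg]
  norm_cast
  field_simp

theorem integral_radialBump_deriv : ∫ r in Set.Ioi (0 : ℝ), deriv radialBump r = 0 := by
  have := radialBump.hasCompactSupport.integral_Ioi_deriv_eq (radialBump.contDiff (n := 1)) 0
  rw [this, radialBump_of_le (by norm_num), neg_zero]

theorem continuous_radialBump_div : Continuous (fun r : ℝ => radialBump r * r⁻¹) := by
  rw [continuous_iff_continuousAt]
  intro r
  rcases le_or_gt r (1 / 4) with hr | hr
  · refine (continuousAt_const (y := (0 : ℝ))).congr ?_
    filter_upwards [gt_mem_nhds (show r < 1 / 2 by linarith)] with s hs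
    rw [radialBump_of_le (le_of_lt hs), zero_mul]
  · exact radialBump.continuous.continuousAt.mul (continuousAt_inv₀ (by linarith))

theorem integral_radialBump_div_pos : 0 < ∫ r in Set.Ioi (0 : ℝ), radialBump r * r⁻¹ := by
  rw [setIntegral_eq_integral_of_forall_compl_eq_zero]
  · refine continuous_radialBump_div.integral_pos_of_hasCompactSupport_nonneg_nonzero (x := 1)
      radialBump.hasCompactSupport.mul_right (fun r => ?_) ?_
    · rcases le_or_gt r 0 with hr | hr
      · simp [radialBump_of_le (show r ≤ 1 / 2 by linarith)]
      · exact mul_nonneg radialBump.nonneg (inv_nonneg.2 hr.le)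
    · have : radialBump (1 : ℝ) = 1 := radialBump.one_of_mem_closedBall (by
        simp [radialBump])
      simp [this]
  · intro r hr
    rw [radialBump_of_le (by have := not_lt.1 (Set.mem_Ioi.not.1 hr); linarith), zero_mul]

/-- The integral over the sphere of the divergence of a vector field that is homogeneous of degree
`-2` vanishes. -/
theorem sInt_div {W : Fin 3 → Far} (hW : ∀ i, Homog (-2) (W i)) :
    sInt (∑ i, FD i (W i)) = 0 := by
  have hint : Integrable (fun x => ∑ i, (BD i (bumpMul (W i))).1 x) :=
    integrable_finsetSum _ fun i _ => integrable_BD_bumpMul (W i) i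
  -- The compactly supported divergence `div (χ W)` integrates to zero. In polar coordinates this
  -- integral is the wanted sphere integral times `∫ χ / r`, plus the flux times `∫ χ'`; the latter
  -- radial integral vanishes and the former is positive.
  have h0 : ∫ x, ∑ i, (BD i (bumpMul (W i))).1 x = 0 := by
    rw [integral_finsetSum _ fun i _ => integrable_BD_bumpMul (W i) i]
    exact Finset.sum_eq_zero fun i _ =>
      integral_pd_eq_zero (bumpMul (W i)).contDiff (hasCompactSupport_bumpMul _) i
  rw [polar_integrable hint, setIntegral_congr_fun measurableSet_Ioi
    fun r hr => sphereInt_BD_bumpMul hW hr] at h0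
  have hd : Integrable (deriv radialBump) :=
    ((radialBump.contDiff (n := ⊤)).continuous_deriv (by simp)).integrable_of_hasCompactSupport
      radialBump.hasCompactSupport.deriv
  have hqi := continuous_radialBump_div.integrable_of_hasCompactSupport (μ := volume)
    radialBump.hasCompactSupport.mul_right
  rw [integral_add (hqi.integrableOn.const_mul _) (hd.integrableOn.const_mul _),
    integral_const_mul, integral_const_mul, integral_radialBump_deriv, mul_zero, add_zero] at h0
  exact (mul_eq_zero.1 h0).resolve_right integral_radialBump_div_pos.ne'

/-! ### The divergence theorem for balls -/

/-- The function on punctured space that is constant along rays and agrees with `v` on the sphere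
of radius `s`. -/
def rayExt (v : Bulk) (s : ℝ) : Far := Far.of (fun x => v.1 (s • (‖x‖⁻¹ • x))) fun _ hx =>
  (v.contDiff.contDiffAt.comp _ ((((contDiffAt_norm ℝ hx).inv
    (norm_ne_zero_iff.2 hx)).smul contDiffAt_id).const_smul s)).contDiffWithinAt

theorem rayExt_apply (v : Bulk) (s : ℝ) (x : Punct) :
    (rayExt v s).1 x = v.1 (s • (‖x.1‖⁻¹ • x.1)) := rfl

theorem homog_rayExt (v : Bulk) (s : ℝ) : Homog 0 (rayExt v s) := fun t ht x => by
  have := (norm_pos x).ne'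
  have h : ‖t • x.1‖⁻¹ • t • x.1 = ‖x.1‖⁻¹ • x.1 := by
    rw [norm_smul, Real.norm_eq_abs, abs_of_pos ht, smul_smul]
    congr 1
    field_simp
  simp only [rayExt_apply, Punct.scale, h, zpow_zero, one_mul]

theorem sph_rayExt (v : Bulk) (s : ℝ) (n : S2) : sph (rayExt v s) n = v.1 (s • (n : E3)) := by
  simp [rayExt_apply, sph, toPunct]

/-- Extension along rays kills the radial derivative; what remains is the tangential part of the
gradient at radius `s`, scaled by `s`. -/
theorem sph_FD_rayExt (v : Bulk) (s : ℝ) (i : Fin 3) (n : S2) : sph (FD i (rayExt v s)) n =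
    s * (pd i v.1 (s • (n : E3)) - (n : E3) i * ∑ j, (n : E3) j * pd j v.1 (s • (n : E3))) := by
  have hinv : HasFDerivAt (fun y : E3 => ‖y‖⁻¹) (fderiv ℝ (fun y : E3 => ‖y‖⁻¹) n) (n : E3) :=
    (((contDiffAt_norm ℝ (sphere_ne_zero n)).inv
      (norm_ne_zero_iff.2 (sphere_ne_zero n))).differentiableAt
        (n := ∞) (by simp)).hasFDerivAt
  have hpd : fderiv ℝ (fun y : E3 => ‖y‖⁻¹) n (ev i) = -(n : E3) i := by
    have h1 : (FD i Fr).1 (toPunct n) = pd i (fun y : E3 => ‖y‖⁻¹) n :=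
      FD_apply_of (fun _ => rfl) i (toPunct n)
    have h2 : sph (FD i Fr) n = -(n : E3) i := by simp [FD_Fr]
    exact h1.symm.trans h2
  have hd := ((hinv.smul (hasFDerivAt_id (n : E3))).const_smul s)
  have hv : HasFDerivAt v.1 (fderiv ℝ v.1 (s • (n : E3))) (s • (‖(n : E3)‖⁻¹ • (n : E3))) := by
    simpa using (v.contDiff.contDiffAt (x := s • (n : E3))).differentiableAt (by simp)
      |>.hasFDerivAt
  have hc := (hv.comp (n : E3) hd).fderiv
  have h1 : sph (FD i (rayExt v s)) n = pd i (fun y => v.1 (s • (‖y‖⁻¹ • y))) n :=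
    FD_apply_of (fun _ => rfl) i (toPunct n)
  rw [h1, pd]
  refine (congrArg (fun L : E3 →L[ℝ] ℝ => L (ev i)) hc).trans ?_
  simp only [ContinuousLinearMap.comp_apply, smul_apply,
    add_apply, ContinuousLinearMap.smulRight_apply, hpd, map_smul, map_add,
    norm_sphere, inv_one, one_smul, smul_eq_mul, id_eq, ContinuousLinearMap.id_apply, map_neg,
    neg_smul]
  rw [fderiv_eq_sum (s • (n : E3)) (n : E3)]
  simp only [pd]
  ring

/-- The radial derivative of the flux density through the sphere of radius `s`. -/
def fluxDeriv (V : Fin 3 → Bulk) (s : ℝ) (n : S2) : ℝ :=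
  s ^ 2 * ∑ i, ∑ j, (n : E3) i * (n : E3) j * pd j (V i).1 (s • (n : E3))
    + 2 * s * ∑ i, (n : E3) i * (V i).1 (s • (n : E3))

theorem continuous_fluxDeriv (V : Fin 3 → Bulk) :
    Continuous (fun p : ℝ × S2 => fluxDeriv V p.1 p.2) := by
  have h1 : ∀ i j, Continuous (pd j (V i).1) := fun i j => (contDiff_pd (V i).contDiff j).continuous
  have h2 : ∀ i, Continuous (V i).1 := fun i => (V i).contDiff.continuous
  have h3 : ∀ i : Fin 3, Continuous (fun x : E3 => x i) := fun i => (contDiff_coord i).continuous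
  have hs : Continuous (fun p : ℝ × S2 => (p.2 : E3)) :=
    continuous_subtype_val.comp continuous_snd
  have hp : Continuous (fun p : ℝ × S2 => p.1 • (p.2 : E3)) := continuous_fst.smul hs
  unfold fluxDeriv
  refine ((continuous_fst.pow 2).mul (continuous_finsetSum _ fun i _ =>
    continuous_finsetSum _ fun j _ => ?_)).add
    ((continuous_const.mul continuous_fst).mul (continuous_finsetSum _ fun i _ => ?_))
  · exact (((h3 i).comp hs).mul ((h3 j).comp hs)).mul ((h1 i j).comp hp)
  · exact ((h3 i).comp hs).mul ((h2 i).comp hp)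

theorem hasDerivAt_flux (V : Fin 3 → Bulk) (n : S2) (s : ℝ) :
    HasDerivAt (fun s : ℝ => s ^ 2 * ∑ i, (n : E3) i * (V i).1 (s • (n : E3)))
      (fluxDeriv V s n) s := by
  have h0 : HasDerivAt (fun s : ℝ => s • (n : E3)) (n : E3) s := by
    simpa using (hasDerivAt_id s).smul_const (n : E3)
  have h1 : ∀ i, HasDerivAt (fun s : ℝ => (V i).1 (s • (n : E3)))
      (∑ j, (n : E3) j * pd j (V i).1 (s • (n : E3))) s := fun i => by
    have := (((V i).contDiff.contDiffAt (x := s • (n : E3))).differentiableAt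
      (by simp)).hasFDerivAt.comp_hasDerivAt s h0
    rwa [fderiv_eq_sum] at this
  have h2 := (hasDerivAt_pow 2 s).mul
    (HasDerivAt.fun_sum (u := Finset.univ) fun i _ => (h1 i).const_mul ((n : E3) i))
  refine h2.congr_deriv ?_
  simp only [fluxDeriv, Finset.mul_sum, mul_assoc]
  simp only [Nat.cast_ofNat, Nat.add_one_sub_one, pow_one]
  ring

/-- The divergence on the sphere of radius `s` splits into the radial derivative of the flux and a
divergence along the sphere. The latter is seen by applying `sInt_div` to `r⁻² V`, with `V` frozen
at radius `s`: on the unit sphere its divergence is `s (div V - nᵢ nⱼ ∂ⱼ Vᵢ) - 2 n · V`. -/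
theorem sphereInt_fluxDeriv (V : Fin 3 → Bulk) (s : ℝ) :
    s ^ 2 * sphereInt (fun n => ∑ i, pd i (V i).1 (s • (n : E3)))
      = sphereInt (fluxDeriv V s) := by
  have hW : ∀ i, Homog (-2) (Fr ^ 2 * rayExt (V i) s) := fun i =>
    (Homog.pow_inv_norm 2).mul (homog_rayExt (V i) s)
  have h := congrArg (fun t => s * t) (sInt_div hW)
  simp only [mul_zero] at h
  rw [← smul_eq_mul, ← map_smul, sInt_apply] at h
  have hc1 : Continuous (fun n : S2 => ∑ i, pd i (V i).1 (s • (n : E3))) :=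
    continuous_finsetSum _ fun i _ => (contDiff_pd (V i).contDiff i).continuous.comp
      (continuous_subtype_val.const_smul s)
  have hc2 : Continuous (fluxDeriv V s) :=
    (continuous_fluxDeriv V).comp (continuous_const.prodMk continuous_id)
  have h3 : sph (s • ∑ i, FD i (Fr ^ 2 * rayExt (V i) s)) = fun n : S2 =>
      s ^ 2 * (∑ i, pd i (V i).1 (s • (n : E3))) - fluxDeriv V s n := by
    funext n
    simp only [sph_smul, sph_sum, Derivation.leibniz, Derivation.leibniz_pow, FD_Fr, smul_eq_mul,
      sph_add, sph_mul, sph_pow, sph_Fr, sph_rayExt, sph_FD_rayExt, nsmul_eq_mul, sph_neg, sph_FX]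
    have h2 : sph (((2 : ℕ) : Far)) n = 2 := rfl
    simp only [h2, fluxDeriv, Fin.sum_univ_three]
    ring
  rw [h3] at h
  have h4 : sphereInt (fun n : S2 => s ^ 2 * (∑ i, pd i (V i).1 (s • (n : E3))) - fluxDeriv V s n)
      = s ^ 2 * sphereInt (fun n => ∑ i, pd i (V i).1 (s • (n : E3)))
        - sphereInt (fluxDeriv V s) := by
    unfold sphereInt
    rw [integral_sub ((integrable_of_continuous_sphere hc1).const_mul _)
      (integrable_of_continuous_sphere hc2), integral_const_mul]
  linarith

/-- The divergence theorem for balls. -/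
theorem integral_ball_div (V : Fin 3 → Bulk) {R : ℝ} (hR : 0 ≤ R) :
    ∫ x in ball (0 : E3) R, (∑ i, BD i (V i)).1 x
      = sphereInt (fun n => R ^ 2 * ∑ i, (n : E3) i * (V i).1 (R • (n : E3))) := by
  rw [polar_ball (∑ i, BD i (V i)).contDiff.continuous hR]
  simp only [Bulk.sum_apply, BD_apply]
  have h1 : ∫ r in (0 : ℝ)..R, r ^ 2 * sphereInt (fun n => ∑ i, pd i (V i).1 (r • (n : E3)))
      = ∫ r in (0 : ℝ)..R, sphereInt (fluxDeriv V r) := by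
    exact intervalIntegral.integral_congr fun r _ => sphereInt_fluxDeriv V r
  have hint : Integrable (Function.uncurry (fluxDeriv V))
      ((volume.restrict (Set.uIoc 0 R)).prod (volume : Measure E3).toSphere) := by
    have h2 : IntegrableOn (Function.uncurry (fluxDeriv V)) (Set.uIcc 0 R ×ˢ Set.univ)
        ((volume : Measure ℝ).prod (volume : Measure E3).toSphere) :=
      (continuous_fluxDeriv V).continuousOn.integrableOn_compact
        (isCompact_uIcc.prod isCompact_univ)
    rw [IntegrableOn, ← Measure.prod_restrict, Measure.restrict_univ] at h2
    refine h2.mono_measure ?_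
    exact Measure.prod_mono (Measure.restrict_mono Set.uIoc_subset_uIcc le_rfl) le_rfl
  rw [h1]
  unfold sphereInt
  -- With the radial integral innermost, the fundamental theorem of calculus applies along each ray;
  -- the boundary term at radius `0` vanishes because of the factor `s ^ 2`.
  rw [intervalIntegral_integral_swap hint]
  congr 1
  funext n
  have hc : Continuous (fun s => fluxDeriv V s n) :=
    (continuous_fluxDeriv V).comp (continuous_id.prodMk continuous_const)
  rw [intervalIntegral.integral_eq_sub_of_hasDerivAt (fun s _ => hasDerivAt_flux V n s)
    (hc.intervalIntegrable _ _)]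
  simp

/-! ### Convergence of bulk integrals -/

/-- The integral over balls of `f` tends to `L`. -/
def BulkTendsto (f : Bulk) (L : ℝ) : Prop :=
  Tendsto (fun R : ℝ => ∫ x in ball (0 : E3) R, f.1 x) atTop (𝓝 L)

theorem BulkTendsto.bulkInt_eq {f : Bulk} {L : ℝ} (h : BulkTendsto f L) : bulkInt f.1 = L :=
  h.limUnder_eq

theorem BulkTendsto.converges {f : Bulk} {L : ℝ} (h : BulkTendsto f L) : BulkConverges f.1 :=
  ⟨L, h⟩

theorem integrableOn_ball (f : Bulk) (R : ℝ) : IntegrableOn f.1 (ball (0 : E3) R) :=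
  (f.contDiff.continuous.continuousOn.integrableOn_compact (isCompact_closedBall 0 R)).mono_set
    ball_subset_closedBall

theorem BulkTendsto.add {f g : Bulk} {L M : ℝ} (hf : BulkTendsto f L) (hg : BulkTendsto g M) :
    BulkTendsto (f + g) (L + M) :=
  (Tendsto.add hf hg).congr fun R =>
    (integral_add (integrableOn_ball f R) (integrableOn_ball g R)).symm

theorem BulkTendsto.smul {f : Bulk} {L : ℝ} (a : ℝ) (hf : BulkTendsto f L) :
    BulkTendsto (a • f) (a * L) :=
  (Tendsto.const_mul a hf).congr fun _ => (integral_const_mul a _).symm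

theorem BulkTendsto.neg {f : Bulk} {L : ℝ} (hf : BulkTendsto f L) : BulkTendsto (-f) (-L) := by
  simpa using hf.smul (-1)

theorem BulkTendsto.sub {f g : Bulk} {L M : ℝ} (hf : BulkTendsto f L) (hg : BulkTendsto g M) :
    BulkTendsto (f - g) (L - M) := by
  simpa only [sub_eq_add_neg] using hf.add hg.neg

theorem BulkTendsto.zero : BulkTendsto 0 0 := by
  simpa using BulkTendsto.smul (f := 0) (L := ∫ x, (0 : Bulk).1 x) 0
    ((aecover_ball tendsto_id).integral_tendsto_of_countably_generated (integrable_zero E3 ℝ _))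

theorem integrable_of_lead0 {f : Bulk} {F0 : Far} (h : Lead0 4 (restr f) F0) :
    Integrable f.1 := by
  have h1 : (restr f).ex =O[Bornology.cobounded E3] fun x => ‖x‖ ^ (-4 : ℤ) := by
    have h2 := (h.1.big []).add (h.2.big [])
    simp only [iterD, List.length_nil, Nat.cast_zero, add_zero] at h2
    refine h2.congr' ?_ EventuallyEq.rfl
    filter_upwards [eventually_ne_zero] with x hx
    simp [Far.ex_of_ne _ hx]
  have h3 : f.1 =O[Bornology.cobounded E3] fun x => (1 + ‖x‖) ^ (-(4 : ℝ)) := by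
    -- The constant is `16 = 2 ^ 4`, since `1 + ‖x‖ ≤ 2 ‖x‖` once `‖x‖ ≥ 1`. The power `4` exceeds
    -- the dimension `3`, so the comparison function is integrable.
    refine IsBigO.trans (h1.congr' ?_ EventuallyEq.rfl) (IsBigO.of_bound 16 ?_)
    · filter_upwards [eventually_ne_zero] with x hx
      rw [Far.ex_of_ne _ hx]; rfl
    · filter_upwards [eventually_cobounded_le_norm (E := E3) 1] with x hx
      have h0 : 0 < ‖x‖ := by linarith
      have e1 : (1 + ‖x‖) ^ (-(4 : ℝ)) = ((1 + ‖x‖) ^ 4)⁻¹ := by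
        rw [Real.rpow_neg (by linarith)]; norm_cast
      have e2 : ‖x‖ ^ (-4 : ℤ) = (‖x‖ ^ 4)⁻¹ := by rw [zpow_neg]; norm_cast
      rw [e1, e2, Real.norm_of_nonneg (by positivity), Real.norm_of_nonneg (by positivity),
        ← div_eq_mul_inv, inv_eq_one_div, div_le_div_iff₀ (by positivity) (by positivity)]
      have : (1 + ‖x‖) ^ 4 ≤ (2 * ‖x‖) ^ 4 := by gcongr; linarith
      nlinarith
  rw [cobounded_eq_cocompact] at h3
  refine f.contDiff.continuous.locallyIntegrable.integrable_of_isBigO_cocompact h3 ?_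
  exact (integrable_one_add_norm (by simp; norm_num)).integrableAtFilter _

theorem bulkTendsto_of_integrable {f : Bulk} (h : Integrable f.1) :
    BulkTendsto f (∫ x, f.1 x) :=
  (aecover_ball tendsto_id).integral_tendsto_of_countably_generated h

/-- A function whose leading term of order `r ^ (-3)` has vanishing average has a convergent bulk
integral. -/
theorem bulkTendsto_of_lead1 {f : Bulk} {F0 : Far} (h : Lead1 3 (restr f) F0)
    (h0 : sInt F0 = 0) : ∃ L, BulkTendsto f L := by
  -- The filled leading term is a radial factor times `F0` on each sphere, so its integral over
  -- every ball is exactly zero. This is where convergence is conditional: the order `r⁻³` alone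
  -- would give a logarithm.
  have hfill : BulkTendsto (fill F0) 0 := by
    refine tendsto_const_nhds.congr' ?_
    filter_upwards [eventually_ge_atTop 0] with R hR
    rw [polar_ball (fill F0).contDiff.continuous hR]
    symm
    refine intervalIntegral.integral_zero_ae (Eventually.of_forall fun r hr => ?_)
    rw [Set.uIoc_of_le hR] at hr
    have hr0 := hr.1
    have h1 : (fun n : S2 => (fill F0).1 (r • (n : E3)))
        = sph ((Real.smoothTransition (r ^ 2 - 1) * r ^ (-3 : ℤ)) • F0) := by
      funext n
      have h2 := h.1 r hr0 (toPunct n)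
      have h3 : F0.ex (r • (n : E3)) = F0.1 ((toPunct n).scale r hr0) :=
        F0.ex_apply ((toPunct n).scale r hr0)
      have h4 : cutoff (r • (n : E3)) = Real.smoothTransition (r ^ 2 - 1) := by
        simp [cutoff, norm_smul]
      rw [sph_smul]
      simp only [fill, Bulk.of_apply, h3, h4, h2, sph]
      ring
    rw [h1, ← sInt_apply, map_smul, h0, smul_zero, mul_zero]
  -- Subtracting the filling cancels the order `r⁻³`; the rest is of order `r⁻⁴` and absolutely
  -- integrable.
  have h1 : Lead1 3 (restr (f - fill F0)) 0 := by
    rw [map_sub, ← sub_self F0]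
    exact h.sub (lead1_fill h.1)
  obtain ⟨F1, h2⟩ := h1.of_zero (m := 4)
  have h3 := (bulkTendsto_of_integrable (integrable_of_lead0 h2)).add hfill
  rw [sub_add_cancel] at h3
  exact ⟨_, h3⟩

/-- The bulk integral of a divergence is the flux through the sphere at infinity. -/
theorem bulkTendsto_div {V : Fin 3 → Bulk} {V0 : Fin 3 → Far}
    (h : ∀ i, Lead0 2 (restr (V i)) (V0 i)) :
    BulkTendsto (∑ i, BD i (V i)) (sInt (∑ i, FX i * V0 i)) := by
  have hlim : Tendsto (fun R : ℝ => sphereInt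
      (fun n => R ^ 2 * ∑ i, (n : E3) i * (V i).1 (R • (n : E3)))) atTop
      (𝓝 (sInt (∑ i, FX i * V0 i))) := by
    have hbound : ∀ i, ∃ C : ℝ, ∀ᶠ x in Bornology.cobounded E3, ‖(V i).1 x‖ ≤ C * ‖x‖ ^ (-2 : ℤ) := by
      intro i
      have h2 := (((h i).1.big []).add ((h i).2.big [])).bound
      obtain ⟨C, hC⟩ := h2
      refine ⟨C, ?_⟩
      filter_upwards [hC, eventually_ne_zero] with x hx hx0
      simpa [iterD, Far.ex_of_ne _ hx0] using hx
    choose C hC using hbound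
    have hC' : ∀ᶠ x in Bornology.cobounded E3, ∀ i, ‖(V i).1 x‖ ≤ C i * ‖x‖ ^ (-2 : ℤ) :=
      eventually_all.2 hC
    rw [← comap_norm_atTop, eventually_comap] at hC'
    -- The flux density is dominated by the sum of the decay constants of the components, since the
    -- coordinates of a unit vector are at most one in absolute value.
    refine tendsto_integral_filter_of_dominated_convergence (fun _ => ∑ i, C i) ?_ ?_
      (integrable_const _) ?_
    · refine Eventually.of_forall fun R => Continuous.aestronglyMeasurable ?_
      exact continuous_const.mul (continuous_finsetSum _ fun i _ =>
        ((contDiff_coord i).continuous.comp continuous_subtype_val).mul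
          ((V i).contDiff.continuous.comp (continuous_subtype_val.const_smul R)))
    · filter_upwards [hC', eventually_gt_atTop 0] with R hR hR0
      refine Eventually.of_forall fun n => ?_
      have hn : ‖R • (n : E3)‖ = R := by simp [norm_smul, abs_of_pos hR0]
      have hR' := hR _ hn
      rw [norm_mul, Real.norm_of_nonneg (sq_nonneg R)]
      calc R ^ 2 * ‖∑ i, (n : E3) i * (V i).1 (R • (n : E3))‖
          ≤ R ^ 2 * ∑ i, C i * R ^ (-2 : ℤ) := by
            gcongr
            refine (norm_sum_le _ _).trans (Finset.sum_le_sum fun i _ => ?_)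
            rw [norm_mul]
            have h1 : ‖(n : E3) i‖ ≤ 1 := by
              simpa using PiLp.norm_apply_le (n : E3) i
            have h2 := hR' i
            rw [hn] at h2
            calc _ ≤ 1 * ‖(V i).1 (R • (n : E3))‖ := by gcongr
              _ ≤ _ := by rw [one_mul]; exact h2
        _ = ∑ i, C i := by
            rw [Finset.mul_sum]
            refine Finset.sum_congr rfl fun i _ => ?_
            rw [zpow_neg]
            norm_cast
            field_simp
    · refine Eventually.of_forall fun n => ?_
      have h2 := tendsto_finsetSum Finset.univ fun i _ =>
        ((h i).tendsto (k := 2) n).const_mul ((n : E3) i)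
      simp only [sph_sum, sph_mul, sph_FX]
      refine h2.congr fun R => ?_
      rw [Finset.mul_sum]
      exact Finset.sum_congr rfl fun i _ => by simp only [smul_eq_mul]; ring
  refine hlim.congr' ?_
  filter_upwards [eventually_ge_atTop 0] with R hR
  exact (integral_ball_div V hR).symm

/-! ### Algebraic identities -/

/-- Quadruples `(A_i, π^i, Ψ, π_Ψ)` with components in a ring. -/
abbrev Quad (R : Type*) : Type _ := (Fin 3 → R) × (Fin 3 → R) × R × R

section Algebra

variable {R : Type*} [CommRing R] [Algebra ℝ R] (D : Fin 3 → Derivation ℝ R R)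

/-- A Killing vector field of Minkowski space at `t = 0`, given by its normal component `xi` and its
tangential components `Y`. -/
structure Killing where
  xi : R
  Y : Fin 3 → R
  beta : Fin 3 → R
  om : Fin 3 → Fin 3 → R
  d_xi : ∀ i, D i xi = beta i
  d_Y : ∀ i j, D i (Y j) = om i j
  d_beta : ∀ i j, D i (beta j) = 0
  d_om : ∀ i j k, D i (om j k) = 0
  om_skew : ∀ i j, om i j = -om j i
  om_diag : ∀ i, om i i = 0

/-- The field strength. -/
def fs (A : Fin 3 → R) (i j : Fin 3) : R := D i (A j) - D j (A i)

variable {D}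

/-- The Poincaré transformation of the fields. -/
def Killing.act (k : Killing D) (z : Quad R) : Quad R :=
  (fun i => k.xi * z.2.1 i + D i (k.xi * z.2.2.1)
      + ∑ j, (k.Y j * D j (z.1 i) + z.1 j * D i (k.Y j)),
   fun i => ∑ m, D m (k.xi * fs D z.1 m i) + k.xi * D i z.2.2.2
      + ∑ m, (D m (k.Y m * z.2.1 i) - D m (k.Y i) * z.2.1 m),
   ∑ i, D i (k.xi * z.1 i) + ∑ i, k.Y i * D i z.2.2.1,
   k.xi * ∑ i, D i (z.2.1 i) + ∑ i, D i (z.2.2.2 * k.Y i))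

/-- The density of the kinetic term. -/
def kd (z w : Quad R) : R := ∑ i, z.2.1 i * w.1 i + z.2.2.2 * w.2.2.1

/-- The polarization of twice the density of the Poincaré generator. -/
def Killing.polar (k : Killing D) (z w : Quad R) : R :=
  k.xi * (-(z.2.2.1 * ∑ i, D i (w.2.1 i)) - w.2.2.1 * ∑ i, D i (z.2.1 i)
      - ∑ i, (z.1 i * D i w.2.2.2 + w.1 i * D i z.2.2.2) + ∑ i, z.2.1 i * w.2.1 i
      + (fs D z.1 0 1 * fs D w.1 0 1 + fs D z.1 0 2 * fs D w.1 0 2 + fs D z.1 1 2 * fs D w.1 1 2))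
    + ∑ i, k.Y i * (∑ j, (fs D z.1 i j * w.2.1 j + fs D w.1 i j * z.2.1 j)
      - z.1 i * ∑ j, D j (w.2.1 j) - w.1 i * ∑ j, D j (z.2.1 j)
      + z.2.2.2 * D i w.2.2.1 + w.2.2.2 * D i z.2.2.1)

/-- Together with `Killing.surf_comm`, this symmetry makes the Poincaré vector fields symmetric with
respect to the symplectic form. -/
theorem Killing.polar_comm (k : Killing D) (z w : Quad R) : k.polar z w = k.polar w z := by
  simp only [Killing.polar, Fin.sum_univ_three]; ring

/-- The flux of the Poincaré generator. -/
def Killing.flux (k : Killing D) (z w : Quad R) (m : Fin 3) : R :=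
  -(k.xi * z.2.2.1 * w.2.1 m) - k.xi * z.1 m * w.2.2.2 + k.xi * ∑ i, fs D z.1 m i * w.1 i
    - (∑ j, k.Y j * z.1 j) * w.2.1 m + k.Y m * ∑ i, z.2.1 i * w.1 i
    - (∑ j, k.Y j * w.1 j) * z.2.1 m + k.Y m * z.2.2.2 * w.2.2.1

-- The bulk half of `d_V P = -i_X Ω`: the variation of the density agrees with the symplectic
-- density up to a total derivative. It is a polynomial identity in the fields and their
-- derivatives, and uses only that partial derivatives commute and that the shift is Killing. No
-- field equation or constraint enters.
set_option maxHeartbeats 1000000 in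
theorem Killing.polar_eq (hD : ∀ i j f, D i (D j f) = D j (D i f)) (k : Killing D) (z w : Quad R) :
    k.polar z w + (kd (k.act z) w - kd w (k.act z)) = ∑ m, D m (k.flux z w m) := by
  -- Only decreasing pairs of indices are exchanged, so that rewriting terminates and brings second
  -- derivatives to a normal form on which `ring` can decide the identity; the skew coefficients
  -- `om` are normalized in the same way.
  have h10 := hD 1 0
  have h20 := hD 2 0
  have h21 := hD 2 1
  have o10 := k.om_skew 1 0
  have o20 := k.om_skew 2 0
  have o21 := k.om_skew 2 1
  simp only [Killing.polar, Killing.act, Killing.flux, kd, fs, Fin.sum_univ_three, map_add, map_sub,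
    map_neg, Derivation.leibniz, smul_eq_mul, k.d_xi, k.d_Y, k.om_diag, h10, h20, h21, o10, o20, o21]
  ring

/-- The Lie derivative of a one-form along the tangential part of a Killing field. -/
def Killing.lie (k : Killing D) (v : Fin 3 → R) (i : Fin 3) : R :=
  ∑ j, (k.Y j * D j (v i) + k.om i j * v j)

/-- The relations satisfied by the commutator of two Killing fields. -/
structure Killing.IsBracket (k l m : Killing D) : Prop where
  xi_eq : m.xi = ∑ i, k.Y i * l.beta i - ∑ i, l.Y i * k.beta i
  Y_eq : ∀ i, m.Y i = ∑ j, k.Y j * l.om j i - ∑ j, l.Y j * k.om j i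
    + (k.xi * l.beta i - l.xi * k.beta i)

-- The commutator closes exactly, off the constraint surface. Since `beta` and `om` are constants,
-- each component is a polynomial identity in derivatives of the fields once Leibniz has been
-- applied and mixed derivatives sorted.
set_option maxHeartbeats 1000000 in
theorem Killing.IsBracket.act_fst (hD : ∀ i j f, D i (D j f) = D j (D i f)) {k l m : Killing D}
    (h : k.IsBracket l m) (z : Quad R) (i : Fin 3) :
    (k.act (l.act z)).1 i - (l.act (k.act z)).1 i = (m.act z).1 i := by
  have h10 := hD 1 0
  have h20 := hD 2 0
  have h21 := hD 2 1
  have o10 := k.om_skew 1 0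
  have o20 := k.om_skew 2 0
  have o21 := k.om_skew 2 1
  have q10 := l.om_skew 1 0
  have q20 := l.om_skew 2 0
  have q21 := l.om_skew 2 1
  fin_cases i <;>
  · simp only [Killing.act, fs, Fin.sum_univ_three, map_add, map_sub,
      Derivation.leibniz, smul_eq_mul, k.d_xi, k.d_Y, l.d_xi, l.d_Y, k.d_beta,
      l.d_beta, k.d_om, l.d_om, h.xi_eq, h.Y_eq,
      k.om_diag, l.om_diag, h10, h20, h21, o10, o20, o21, q10, q20, q21, Fin.zero_eta, Fin.mk_one,
      Fin.reduceFinMk]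
    ring

set_option maxHeartbeats 4000000 in
theorem Killing.IsBracket.act_snd (hD : ∀ i j f, D i (D j f) = D j (D i f)) {k l m : Killing D}
    (h : k.IsBracket l m) (z : Quad R) (i : Fin 3) :
    (k.act (l.act z)).2.1 i - (l.act (k.act z)).2.1 i = (m.act z).2.1 i := by
  have h10 := hD 1 0
  have h20 := hD 2 0
  have h21 := hD 2 1
  have o10 := k.om_skew 1 0
  have o20 := k.om_skew 2 0
  have o21 := k.om_skew 2 1
  have q10 := l.om_skew 1 0
  have q20 := l.om_skew 2 0
  have q21 := l.om_skew 2 1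
  fin_cases i <;>
  · simp only [Killing.act, fs, Fin.sum_univ_three, map_add, map_sub,
      Derivation.leibniz, smul_eq_mul, k.d_xi, k.d_Y, l.d_xi, l.d_Y, k.d_beta,
      l.d_beta, k.d_om, l.d_om, h.xi_eq, h.Y_eq,
      k.om_diag, l.om_diag, h10, h20, h21, o10, o20, o21, q10, q20, q21, Fin.zero_eta, Fin.mk_one,
      Fin.reduceFinMk, mul_zero, zero_mul, add_zero, zero_add, sub_self, sub_zero]
    ring

set_option maxHeartbeats 1000000 in
theorem Killing.IsBracket.act_trd (hD : ∀ i j f, D i (D j f) = D j (D i f)) {k l m : Killing D}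
    (h : k.IsBracket l m) (z : Quad R) :
    (k.act (l.act z)).2.2.1 - (l.act (k.act z)).2.2.1 = (m.act z).2.2.1 := by
  have h10 := hD 1 0
  have h20 := hD 2 0
  have h21 := hD 2 1
  have o10 := k.om_skew 1 0
  have o20 := k.om_skew 2 0
  have o21 := k.om_skew 2 1
  have q10 := l.om_skew 1 0
  have q20 := l.om_skew 2 0
  have q21 := l.om_skew 2 1
  simp only [Killing.act, Fin.sum_univ_three, map_add, map_sub,
    Derivation.leibniz, smul_eq_mul, k.d_xi, k.d_Y, l.d_xi, l.d_Y, k.d_beta,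
    l.d_beta, k.d_om, l.d_om, h.xi_eq, h.Y_eq,
    k.om_diag, l.om_diag, h10, h20, h21, o10, o20, o21, q10, q20, q21]
  ring

set_option maxHeartbeats 1000000 in
theorem Killing.IsBracket.act_fth (hD : ∀ i j f, D i (D j f) = D j (D i f)) {k l m : Killing D}
    (h : k.IsBracket l m) (z : Quad R) :
    (k.act (l.act z)).2.2.2 - (l.act (k.act z)).2.2.2 = (m.act z).2.2.2 := by
  have h10 := hD 1 0
  have h20 := hD 2 0
  have h21 := hD 2 1
  have o10 := k.om_skew 1 0
  have o20 := k.om_skew 2 0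
  have o21 := k.om_skew 2 1
  have q10 := l.om_skew 1 0
  have q20 := l.om_skew 2 0
  have q21 := l.om_skew 2 1
  simp only [Killing.act, fs, Fin.sum_univ_three, map_add, map_sub,
    Derivation.leibniz, smul_eq_mul, k.d_xi, k.d_Y, l.d_xi, l.d_Y, k.d_beta,
    l.d_beta, k.d_om, l.d_om, h.xi_eq, h.Y_eq,
    mul_zero, zero_mul, add_zero, zero_add,
      k.om_diag, l.om_diag, h10, h20, h21, o10, o20, o21, q10, q20, q21]
  ring

/-- The Poincaré transformations represent the Poincaré algebra. -/
theorem Killing.IsBracket.act_eq (hD : ∀ i j f, D i (D j f) = D j (D i f)) {k l m : Killing D}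
    (h : k.IsBracket l m) (z : Quad R) : k.act (l.act z) - l.act (k.act z) = m.act z :=
  Prod.ext (funext (h.act_fst hD z)) (Prod.ext (funext (h.act_snd hD z))
    (Prod.ext (h.act_trd hD z) (h.act_fth hD z)))

/-- The gauge transformation of the fields. -/
def gaugeQuad (D : Fin 3 → Derivation ℝ R R) (μ ε : R) : Quad R := (fun i => D i ε, 0, μ, 0)

/-- The commutator of a Poincaré transformation with a gauge transformation. -/
def Killing.gauge (k : Killing D) (p : R × R) : R × R :=
  (∑ i, D i (k.xi * D i p.2) + ∑ i, k.Y i * D i p.1, k.xi * p.1 + ∑ i, k.Y i * D i p.2)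

/-- A pure gauge configuration has no field strength and no momenta, so the momentum components of
its image vanish. The others regroup into a gradient and a function, the new gauge parameters. This
is the commutator of the two kinds of transformations, because the gauge vector field is constant.
-/
theorem Killing.act_gaugeQuad (hD : ∀ i j f, D i (D j f) = D j (D i f)) (k : Killing D) (μ ε : R) :
    k.act (gaugeQuad D μ ε) = gaugeQuad D (k.gauge (μ, ε)).1 (k.gauge (μ, ε)).2 := by
  have hfs : ∀ i j, fs D (fun i => D i ε) i j = 0 := fun i j => by
    rw [fs, hD, sub_self]
  refine Prod.ext (funext fun i => ?_) (Prod.ext (funext fun i => ?_) (Prod.ext ?_ ?_))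
  · simp only [Killing.act, gaugeQuad, Killing.gauge, map_add, map_sum, Derivation.leibniz,
      smul_eq_mul, Pi.zero_apply, mul_zero, zero_add, Finset.sum_add_distrib]
    simp only [hD i]
  · simp [Killing.act, gaugeQuad, hfs]
  · simp [Killing.act, gaugeQuad, Killing.gauge]
  · simp [Killing.act, gaugeQuad]

-- The representation property on gauge parameters. Applied to the leading terms, it yields the Lie
-- algebra homomorphism of the semidirect sum.
set_option maxHeartbeats 1000000 in
theorem Killing.IsBracket.gauge_eq (hD : ∀ i j f, D i (D j f) = D j (D i f)) {k l m : Killing D}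
    (h : k.IsBracket l m) (p : R × R) : k.gauge (l.gauge p) - l.gauge (k.gauge p) = m.gauge p := by
  have h10 := hD 1 0
  have h20 := hD 2 0
  have h21 := hD 2 1
  have o10 := k.om_skew 1 0
  have o20 := k.om_skew 2 0
  have o21 := k.om_skew 2 1
  have q10 := l.om_skew 1 0
  have q20 := l.om_skew 2 0
  have q21 := l.om_skew 2 1
  refine Prod.ext ?_ ?_ <;>
  · simp only [Killing.gauge, Prod.fst_sub, Prod.snd_sub, Fin.sum_univ_three, map_add, map_sub,
      Derivation.leibniz, smul_eq_mul, k.d_xi, k.d_Y, l.d_xi, l.d_Y, k.d_beta,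
      l.d_beta, h.xi_eq, h.Y_eq,
      k.d_om, l.d_om, mul_zero, zero_mul, add_zero, zero_add,
      k.om_diag, l.om_diag, h10, h20, h21, o10, o20, o21, q10, q20, q21]
    ring

/-- The divergence of the divergence of an antisymmetric tensor vanishes. -/
theorem div_div_eq_zero (hD : ∀ i j f, D i (D j f) = D j (D i f)) {K : Fin 3 → Fin 3 → R}
    (hK : ∀ i j, K i j = -K j i) (hK0 : ∀ i, K i i = 0) : ∑ i, D i (∑ m, D m (K m i)) = 0 := by
  simp only [Fin.sum_univ_three, map_add, hK0, map_zero, hK 1 0, hK 2 0, hK 2 1, map_neg,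
    hD 1 0, hD 2 0, hD 2 1]
  ring

/-- The magnetic term drops out as a double divergence of a skew tensor, and the Lie derivative
commutes with the divergence of a density. Hence the Gauss constraint is mapped to the constraints;
the same identity at leading order preserves the asymptotic Gauss law. -/
theorem Killing.div_act (hD : ∀ i j f, D i (D j f) = D j (D i f)) (k : Killing D) (z : Quad R) :
    ∑ i, D i ((k.act z).2.1 i) = ∑ i, D i (k.xi * D i z.2.2.2)
      + ∑ m, k.Y m * D m (∑ i, D i (z.2.1 i)) := by
  have h0 := div_div_eq_zero hD (K := fun m i => k.xi * fs D z.1 m i)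
    (fun i j => by simp only [fs]; ring) (fun i => by simp only [fs]; ring)
  simp only [Killing.act, map_add, Finset.sum_add_distrib, h0, zero_add]
  congr 1
  have h10 := hD 1 0
  have h20 := hD 2 0
  have h21 := hD 2 1
  have o10 := k.om_skew 1 0
  have o20 := k.om_skew 2 0
  have o21 := k.om_skew 2 1
  simp only [Fin.sum_univ_three, map_add, map_sub, Derivation.leibniz, smul_eq_mul, k.d_Y,
    k.om_diag, k.d_om, h10, h20, h21, o10, o20, o21, mul_zero, zero_mul, add_zero]
  ring

end Algebra

/-! ### The leading terms of the fields -/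

theorem Far.neg_mul (a b : Far) : -a * b = -(a * b) := by ring

theorem Far.mul_neg (a b : Far) : a * -b = -(a * b) := by ring

/-- The radial component of a vector field, times the radius. -/
def rad (A : Fin 3 → Far) : Far := ∑ i, FX i * A i

/-- The component of a vector field tangent to the spheres. -/
def tan (A : Fin 3 → Far) (i : Fin 3) : Far := A i - rad A * FX i * Fr ^ 2

theorem rad_add (A B : Fin 3 → Far) : rad (A + B) = rad A + rad B := by
  simp [rad, mul_add, Finset.sum_add_distrib]

theorem rad_smul (t : ℝ) (A : Fin 3 → Far) : rad (t • A) = t • rad A := by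
  simp [rad, Finset.smul_sum]

theorem tan_add (A B : Fin 3 → Far) (i : Fin 3) : tan (A + B) i = tan A i + tan B i := by
  simp only [tan, rad_add, Pi.add_apply]; ring

theorem tan_smul (t : ℝ) (A : Fin 3 → Far) (i : Fin 3) : tan (t • A) i = t • tan A i := by
  simp only [tan, rad_smul, Pi.smul_apply, smul_sub, smul_mul_assoc]

theorem Fr_sq' : Fr ^ 2 * (FX 0 * FX 0 + FX 1 * FX 1 + FX 2 * FX 2) = 1 := by
  rw [← Fr_sq, Fin.sum_univ_three]; ring

theorem rad_tan (A : Fin 3 → Far) : rad (tan A) = 0 := by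
  simp only [rad, tan, Fin.sum_univ_three]
  linear_combination (-(FX 0 * A 0 + FX 1 * A 1 + FX 2 * A 2)) * Fr_sq'

theorem Homog.rad {d e : ℤ} {A : Fin 3 → Far} (h : ∀ i, Homog d (A i))
    (he : d + 1 = e := by norm_num) : Homog e (rad A) :=
  Homog.sum _ fun i _ => (Homog.coord i).mul (h i) (by omega)

theorem Homog.inv_norm_sq : Homog (-2) (Fr ^ 2) := Homog.pow_inv_norm 2

theorem Homog.tan {d : ℤ} {A : Fin 3 → Far} (h : ∀ i, Homog d (A i)) (i : Fin 3) :
    Homog d (tan A i) :=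
  (h i).sub (((Homog.rad h rfl).mul (Homog.coord i) rfl).mul Homog.inv_norm_sq (by omega))

/-- Euler's relation, with `3` coming from the divergence of the position vector. -/
theorem sum_mul_FD_mul {d : ℤ} {f : Far} (h : Homog d f) :
    ∑ i, FD i (f * FX i) = (d + 3) * f := by
  have := h.euler
  simp only [Fin.sum_univ_three, Derivation.leibniz, smul_eq_mul, FD_FX, if_true] at this ⊢
  linear_combination this

/-- The sphere integral of a divergence. -/
theorem sInt_dv {V : Fin 3 → Far} (h : ∀ i, Homog 0 (V i)) :
    sInt (∑ i, FD i (V i)) = 2 * sInt (rad V) := by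
  -- The tangential part, rescaled by `r⁻²` to degree `-2`, integrates to zero by `sInt_div`. The
  -- radial part `x (x · V) / r²` has divergence `2 (x · V) / r²`, which is the right-hand side.
  have h1 := sInt_div (W := fun i => Fr ^ 2 * tan V i) fun i =>
    Homog.inv_norm_sq.mul (Homog.tan h i)
  have e1 : ∀ i, FD i (Fr ^ 2 * tan V i) = Fr ^ 2 * FD i (tan V i) -
      2 * Fr ^ 4 * (FX i * tan V i) := fun i => by
    simp only [Derivation.leibniz, Derivation.leibniz_pow, FD_Fr, smul_eq_mul, nsmul_eq_mul]
    push_cast; ring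
  have hr : Homog (-1) (rad V * Fr ^ 2) := (Homog.rad h (e := 1)).mul Homog.inv_norm_sq
  have e2 : ∑ i, FD i (tan V i) = ∑ i, FD i (V i) - 2 * (rad V * Fr ^ 2) := by
    have := sum_mul_FD_mul hr
    have e : ∀ i, FD i (tan V i) = FD i (V i) - FD i (rad V * Fr ^ 2 * FX i) := fun i => by
      rw [tan, map_sub]; congr 2; ring
    rw [Finset.sum_congr rfl fun i _ => e i, Finset.sum_sub_distrib, this]
    push_cast; ring
  have e3 : ∑ i, FX i * tan V i = 0 := rad_tan V
  rw [Finset.sum_congr rfl fun i _ => e1 i, Finset.sum_sub_distrib, ← Finset.mul_sum,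
    ← Finset.mul_sum, e3, e2, mul_zero, sub_zero] at h1
  have h2 : sInt (Fr ^ 2 * (∑ i, FD i (V i) - 2 * (rad V * Fr ^ 2))) =
      sInt (∑ i, FD i (V i) - (rad V + rad V)) := sInt_congr_sph fun n => by
    simp only [sph_mul, sph_sub, sph_pow, sph_Fr, sph_add, two_mul]; ring
  rw [h2, map_sub, map_add] at h1
  linarith

/-- The Gauss law and the parity conditions on the leading terms `A` and `P` of the vector potential
and of the electric field. The sign `s` is `-1` for the twisted parity conditions and `1` for the
conditions adapted to magnetic sources. -/
structure LeadCond (s : ℝ) (A P : Fin 3 → Far) : Prop where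
  radA : refl (rad A) = -rad A
  radP : refl (rad P) = rad P
  angA : ∃ Φ, Homog 0 Φ ∧ refl Φ = s • Φ ∧ ∀ i, refl (tan A i) = s • tan A i + FD i Φ
  angP : ∀ i, refl (tan P i) = -(s • tan P i)
  div : ∑ i, FD i (P i) = 0

theorem LeadCond.add {s : ℝ} {A P B Q : Fin 3 → Far} (h : LeadCond s A P) (k : LeadCond s B Q) :
    LeadCond s (A + B) (P + Q) where
  radA := by simp only [rad_add, map_add, h.radA, k.radA]; ring
  radP := by simp only [rad_add, map_add, h.radP, k.radP]
  angA := by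
    obtain ⟨Φ, h1, h2, h3⟩ := h.angA
    obtain ⟨Θ, k1, k2, k3⟩ := k.angA
    refine ⟨Φ + Θ, h1.add k1, by simp only [map_add, h2, k2, smul_add], fun i => ?_⟩
    simp only [tan_add, map_add, h3, k3, smul_add]; ring
  angP i := by simp only [tan_add, map_add, h.angP, k.angP, smul_add]; ring
  div := by simp only [Pi.add_apply, map_add, Finset.sum_add_distrib, h.div, k.div, add_zero]

theorem LeadCond.smul {s : ℝ} {A P : Fin 3 → Far} (t : ℝ) (h : LeadCond s A P) :
    LeadCond s (t • A) (t • P) where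
  radA := by simp only [rad_smul, map_smul, h.radA, smul_neg]
  radP := by simp only [rad_smul, map_smul, h.radP]
  angA := by
    obtain ⟨Φ, h1, h2, h3⟩ := h.angA
    refine ⟨t • Φ, h1.smul t, by simp only [map_smul, h2, smul_comm t s], fun i => ?_⟩
    simp only [tan_smul, map_smul, Derivation.map_smul, h3, smul_add, smul_comm t s]
  angP i := by simp only [tan_smul, map_smul, h.angP, smul_neg, smul_comm t s]
  div := by simp only [Pi.smul_apply, Derivation.map_smul, ← Finset.smul_sum, h.div, smul_zero]

theorem sum_mul_eq_rad_tan (A B : Fin 3 → Far) :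
    ∑ i, A i * B i = rad A * rad B * Fr ^ 2 + ∑ i, tan A i * tan B i := by
  simp only [rad, tan, Fin.sum_univ_three]
  linear_combination (-(FX 0 * A 0 + FX 1 * A 1 + FX 2 * A 2) *
    (FX 0 * B 0 + FX 1 * B 1 + FX 2 * B 2) * Fr ^ 2) * Fr_sq'

/-- The radial part is `x` times a function of degree `-3`, and `-3 + 3 = 0`: a radial field of
order `r⁻²` is divergence-free for every angular profile. So the angular Gauss law is the vanishing
of the full divergence of the leading term. -/
theorem dv_tan {P : Fin 3 → Far} (h : ∀ i, Homog (-2) (P i)) :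
    ∑ i, FD i (tan P i) = ∑ i, FD i (P i) := by
  have := sum_mul_FD_mul ((Homog.rad h (e := -1)).mul Homog.inv_norm_sq (k := -3))
  have e : ∀ i, FD i (tan P i) = FD i (P i) - FD i (rad P * Fr ^ 2 * FX i) := fun i => by
    rw [tan, map_sub]; congr 2; ring
  rw [Finset.sum_congr rfl fun i _ => e i, Finset.sum_sub_distrib, this]
  push_cast; ring

/-- The logarithmic divergence of the symplectic form vanishes. -/
theorem LeadCond.sInt_pairing {s : ℝ} (hs : s * s = 1) {A P B Q : Fin 3 → Far}
    (h : LeadCond s A P) (k : LeadCond s B Q) (hP : ∀ i, Homog (-2) (P i)) :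
    sInt (∑ i, P i * B i) = 0 := by
  obtain ⟨Φ, h1, h2, h3⟩ := k.angA
  -- Because the tangential electric field is divergence-free, its product with the gradient of `Φ`
  -- is itself a divergence of degree `-2`; the improper gauge part of the potential therefore does
  -- not contribute.
  have hd : ∑ i, FD i (Φ * tan P i) = ∑ i, tan P i * FD i Φ := by
    simp only [Derivation.leibniz, smul_eq_mul, Finset.sum_add_distrib, ← Finset.mul_sum,
      dv_tan hP, h.div, mul_zero, zero_add]
  have e1 : sInt (rad P * rad B * Fr ^ 2) = 0 := sInt_eq_zero_of_odd (by
    simp only [map_mul, map_pow, refl_Fr, h.radP, k.radA]; ring)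
  -- The two angular factors pick up the signs `-s` and `s`, and `s * s = 1`; their product is odd
  -- up to the divergence above, whichever boundary condition is used.
  have e2 : refl (∑ i, tan P i * tan B i) =
      -∑ i, tan P i * tan B i - s • ∑ i, FD i (Φ * tan P i) := by
    rw [hd]
    simp only [map_sum, map_mul, h.angP, h3, Finset.smul_sum, ← Finset.sum_neg_distrib,
      ← Finset.sum_sub_distrib]
    refine Finset.sum_congr rfl fun i _ => ?_
    have : s • tan P i * s • tan B i = tan P i * tan B i := by
      rw [smul_mul_smul_comm, hs, one_smul]
    rw [Far.neg_mul, mul_add, this, smul_mul_assoc]; ring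
  have e3 := sInt_refl (∑ i, tan P i * tan B i)
  rw [e2, map_sub, map_neg, map_smul, sInt_div fun i => h1.mul (Homog.tan hP i), smul_zero] at e3
  rw [sum_mul_eq_rad_tan, map_add, e1]
  linarith

/-! ### Lorentz transformations of the leading terms. -/

/-- A homogeneous Killing vector field, that is, a Lorentz transformation. -/
structure Lorentz (k : Killing FD) : Prop where
  xi_eq : k.xi = ∑ i, FX i * k.beta i
  Y_eq : ∀ j, k.Y j = ∑ i, FX i * k.om i j
  beta_homog : ∀ i, Homog 0 (k.beta i)
  om_homog : ∀ i j, Homog 0 (k.om i j)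
  refl_beta : ∀ i, refl (k.beta i) = k.beta i
  refl_om : ∀ i j, refl (k.om i j) = k.om i j

namespace Lorentz

variable {k : Killing FD} (hk : Lorentz k)

theorem homog_xi (hk : Lorentz k) : Homog 1 k.xi := by
  rw [hk.xi_eq]; exact Homog.sum _ fun i _ => (Homog.coord i).mul (hk.beta_homog i)

theorem homog_Y (hk : Lorentz k) (j : Fin 3) : Homog 1 (k.Y j) := by
  rw [hk.Y_eq]; exact Homog.sum _ fun i _ => (Homog.coord i).mul (hk.om_homog i j)

theorem refl_xi (hk : Lorentz k) : refl k.xi = -k.xi := by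
  simp only [hk.xi_eq, map_sum, map_mul, refl_FX, hk.refl_beta, Far.neg_mul, Finset.sum_neg_distrib]

theorem refl_Y (hk : Lorentz k) (j : Fin 3) : refl (k.Y j) = -k.Y j := by
  simp only [hk.Y_eq, map_sum, map_mul, refl_FX, hk.refl_om, Far.neg_mul, Finset.sum_neg_distrib]

theorem rad_Y (hk : Lorentz k) : rad k.Y = 0 := by
  simp only [rad, hk.Y_eq, Fin.sum_univ_three, k.om_skew 1 0, k.om_skew 2 0, k.om_skew 2 1,
    k.om_diag]
  ring

theorem sum_FX_om (hk : Lorentz k) (j : Fin 3) : ∑ i, FX i * k.om i j = k.Y j := (hk.Y_eq j).symm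

end Lorentz

/-- The derivative along the tangential part of a Killing field. -/
def Killing.along (k : Killing FD) (f : Far) : Far := ∑ i, k.Y i * FD i f

theorem Killing.along_mul (k : Killing FD) (f g : Far) :
    k.along (f * g) = f * k.along g + g * k.along f := by
  simp only [Killing.along, Fin.sum_univ_three, Derivation.leibniz, smul_eq_mul]; ring

theorem Lorentz.along_Fr {k : Killing FD} (hk : Lorentz k) : k.along Fr = 0 := by
  have := hk.rad_Y
  simp only [rad, Killing.along, Fin.sum_univ_three, FD_Fr] at this ⊢
  linear_combination (-Fr ^ 3) * this

theorem Killing.along_FX (k : Killing FD) (i : Fin 3) : k.along (FX i) = k.Y i := by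
  simp [Killing.along, FD_FX]

theorem Lorentz.refl_along {k : Killing FD} (hk : Lorentz k) (f : Far) :
    refl (k.along f) = k.along (refl f) := by
  simp only [Killing.along, map_sum, map_mul, hk.refl_Y, FD_refl]
  exact Finset.sum_congr rfl fun i _ => by ring

theorem Lorentz.homog_along {k : Killing FD} (hk : Lorentz k) {d : ℤ} {f : Far} (h : Homog d f) :
    Homog d (k.along f) :=
  Homog.sum _ fun i _ => (hk.homog_Y i).mul (h.deriv i (k := d - 1) (by ring)) (by ring)

theorem Lorentz.refl_lie {k : Killing FD} (hk : Lorentz k) (v : Fin 3 → Far) (i : Fin 3) :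
    refl (k.lie v i) = k.lie (fun j => refl (v j)) i := by
  simp only [Killing.lie, map_sum, map_add, map_mul, hk.refl_Y, hk.refl_om, FD_refl]
  exact Finset.sum_congr rfl fun i _ => by ring

theorem Killing.lie_add (k : Killing FD) (v w : Fin 3 → Far) (i : Fin 3) :
    k.lie (fun j => v j + w j) i = k.lie v i + k.lie w i := by
  simp only [Killing.lie, map_add, ← Finset.sum_add_distrib]
  exact Finset.sum_congr rfl fun i _ => by ring

theorem Killing.lie_smul (k : Killing FD) (t : ℝ) (v : Fin 3 → Far) (i : Fin 3) :
    k.lie (fun j => t • v j) i = t • k.lie v i := by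
  simp only [Killing.lie, Derivation.map_smul, Finset.smul_sum, smul_add, mul_smul_comm]

theorem Killing.lie_grad (k : Killing FD) (f : Far) (i : Fin 3) :
    k.lie (fun j => FD j f) i = FD i (k.along f) := by
  simp only [Killing.lie, Killing.along, map_sum, Derivation.leibniz, smul_eq_mul, k.d_Y]
  exact Finset.sum_congr rfl fun j _ => by rw [FD_comm i j]; ring

/-- Rotations fix the position one-form, so Lie derivation along them commutes with the splitting
into radial and tangential parts. -/
theorem Lorentz.rad_lie {k : Killing FD} (hk : Lorentz k) (v : Fin 3 → Far) :
    rad (k.lie v) = k.along (rad v) := by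
  have h0 := hk.sum_FX_om 0
  have h1 := hk.sum_FX_om 1
  have h2 := hk.sum_FX_om 2
  simp only [rad, Killing.lie, Killing.along, Fin.sum_univ_three, map_add, Derivation.leibniz,
    smul_eq_mul, FD_FX] at *
  simp only [Fin.reduceEq, if_true, if_false]
  linear_combination v 0 * h0 + v 1 * h1 + v 2 * h2

theorem Lorentz.tan_lie {k : Killing FD} (hk : Lorentz k) (v : Fin 3 → Far) (i : Fin 3) :
    tan (k.lie v) i = k.lie (tan v) i := by
  have h1 : k.lie (fun j => rad v * FX j * Fr ^ 2) i = k.along (rad v) * FX i * Fr ^ 2 := by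
    have e : k.lie (fun j => rad v * FX j * Fr ^ 2) i = k.along (rad v * FX i * Fr ^ 2)
        - (∑ j, FX j * k.om j i) * (rad v * Fr ^ 2) := by
      simp only [Killing.lie, Killing.along, Finset.sum_mul, ← Finset.sum_sub_distrib]
      exact Finset.sum_congr rfl fun j _ => by rw [k.om_skew i j]; ring
    rw [e, hk.sum_FX_om, Killing.along_mul, Killing.along_mul, k.along_FX, pow_two,
      Killing.along_mul, hk.along_Fr]
    ring
  have h2 : k.lie v i = k.lie (tan v) i + k.lie (fun j => rad v * FX j * Fr ^ 2) i := by
    rw [← Killing.lie_add]; simp only [tan, sub_add_cancel]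
  rw [tan, hk.rad_lie, h2, h1]; ring

theorem rad_grad {f : Far} (h : Homog 0 f) : rad (fun i => FD i f) = 0 := by
  have := h.euler; rw [rad, this]; simp

theorem tan_grad {f : Far} (h : Homog 0 f) (i : Fin 3) : tan (fun i => FD i f) i = FD i f := by
  rw [tan, rad_grad h]; ring

/-- The leading term of the Poincaré transformation of the vector potential. -/
theorem Killing.act_fst_eq (k : Killing FD) (z : Quad Far) :
    (k.act z).1 = (fun i => k.xi * z.2.1 i) + ((fun i => FD i (k.xi * z.2.2.1)) + k.lie z.1) := by
  funext i
  simp only [Killing.act, Killing.lie, Pi.add_apply, k.d_Y, add_assoc]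
  congr 2
  exact Finset.sum_congr rfl fun j _ => by ring

theorem Killing.act_snd_eq (k : Killing FD) (z : Quad Far) (hz : z.2.2.2 = 0) :
    (k.act z).2.1 = (fun i => ∑ m, FD m (k.xi * fs FD z.1 m i)) + k.lie z.2.1 := by
  funext i
  simp only [Killing.act, Killing.lie, Pi.add_apply, k.d_Y, hz, map_zero, mul_zero, add_zero]
  congr 1
  simp only [Fin.sum_univ_three, Derivation.leibniz, smul_eq_mul, k.d_Y, k.om_diag, k.om_skew 0 i,
    k.om_skew 1 i, k.om_skew 2 i]
  ring

theorem rad_mul (f : Far) (v : Fin 3 → Far) : rad (fun i => f * v i) = f * rad v := by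
  simp only [rad, Finset.mul_sum]; exact Finset.sum_congr rfl fun i _ => by ring

theorem tan_mul (f : Far) (v : Fin 3 → Far) (i : Fin 3) : tan (fun i => f * v i) i = f * tan v i := by
  simp only [tan, rad_mul]; ring

/-- For degree `-1`, Euler's relation turns the radial derivative of `A_m` into `-A_m`, which
cancels the term from differentiating the position vector. -/
theorem rad_fs {A : Fin 3 → Far} (h : ∀ i, Homog (-1) (A i)) (m : Fin 3) :
    ∑ i, FX i * fs FD A m i = FD m (rad A) := by
  have e := (h m).euler
  push_cast at e
  fin_cases m <;>
  · simp only [fs, rad, Fin.sum_univ_three, map_add, Derivation.leibniz, smul_eq_mul, FD_FX,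
      Fin.reduceEq, if_true, if_false, Fin.zero_eta, Fin.mk_one, Fin.reduceFinMk] at *
    linear_combination -e

theorem fs_self (A : Fin 3 → Far) (i : Fin 3) : fs FD A i i = 0 := sub_self _

theorem fs_skew (A : Fin 3 → Far) (i j : Fin 3) : fs FD A i j = -fs FD A j i :=
  (neg_sub _ _).symm

/-- The position vector can be moved inside the divergence because the extra term is the trace of a
skew tensor; then `rad_fs` applies. -/
theorem rad_div_fs {k : Killing FD} {A : Fin 3 → Far} (h : ∀ i, Homog (-1) (A i)) :
    rad (fun i => ∑ m, FD m (k.xi * fs FD A m i)) = ∑ m, FD m (k.xi * FD m (rad A)) := by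
  have e : ∀ m, FD m (rad A) = ∑ i, FX i * fs FD A m i := fun m => (rad_fs h m).symm
  simp only [e]
  simp only [rad, Fin.sum_univ_three, map_add, Derivation.leibniz, smul_eq_mul, FD_FX,
    Fin.reduceEq, if_true, if_false, fs_self, fs_skew A 1 0, fs_skew A 2 0, fs_skew A 2 1,
    map_neg, map_zero]
  ring

/-- The radial part of the potential influences only the radial part of the variation of the
electric field. Radial and angular parities, which are independent of each other, are thus preserved
separately. -/
theorem tan_div_fs {k : Killing FD} (hk : Lorentz k) {A : Fin 3 → Far}
    (h : ∀ i, Homog (-1) (A i)) (i : Fin 3) :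
    tan (fun i => ∑ m, FD m (k.xi * fs FD A m i)) i = ∑ m, FD m (k.xi * fs FD (tan A) m i) := by
  have ha : Homog 0 (rad A) := Homog.rad h
  -- The radial part of `A` contributes the wedge of its differential with `x / r²`; derivatives of
  -- `r⁻²` are radial and cancel by skewness.
  have e1 : ∀ m, fs FD A m i = fs FD (tan A) m i
      + (FX i * FD m (rad A) - FX m * FD i (rad A)) * Fr ^ 2 := fun m => by
    simp only [fs, tan, map_sub, Derivation.leibniz, Derivation.leibniz_pow, FD_Fr, FD_FX,
      smul_eq_mul, nsmul_eq_mul, eq_comm (a := i) (b := m)]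
    push_cast; ring
  have e2 := sum_mul_FD_mul ((hk.homog_xi.mul Homog.inv_norm_sq rfl).mul
    (ha.deriv i (k := -1)) rfl)
  have e3 : ∑ m, FX m * FD m (k.xi * Fr ^ 2) = -(k.xi * Fr ^ 2) := by
    rw [(hk.homog_xi.mul Homog.inv_norm_sq (k := -1)).euler]; push_cast; ring
  have e4 : ∑ m, FD m (k.xi * Fr ^ 2 * FD m (rad A)) = Fr ^ 2 * ∑ m, FD m (k.xi * FD m (rad A)) := by
    have := rad_grad ha
    simp only [rad, Fin.sum_univ_three, Derivation.leibniz, Derivation.leibniz_pow, FD_Fr,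
      smul_eq_mul, nsmul_eq_mul] at this ⊢
    push_cast
    linear_combination (-2 * k.xi * Fr ^ 4) * this
  have e5 : ∑ m, FD m (k.xi * fs FD A m i) = ∑ m, FD m (k.xi * fs FD (tan A) m i)
      + (FX i * ∑ m, FD m (k.xi * Fr ^ 2 * FD m (rad A)) + k.xi * Fr ^ 2 * FD i (rad A)
        - ∑ m, FD m (k.xi * Fr ^ 2 * FD i (rad A) * FX m)) := by
    have : k.xi * Fr ^ 2 * FD i (rad A) =
        ∑ m, FD m (FX i) * (k.xi * Fr ^ 2 * FD m (rad A)) := by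
      simp [FD_FX]
    conv_rhs => enter [2, 1, 2]; rw [this]
    rw [Finset.mul_sum, ← Finset.sum_add_distrib, ← Finset.sum_sub_distrib,
      ← Finset.sum_add_distrib]
    refine Finset.sum_congr rfl fun m _ => ?_
    rw [e1]
    simp only [mul_add, map_add, mul_sub, sub_mul, map_sub]
    rw [show k.xi * (FX i * FD m (rad A) * Fr ^ 2) = FX i * (k.xi * Fr ^ 2 * FD m (rad A)) by ring,
      show k.xi * (FX m * FD i (rad A) * Fr ^ 2) = k.xi * Fr ^ 2 * FD i (rad A) * FX m by ring,
      Derivation.leibniz (D := FD m) (FX i)]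
    simp only [smul_eq_mul]
    ring
  rw [tan, rad_div_fs h, e5, e2, e4]
  push_cast; ring

theorem refl_fs (A : Fin 3 → Far) (i j : Fin 3) :
    refl (fs FD A i j) = -fs FD (fun i => refl (A i)) i j := by
  simp only [fs, map_sub, FD_refl]; ring

theorem Lorentz.refl_div {k : Killing FD} (hk : Lorentz k) (f : Fin 3 → Far) :
    refl (∑ m, FD m (k.xi * f m)) = ∑ m, FD m (k.xi * refl (f m)) := by
  rw [map_sum]
  refine Finset.sum_congr rfl fun m _ => ?_
  rw [← neg_eq_iff_eq_neg.2 (FD_refl m (k.xi * f m)), map_mul, hk.refl_xi, Far.neg_mul, map_neg, neg_neg]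

/-- The Poincaré transformations preserve the conditions on the leading terms. -/
theorem LeadCond.act {s : ℝ} (hs : s * s = 1) {k : Killing FD} (hk : Lorentz k) {z : Quad Far}
    (h : LeadCond s z.1 z.2.1) (hA : ∀ i, Homog (-1) (z.1 i))
    (hΨ : Homog (-1) z.2.2.1) (hz : z.2.2.2 = 0) : LeadCond s (k.act z).1 (k.act z).2.1 := by
  have hΨ' : Homog 0 (k.xi * z.2.2.1) := hk.homog_xi.mul hΨ
  refine ⟨?_, ?_, ?_, fun i => ?_, ?_⟩
  · rw [k.act_fst_eq, rad_add, rad_add, rad_mul, rad_grad hΨ', hk.rad_lie]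
    simp only [map_add, map_mul, map_zero, hk.refl_xi, h.radP, hk.refl_along, h.radA]
    simp only [Killing.along, map_neg, Far.mul_neg, Finset.sum_neg_distrib]
    ring
  · rw [k.act_snd_eq z hz, rad_add, rad_div_fs hA, hk.rad_lie, map_add, hk.refl_along, h.radP,
      hk.refl_div]
    congr 1
    refine Finset.sum_congr rfl fun m _ => ?_
    rw [← neg_eq_iff_eq_neg.2 (FD_refl m _), h.radA, map_neg, neg_neg]
  · obtain ⟨Φ, h1, h2, h3⟩ := h.angA
    refine ⟨-(s • (k.xi * z.2.2.1)) - refl (k.xi * z.2.2.1) + k.along Φ,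
      ((hΨ'.smul s).neg.sub hΨ'.refl).add (hk.homog_along h1), ?_, fun i => ?_⟩
    · simp only [map_add, map_sub, map_neg, map_smul, refl_refl, hk.refl_along, h2]
      have : k.along (s • Φ) = s • k.along Φ := by
        simp only [Killing.along, Derivation.map_smul, mul_smul_comm, Finset.smul_sum]
      rw [this, smul_add, smul_sub, smul_neg, smul_smul, hs, one_smul]; ring
    · rw [k.act_fst_eq, tan_add, tan_add, tan_mul, tan_grad hΨ', hk.tan_lie]
      simp only [map_add, map_sub, map_neg, map_mul, hk.refl_xi, h.angP, hk.refl_lie, h3,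
        Killing.lie_add, Killing.lie_smul, Killing.lie_grad, smul_add, Derivation.map_smul]
      have := FD_refl i (k.xi * z.2.2.1)
      rw [map_mul, hk.refl_xi] at this
      rw [← neg_eq_iff_eq_neg.2 this]
      simp only [mul_smul_comm, Far.neg_mul, Far.mul_neg, neg_neg, map_neg, smul_neg]
      ring
  · rw [k.act_snd_eq z hz, tan_add, tan_div_fs hk hA, hk.tan_lie, map_add, hk.refl_lie, hk.refl_div]
    obtain ⟨Φ, h1, h2, h3⟩ := h.angA
    have e1 : ∀ m, refl (fs FD (tan z.1) m i) = -(s • fs FD (tan z.1) m i) := fun m => by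
      rw [refl_fs]
      simp only [h3, fs, map_add, Derivation.map_smul, FD_comm i m, smul_sub]
      ring
    have e2 : k.lie (fun j => refl (tan z.2.1 j)) i = -(s • k.lie (tan z.2.1) i) := by
      simp only [h.angP, ← neg_smul, Killing.lie_smul]
    simp only [e1, e2, Far.mul_neg, mul_smul_comm, map_neg, Derivation.map_smul, Finset.sum_neg_distrib,
      ← Finset.smul_sum, smul_add]
    ring
  -- The leading term of `π_Ψ` is zero, so the leading divergence is merely Lie transported and
  -- stays zero.
  · rw [k.div_act FD_comm, h.div, hz]
    simp

/-! ### Surface terms of the Poincaré generators. -/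

/-- Twice the polarization of the surface term of the Poincaré generator. -/
def Killing.surf (k : Killing FD) (z w : Quad Far) : Far :=
  k.xi * (z.2.2.1 * rad w.2.1 + w.2.2.1 * rad z.2.1 + ∑ i, z.1 i * FD i (rad w.1)
      + ∑ i, w.1 i * FD i (rad z.1))
    + ((∑ i, k.Y i * z.1 i) * rad w.2.1 + (∑ i, k.Y i * w.1 i) * rad z.2.1
      + z.2.2.1 * k.along (rad w.1) + w.2.2.1 * k.along (rad z.1))

theorem Killing.surf_comm (k : Killing FD) (z w : Quad Far) : k.surf z w = k.surf w z := by
  simp only [Killing.surf]; ring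

theorem Lorentz.rad_act {k : Killing FD} (hk : Lorentz k) {z : Quad Far} (hΨ : Homog (-1) z.2.2.1) :
    rad (k.act z).1 = k.xi * rad z.2.1 + k.along (rad z.1) := by
  have hΨ' : Homog 0 (k.xi * z.2.2.1) := hk.homog_xi.mul hΨ
  rw [k.act_fst_eq, rad_add, rad_add, rad_mul, rad_grad hΨ', hk.rad_lie, zero_add]

/-- All contributions at infinity collected: the flux of `Killing.polar_eq`, the surface term of the
generator and the surface term of the symplectic form. The last is what compensates the boosts; the
remainder is an exact divergence. -/
theorem Lorentz.surface_eq {k : Killing FD} (hk : Lorentz k) {z w : Quad Far}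
    (hA : ∀ i, Homog (-1) (z.1 i)) (hΨ : Homog (-1) z.2.2.1) (hz : z.2.2.2 = 0)
    (hw : w.2.2.2 = 0) :
    rad (k.flux z w) + k.surf z w - (rad (k.act z).1 * w.2.2.1 - rad w.1 * (k.act z).2.2.1)
      = ∑ i, FD i (rad w.1 * (k.xi * z.1 i + k.Y i * z.2.2.1)) := by
  have e1 : rad (k.flux z w) = -(k.xi * z.2.2.1 * rad w.2.1) - k.xi * ∑ i, w.1 i * FD i (rad z.1)
      - (∑ j, k.Y j * z.1 j) * rad w.2.1 - (∑ j, k.Y j * w.1 j) * rad z.2.1 := by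
    have h1 := hk.rad_Y
    have h2 : ∑ m, FX m * ∑ i, fs FD z.1 m i * w.1 i = -∑ i, w.1 i * FD i (rad z.1) := by
      simp only [Finset.mul_sum]
      rw [Finset.sum_comm, ← Finset.sum_neg_distrib]
      refine Finset.sum_congr rfl fun i _ => ?_
      rw [← rad_fs hA, Finset.mul_sum, ← Finset.sum_neg_distrib]
      exact Finset.sum_congr rfl fun m _ => by rw [fs_skew]; ring
    simp only [rad, Killing.flux, hz, hw, Fin.sum_univ_three] at *
    linear_combination (k.xi) * h2
      + (z.2.1 0 * w.1 0 + z.2.1 1 * w.1 1 + z.2.1 2 * w.1 2) * h1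
  have e2 : ∑ i, FD i (rad w.1 * (k.xi * z.1 i + k.Y i * z.2.2.1)) =
      k.xi * (∑ i, z.1 i * FD i (rad w.1)) + z.2.2.1 * k.along (rad w.1)
        + rad w.1 * (∑ i, FD i (k.xi * z.1 i) + k.along z.2.2.1) := by
    simp only [Killing.along, Fin.sum_univ_three, Derivation.leibniz, smul_eq_mul, map_add, k.d_Y,
      k.om_diag]
    ring
  rw [hk.rad_act hΨ, e1, e2, Killing.surf]
  simp only [Killing.act, Killing.along]
  ring

/-- The surface terms in the variation of the Poincaré generators cancel. -/
theorem Lorentz.sInt_surface {s : ℝ} {k : Killing FD} (hk : Lorentz k) {z w : Quad Far}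
    (h : LeadCond s z.1 z.2.1) (h' : LeadCond s w.1 w.2.1)
    (hA : ∀ i, Homog (-1) (z.1 i)) (hA' : ∀ i, Homog (-1) (w.1 i)) (hΨ : Homog (-1) z.2.2.1)
    (hz : z.2.2.2 = 0) (hw : w.2.2.2 = 0) :
    sInt (rad (k.flux z w)) + sInt (k.surf z w)
      - sInt (rad (k.act z).1 * w.2.2.1 - rad w.1 * (k.act z).2.2.1) = 0 := by
  -- The vector field has degree `0`, so its divergence integrates to twice its radial component.
  -- The rotation drops out there, leaving the product of three odd functions.
  have hV : ∀ i, Homog 0 (rad w.1 * (k.xi * z.1 i + k.Y i * z.2.2.1)) := fun i =>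
    (Homog.rad hA' (e := 0)).mul ((hk.homog_xi.mul (hA i) (k := 0)).add ((hk.homog_Y i).mul hΨ))
  have e : rad (fun i => rad w.1 * (k.xi * z.1 i + k.Y i * z.2.2.1)) = rad w.1 * k.xi * rad z.1 := by
    have h1 := hk.rad_Y
    simp only [rad, Fin.sum_univ_three] at *
    linear_combination (FX 0 * w.1 0 + FX 1 * w.1 1 + FX 2 * w.1 2) * z.2.2.1 * h1
  rw [← map_add, ← map_sub, hk.surface_eq hA hΨ hz hw, sInt_dv hV, e,
    sInt_eq_zero_of_odd (by simp only [map_mul, h.radA, h'.radA, hk.refl_xi]; ring), mul_zero]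

/-! ### The phase space in terms of components -/

/-- The sign in the parity conditions. -/
def sgn : AngularBC → ℝ
  | .twisted => -1
  | .magnetic => 1

theorem sgn_mul_self (c : AngularBC) : sgn c * sgn c = 1 := by cases c <;> norm_num [sgn]

/-- The configuration with given smooth components. -/
def toConfig (b : Quad Bulk) : Config :=
  (fun x => WithLp.toLp 2 fun i => (b.1 i).1 x, fun x => WithLp.toLp 2 fun i => (b.2.1 i).1 x,
    b.2.2.1.1, b.2.2.2.1)

theorem toConfig_add (b b' : Quad Bulk) : toConfig (b + b') = toConfig b + toConfig b' := by
  refine Prod.ext (funext fun x => ?_) (Prod.ext (funext fun x => ?_) (Prod.ext rfl rfl)) <;>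
  · ext i; rfl

theorem toConfig_smul (t : ℝ) (b : Quad Bulk) : toConfig (t • b) = t • toConfig b := by
  refine Prod.ext (funext fun x => ?_) (Prod.ext (funext fun x => ?_) (Prod.ext rfl rfl)) <;>
  · ext i; rfl

/-- The fall-off conditions: the components `b` have leading terms `l`. -/
structure HasLead (b : Quad Bulk) (l : Quad Far) : Prop where
  A : ∀ i, Lead1 1 (restr (b.1 i)) (l.1 i)
  P : ∀ i, Lead1 2 (restr (b.2.1 i)) (l.2.1 i)
  Ψ : Lead1 1 (restr b.2.2.1) l.2.2.1
  Q : ∃ Q0, Lead0 3 (restr b.2.2.2) Q0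
  zero : l.2.2.2 = 0

theorem HasLead.add {b b' : Quad Bulk} {l l' : Quad Far} (h : HasLead b l) (h' : HasLead b' l') :
    HasLead (b + b') (l + l') where
  A i := by simpa only [Prod.fst_add, Pi.add_apply, map_add] using (h.A i).add (h'.A i)
  P i := by simpa only [Prod.fst_add, Prod.snd_add, Pi.add_apply, map_add] using (h.P i).add (h'.P i)
  Ψ := by simpa only [Prod.fst_add, Prod.snd_add, map_add] using h.Ψ.add h'.Ψ
  Q := by
    obtain ⟨Q, hQ⟩ := h.Q
    obtain ⟨Q', hQ'⟩ := h'.Q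
    exact ⟨Q + Q', by simpa only [Prod.snd_add, map_add] using hQ.add hQ'⟩
  zero := by simp only [Prod.snd_add, h.zero, h'.zero, add_zero]

theorem HasLead.smul (t : ℝ) {b : Quad Bulk} {l : Quad Far} (h : HasLead b l) :
    HasLead (t • b) (t • l) where
  A i := by simpa only [Prod.smul_fst, Pi.smul_apply, map_smul] using (h.A i).smul t
  P i := by simpa only [Prod.smul_fst, Prod.smul_snd, Pi.smul_apply, map_smul] using (h.P i).smul t
  Ψ := by simpa only [Prod.smul_fst, Prod.smul_snd, map_smul] using h.Ψ.smul t
  Q := by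
    obtain ⟨Q, hQ⟩ := h.Q
    exact ⟨t • Q, by simpa only [Prod.smul_snd, map_smul] using hQ.smul t⟩
  zero := by simp only [Prod.smul_snd, h.zero, smul_zero]

/-- The components `b` with leading terms `l` satisfy the boundary conditions. -/
structure Admissible (c : AngularBC) (b : Quad Bulk) (l : Quad Far) : Prop where
  lead : HasLead b l
  cond : LeadCond (sgn c) l.1 l.2.1

section Bridge

variable {b : Quad Bulk} {l : Quad Far}

/-- The gradient on the sphere is defined by extension along rays, and a function of degree `0` is
its own such extension. -/
theorem sgrad_sph {F : Far} (hF : Homog 0 F) (n : S2) (i : Fin 3) :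
    sgrad (sph F) n i = sph (FD i F) n := by
  have h1 : sgrad (sph F) n i = inner ℝ (ev i) (sgrad (sph F) n) := by
    simp [ev, EuclideanSpace.inner_single_left]
  rw [h1, real_inner_comm, sgrad, inner_gradient_left]
  change pd i _ _ = pd i _ _
  refine pd_congr_on (fun x hx => ?_) i n (sphere_ne_zero n)
  rw [show x = (⟨x, hx⟩ : Punct).1 from rfl, F.ex_apply, hF.apply_eq, radialExt_apply, zpow_zero,
    one_mul]

theorem tang_toLp (V : Fin 3 → Far) (n : S2) :
    tang (fun n => WithLp.toLp 2 fun i => sph (V i) n) n = WithLp.toLp 2 fun i => sph (tan V i) n := by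
  ext i
  simp [tang, tan, rad, PiLp.inner_apply]

theorem HasLead.lead_vecA (h : HasLead b l) :
    lead 1 (vecA (toConfig b)) = fun n => WithLp.toLp 2 fun i => sph (l.1 i) n :=
  lead_vector fun i => (h.A i).lead0

theorem HasLead.lead_momA (h : HasLead b l) :
    lead 2 (momA (toConfig b)) = fun n => WithLp.toLp 2 fun i => sph (l.2.1 i) n :=
  lead_vector fun i => (h.P i).lead0

theorem HasLead.barAr (h : HasLead b l) : barAr (toConfig b) = sph (rad l.1) := funext fun n => by
  simp [EMInfinity.barAr, h.lead_vecA, rad, PiLp.inner_apply]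

theorem HasLead.barPr (h : HasLead b l) : barPr (toConfig b) = sph (rad l.2.1) := funext fun n => by
  simp [EMInfinity.barPr, h.lead_momA, rad, PiLp.inner_apply]

theorem HasLead.barAang (h : HasLead b l) (n : S2) :
    barAang (toConfig b) n = WithLp.toLp 2 fun i => sph (tan l.1 i) n := by
  rw [EMInfinity.barAang, h.lead_vecA, tang_toLp]

theorem HasLead.barPang (h : HasLead b l) (n : S2) :
    barPang (toConfig b) n = WithLp.toLp 2 fun i => sph (tan l.2.1 i) n := by
  rw [EMInfinity.barPang, h.lead_momA, tang_toLp]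

theorem HasLead.barPsi (h : HasLead b l) : barPsi (toConfig b) = sph l.2.2.1 :=
  Lead0.lead_eq h.Ψ.lead0

/-- Passing from extension along rays to extension of degree `-d` inserts the factor `r ^ (-d)`. Its
gradient is radial and does not see a tangential field, so both divergences agree on the unit
sphere. -/
theorem sdiv_toLp {d : ℕ} {V : Fin 3 → Far} (h : ∀ i, Homog (-d) (V i)) (hV : rad V = 0) (n : S2) :
    sdiv (fun n => WithLp.toLp 2 fun i => sph (V i) n) n = sph (∑ i, FD i (V i)) n := by
  set U : S2 → E3 := fun n => WithLp.toLp 2 fun i => sph (V i) n with hU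
  set W : Fin 3 → Far := fun i => hom 0 (sph (V i)) (sphereSmooth_sph _) with hW
  have h1 : ∀ i x, radialExt U x i = radialExt (sph (V i)) x := fun i x =>
    (radialExt_clm U (coordL i) x).symm
  have h2 : SphereSmooth U := by
    refine (contDiffOn_piLp 2).2 fun i => ?_
    simp only [h1]
    exact sphereSmooth_sph _
  have h3 : ∀ i, fderiv ℝ (radialExt U) (n : E3) (ev i) i = sph (FD i (W i)) n := fun i => by
    have hd : DifferentiableAt ℝ (radialExt U) (n : E3) :=
      ((h2 n (sphere_ne_zero n)).contDiffAt (isOpen_punctured.mem_nhds (sphere_ne_zero n))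
        ).differentiableAt (by simp)
    have e1 := (coordL i).hasFDerivAt.comp (n : E3) hd.hasFDerivAt
    have e2 : (⇑(coordL i) ∘ radialExt U) = radialExt (sph (V i)) := funext fun x => h1 i x
    rw [e2] at e1
    have e3 : pd i (radialExt (sph (V i))) (n : E3) = fderiv ℝ (radialExt U) (n : E3) (ev i) i := by
      rw [pd, e1.fderiv]; rfl
    rw [← e3]
    refine pd_congr_on (fun x hx => ?_) i n (sphere_ne_zero n)
    rw [Far.ex_of_ne _ hx, hom_apply]; simp
  have h4 : ∀ i, V i = Fr ^ d * W i := fun i =>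
    Homog.ext_sph (h i) ((Homog.pow_inv_norm d).mul (homog_hom 0 _) (by simp)) fun n => by
      simp [hW]
  have h5 : ∑ i, FX i * W i = 0 := by
    have : Homog 1 (∑ i, FX i * W i) :=
      Homog.sum _ fun i _ => (Homog.coord i).mul (homog_hom 0 (sphereSmooth_sph (V i)))
    refine Homog.ext_sph this (Homog.zero _) fun n => ?_
    have := congrArg (fun F => sph F n) hV
    simpa [rad, hW] using this
  have h6 : sph (∑ i, FD i (V i)) n = sph (∑ i, FD i (W i)) n := by
    have e : ∀ i, FD i (V i) = Fr ^ d * FD i (W i)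
        - ((d : Far) * Fr ^ (d - 1) * Fr ^ 3) * (FX i * W i) := fun i => by
      rw [h4]
      simp only [Derivation.leibniz, Derivation.leibniz_pow, FD_Fr, smul_eq_mul, nsmul_eq_mul]
      ring
    rw [Finset.sum_congr rfl fun i _ => e i, Finset.sum_sub_distrib, ← Finset.mul_sum,
      ← Finset.mul_sum, h5]
    simp
  rw [h6, sdiv]
  simp only [h3, sph_sum]

theorem HasLead.homA (h : HasLead b l) (i : Fin 3) : Homog (-1) (l.1 i) := (h.A i).homog

theorem HasLead.homP (h : HasLead b l) (i : Fin 3) : Homog (-2) (l.2.1 i) := (h.P i).homog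

theorem HasLead.homΨ (h : HasLead b l) : Homog (-1) l.2.2.1 := h.Ψ.homog

theorem HasLead.sdiv_eq (h : HasLead b l) (n : S2) :
    sdiv (EMInfinity.barPang (toConfig b)) n = sph (∑ i, FD i (l.2.1 i)) n := by
  rw [funext h.barPang, sdiv_toLp (d := 2) (Homog.tan h.homP) (rad_tan _), dv_tan h.homP]

theorem toLp_eq_iff {f g : Fin 3 → ℝ} :
    (WithLp.toLp 2 f : E3) = WithLp.toLp 2 g ↔ ∀ i, f i = g i := by
  rw [(WithLp.toLp_injective 2).eq_iff, funext_iff]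

/-- Both boundary conditions are brought to the form "parity `s` up to the gradient of a function of
parity `s`", so that all later arguments treat them at once. -/
theorem HasLead.angularParity_iff (h : HasLead b l) (c : AngularBC) :
    AngularParity c (toConfig b) ↔
      (∃ Φ, Homog 0 Φ ∧ refl Φ = sgn c • Φ ∧ ∀ i, refl (tan l.1 i) = sgn c • tan l.1 i + FD i Φ) ∧
      ∀ i, refl (tan l.2.1 i) = -(sgn c • tan l.2.1 i) := by
  have hA := Homog.tan h.homA
  have hP := Homog.tan h.homP
  have hsg : ∀ {Φ : Far}, Homog 0 Φ → ∀ n, sgrad (sph Φ) n = WithLp.toLp 2 fun i => sph (FD i Φ) n :=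
    fun hΦ n => by ext i; exact sgrad_sph hΦ n i
  cases c with
  | twisted =>
    simp only [AngularParity, sgn, h.barAang, h.barPang]
    refine and_congr ⟨?_, ?_⟩ ⟨fun h1 i => ?_, fun h1 n => ?_⟩
    · rintro ⟨Φ, h1, h2, h3⟩
      refine ⟨hom 0 Φ h1, homog_hom 0 h1, ?_, fun i => ?_⟩
      · refine Homog.ext_sph (homog_hom 0 h1).refl ((homog_hom 0 h1).smul _) fun n => ?_
        simp [sph_refl, h2]
      · refine Homog.ext_sph (hA i).refl (((hA i).smul _).add ((homog_hom 0 h1).deriv i)) fun n => ?_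
        have h4 := h3 n
        rw [← sph_hom 0 h1, hsg (homog_hom 0 h1), ← WithLp.toLp_neg, ← WithLp.toLp_add,
          toLp_eq_iff] at h4
        simpa [sph_refl] using h4 i
    · rintro ⟨Φ, h1, h2, h3⟩
      refine ⟨sph Φ, sphereSmooth_sph Φ, fun n => ?_, fun n => ?_⟩
      · rw [← sph_refl, h2]; simp
      · rw [hsg h1, ← WithLp.toLp_neg, ← WithLp.toLp_add, toLp_eq_iff]
        intro i
        rw [← sph_refl, h3]; simp
    · refine Homog.ext_sph (hP i).refl ((hP i).smul _).neg fun n => ?_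
      have := (toLp_eq_iff.1 (h1 n)) i
      simpa [sph_refl] using this
    · rw [toLp_eq_iff]
      intro i
      rw [← sph_refl, h1]; simp
  | magnetic =>
    simp only [AngularParity, sgn, h.barAang, h.barPang, one_smul]
    refine and_congr ⟨?_, ?_⟩ ⟨fun h1 i => ?_, fun h1 n => ?_⟩
    · rintro ⟨U, Φ, h1, h2, h3⟩
      set Θ := hom 0 Φ h1
      have hΘ : Homog 0 Θ := homog_hom 0 h1
      -- If `A` is an even field plus the gradient of `Θ`, then the reflected `A` differs from `A`
      -- by minus the gradients of `Θ` and of its reflection.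
      refine ⟨-(Θ + refl Θ), (hΘ.add hΘ.refl).neg, by simp only [map_neg, map_add, refl_refl, add_comm],
        fun i => ?_⟩
      refine Homog.ext_sph (hA i).refl ((hA i).add ((hΘ.add hΘ.refl).neg.deriv i)) fun n => ?_
      have h4 := h3 n
      have h5 := h3 (-n)
      rw [h2, eq_comm, ← eq_sub_iff_add_eq] at h5
      rw [h5, ← sph_hom 0 h1, hsg hΘ, hsg hΘ, ← WithLp.toLp_sub, ← WithLp.toLp_add,
        toLp_eq_iff] at h4
      have h6 := h4 i
      simp only [Pi.add_apply, Pi.sub_apply] at h6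
      simp only [map_neg, map_add, FD_refl, sph_refl, sph_add, sph_neg]
      linarith
    · rintro ⟨Φ, h1, h2, h3⟩
      -- Half of the failure of evenness is moved to each side: since `Φ` is even, its gradient is
      -- odd, and `A + ½ ∂Φ` is even.
      refine ⟨fun n => WithLp.toLp 2 fun i => sph (tan l.1 i + (1 / 2 : ℝ) • FD i Φ) n,
        sph (-(1 / 2 : ℝ) • Φ), sphereSmooth_sph _, fun n => ?_, fun n => ?_⟩
      · rw [toLp_eq_iff]
        intro i
        have h5 : refl (FD i Φ) = -FD i Φ := by
          rw [← neg_eq_iff_eq_neg.2 (FD_refl i Φ), h2]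
        rw [← sph_refl, map_add, map_smul, h3, h5]
        simp only [sph_add, sph_smul, sph_neg]
        ring
      · rw [hsg (h1.smul _), ← WithLp.toLp_add, toLp_eq_iff]
        intro i
        simp only [Pi.add_apply, sph_add, sph_smul, Derivation.map_smul]
        ring
    · refine Homog.ext_sph (hP i).refl (hP i).neg fun n => ?_
      have := (toLp_eq_iff.1 ((h1 n).trans (WithLp.toLp_neg 2 _).symm)) i
      simpa [sph_refl] using this
    · rw [← WithLp.toLp_neg, toLp_eq_iff]
      intro i
      rw [← sph_refl, h1]; simp

theorem HasLead.mem_iff (h : HasLead b l) (c : AngularBC) :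
    toConfig b ∈ phaseSpace c ↔ LeadCond (sgn c) l.1 l.2.1 := by
  rw [phaseSpace, Set.mem_ofPred]
  have e1 : HasExpansion 1 1 (vecA (toConfig b)) :=
    hasExpansion_vector_iff.2 fun i => hasExpansion_one_iff.2 ⟨_, h.A i⟩
  have e2 : HasExpansion 2 1 (momA (toConfig b)) :=
    hasExpansion_vector_iff.2 fun i => hasExpansion_one_iff.2 ⟨_, h.P i⟩
  have e3 : HasExpansion 1 1 (psi (toConfig b)) := hasExpansion_one_iff.2 ⟨_, h.Ψ⟩
  have e4 : HasExpansion 3 0 (momPsi (toConfig b)) := hasExpansion_zero_iff.2 h.Q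
  have hdiv : Homog (-3) (∑ i, FD i (l.2.1 i)) := Homog.sum _ fun i _ => (h.homP i).deriv i
  simp only [e1, e2, e3, e4, true_and, h.angularParity_iff, h.barAr, h.barPr, h.sdiv_eq]
  constructor
  · rintro ⟨h1, h2, h3, h4⟩
    refine ⟨?_, ?_, h3.1, h3.2, Homog.ext_sph hdiv (Homog.zero _) h4⟩
    · exact Homog.ext_sph (Homog.rad h.homA (e := 0)).refl (Homog.rad h.homA).neg fun n => by
        rw [sph_refl, h1]; rfl
    · exact Homog.ext_sph (Homog.rad h.homP (e := -1)).refl (Homog.rad h.homP) fun n => by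
        rw [sph_refl, h2]
  · intro h1
    refine ⟨fun n => ?_, fun n => ?_, ⟨h1.angA, h1.angP⟩, fun n => ?_⟩
    · rw [← sph_refl, h1.radA]; rfl
    · rw [← sph_refl, h1.radP]
    · rw [h1.div]; rfl

theorem Admissible.mem {c : AngularBC} (h : Admissible c b l) : toConfig b ∈ phaseSpace c :=
  (h.lead.mem_iff c).2 h.cond

/-- The entry point from phase space to algebra: later proofs replace configurations by components
in `Bulk` together with their leading terms in `Far`. -/
theorem exists_admissible {c : AngularBC} {z : Config} (hz : z ∈ phaseSpace c) :
    ∃ b l, z = toConfig b ∧ Admissible c b l := by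
  have h := hz
  rw [phaseSpace, Set.mem_ofPred] at h
  obtain ⟨h1, h2, h3, h4, -⟩ := h
  have g1 := hasExpansion_vector_iff.1 h1
  have g2 := hasExpansion_vector_iff.1 h2
  have k1 := fun i => hasExpansion_one_iff (f := Bulk.of _ (g1 i).1) |>.1 (g1 i)
  have k2 := fun i => hasExpansion_one_iff (f := Bulk.of _ (g2 i).1) |>.1 (g2 i)
  choose A0 hA0 using k1
  choose P0 hP0 using k2
  obtain ⟨Ψ0, hΨ0⟩ := hasExpansion_one_iff (f := Bulk.of _ h3.1) |>.1 h3
  have h5 := hasExpansion_zero_iff (f := Bulk.of _ h4.1) |>.1 h4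
  let b : Quad Bulk := (fun i => Bulk.of _ (g1 i).1, fun i => Bulk.of _ (g2 i).1,
    Bulk.of _ h3.1, Bulk.of _ h4.1)
  have hl : HasLead b (A0, P0, Ψ0, 0) := ⟨hA0, hP0, hΨ0, h5, rfl⟩
  have e : z = toConfig b := rfl
  exact ⟨b, _, e, hl, (hl.mem_iff c).1 (e ▸ hz)⟩

end Bridge

theorem Admissible.add {c : AngularBC} {b b' : Quad Bulk} {l l' : Quad Far}
    (h : Admissible c b l) (h' : Admissible c b' l') : Admissible c (b + b') (l + l') :=
  ⟨h.lead.add h'.lead, h.cond.add h'.cond⟩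

theorem Admissible.smul {c : AngularBC} {b : Quad Bulk} {l : Quad Far} (t : ℝ)
    (h : Admissible c b l) : Admissible c (t • b) (t • l) :=
  ⟨h.lead.smul t, h.cond.smul t⟩

theorem add_mem_phaseSpace {c : AngularBC} {z w : Config} (hz : z ∈ phaseSpace c)
    (hw : w ∈ phaseSpace c) : z + w ∈ phaseSpace c := by
  obtain ⟨b, l, rfl, h⟩ := exists_admissible hz
  obtain ⟨b', l', rfl, h'⟩ := exists_admissible hw
  rw [← toConfig_add]
  exact (h.add h').mem

theorem smul_mem_phaseSpace {c : AngularBC} {z : Config} (t : ℝ) (hz : z ∈ phaseSpace c) :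
    t • z ∈ phaseSpace c := by
  obtain ⟨b, l, rfl, h⟩ := exists_admissible hz
  rw [← toConfig_smul]
  exact (h.smul t).mem

/-! ### The symplectic form -/

theorem kinDensity_toConfig (b b' : Quad Bulk) :
    kinDensity (toConfig b) (toConfig b') = (kd b b').1 := funext fun x => by
  simp only [kinDensity, kd, toConfig, momA, vecA, momPsi, psi, PiLp.inner_apply, Bulk.add_apply,
    Bulk.sum_apply, Bulk.mul_apply, RCLike.inner_apply, conj_trivial]
  congr 1
  exact Finset.sum_congr rfl fun i _ => mul_comm _ _

theorem HasLead.kd {b b' : Quad Bulk} {l l' : Quad Far} (h : HasLead b l) (h' : HasLead b' l') :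
    Lead1 3 (restr (kd b b')) (∑ i, l.2.1 i * l'.1 i) := by
  obtain ⟨Q, hQ⟩ := h.Q
  have h1 := Lead1.sum Finset.univ fun i _ => (h.P i).mul (h'.A i) (m := 3)
  -- The product of `π_Ψ` and `Ψ` has order `r⁻⁴`, so it does not affect the leading term.
  have h2 := (hQ.mul h'.Ψ.lead0 (m := 4)).shift (k := 3)
  have := h1.add h2
  rw [add_zero] at this
  simpa only [EMInfinity.kd, map_add, map_sum, map_mul] using this

theorem Admissible.kd {c : AngularBC} {b b' : Quad Bulk} {l l' : Quad Far} (h : Admissible c b l)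
    (h' : Admissible c b' l') : ∃ L, BulkTendsto (kd b b') L :=
  bulkTendsto_of_lead1 (h.lead.kd h'.lead)
    (h.cond.sInt_pairing (sgn_mul_self c) h'.cond h.lead.homP)

/-- Stated as a limit of the bulk part, so that uniqueness of limits turns identities between
densities into identities for `symp`. -/
theorem Admissible.symp {c : AngularBC} {b b' : Quad Bulk} {l l' : Quad Far} (h : Admissible c b l)
    (h' : Admissible c b' l') : BulkTendsto (EMInfinity.kd b b' - EMInfinity.kd b' b)
      (symp (toConfig b) (toConfig b') + sInt (rad l.1 * l'.2.2.1 - rad l'.1 * l.2.2.1)) := by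
  obtain ⟨L, hL⟩ := h.kd h'
  obtain ⟨M, hM⟩ := h'.kd h
  have e : ∀ F G : Far, sphereInt (fun n => sph F n * sph G n) = sInt (F * G) := fun _ _ => rfl
  have := hL.sub hM
  convert this using 1
  rw [EMInfinity.symp, kinetic, kinetic, kinDensity_toConfig, kinDensity_toConfig, hL.bulkInt_eq,
    hM.bulkInt_eq, h.lead.barAr, h'.lead.barAr, h.lead.barPsi, h'.lead.barPsi, e, e, map_sub]
  ring

theorem BulkTendsto.unique {f : Bulk} {L M : ℝ} (hL : BulkTendsto f L) (hM : BulkTendsto f M) :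
    L = M := tendsto_nhds_unique hL hM

theorem symp_comm (z w : Config) : symp z w = -symp w z := by simp only [symp]; ring

theorem symp_add_left {c : AngularBC} {z w v : Config} (hz : z ∈ phaseSpace c)
    (hw : w ∈ phaseSpace c) (hv : v ∈ phaseSpace c) : symp (z + w) v = symp z v + symp w v := by
  obtain ⟨b, l, rfl, h⟩ := exists_admissible hz
  obtain ⟨b', l', rfl, h'⟩ := exists_admissible hw
  obtain ⟨b'', l'', rfl, h''⟩ := exists_admissible hv
  have h1 := (h.add h').symp h''
  have h2 := (h.symp h'').add (h'.symp h'')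
  have e : kd b b'' - kd b'' b + (kd b' b'' - kd b'' b') = kd (b + b') b'' - kd b'' (b + b') := by
    simp only [kd, Fin.sum_univ_three, Prod.fst_add, Prod.snd_add, Pi.add_apply]; ring
  rw [e] at h2
  have := h1.unique h2
  simp only [Prod.fst_add, Prod.snd_add, rad_add, add_mul, mul_add, map_sub, map_add] at this
  rw [← toConfig_add]
  linarith

theorem symp_smul_left {c : AngularBC} {z v : Config} (t : ℝ) (hz : z ∈ phaseSpace c)
    (hv : v ∈ phaseSpace c) : symp (t • z) v = t * symp z v := by
  obtain ⟨b, l, rfl, h⟩ := exists_admissible hz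
  obtain ⟨b'', l'', rfl, h''⟩ := exists_admissible hv
  have h1 := (h.smul t).symp h''
  have h2 := (h.symp h'').smul t
  have e : t • (kd b b'' - kd b'' b) = kd (t • b) b'' - kd b'' (t • b) := by
    simp only [kd, Prod.smul_fst, Prod.smul_snd, Pi.smul_apply, smul_mul_assoc, mul_smul_comm,
      ← Finset.smul_sum, smul_sub, smul_add]
  rw [e] at h2
  have := h1.unique h2
  simp only [Prod.smul_fst, Prod.smul_snd, rad_smul, smul_mul_assoc, mul_smul_comm, map_sub,
    map_smul, smul_eq_mul] at this
  rw [← toConfig_smul]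
  linarith

theorem symp_add_right {c : AngularBC} {z w v : Config} (hz : z ∈ phaseSpace c)
    (hw : w ∈ phaseSpace c) (hv : v ∈ phaseSpace c) : symp v (z + w) = symp v z + symp v w := by
  rw [symp_comm, symp_add_left hz hw hv, symp_comm z, symp_comm w]; ring

theorem symp_smul_right {c : AngularBC} {z v : Config} (t : ℝ) (hz : z ∈ phaseSpace c)
    (hv : v ∈ phaseSpace c) : symp v (t • z) = t * symp v z := by
  rw [symp_comm, symp_smul_left t hz hv, symp_comm z]; ring

/-! ### Hamiltonian vector fields -/

/-- By symmetry, `F` is the quadratic form of the bilinear form `-½ Ω(X z, w)`, so along a line it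
is a polynomial of degree two whose linear coefficient is `-Ω(X z, w)`. -/
theorem IsHamiltonian.of_quadratic {c : AngularBC} {F : Config → ℝ} {X : Config → Config}
    (hX : ∀ z ∈ phaseSpace c, X z ∈ phaseSpace c)
    (hadd : ∀ z ∈ phaseSpace c, ∀ w ∈ phaseSpace c, ∀ t : ℝ, X (z + t • w) = X z + t • X w)
    (hsymm : ∀ z ∈ phaseSpace c, ∀ w ∈ phaseSpace c, symp (X z) w = symp (X w) z)
    (hF : ∀ z ∈ phaseSpace c, F z = -(1 / 2) * symp (X z) z) : IsHamiltonian c F X := by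
  refine ⟨hX, fun z hz w hw => ?_⟩
  have e : ∀ t : ℝ, F (z + t • w) = F z + (-symp (X z) w) * t + F w * t ^ 2 := fun t => by
    have htw := smul_mem_phaseSpace t hw
    have h1 := hX z hz
    have h2 := smul_mem_phaseSpace t (hX w hw)
    rw [hF _ (add_mem_phaseSpace hz htw), hF z hz, hF w hw, hadd z hz w hw,
      symp_add_left h1 h2 (add_mem_phaseSpace hz htw), symp_add_right hz htw h1,
      symp_add_right hz htw h2, symp_smul_right t hw h1, symp_smul_right t hw h2,
      symp_smul_left t (hX w hw) hz, symp_smul_left t (hX w hw) hw, hsymm w hw z hz]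
    ring
  rw [funext e]
  have h : HasDerivAt (fun t : ℝ => F z + (-symp (X z) w) * t + F w * t ^ 2) _ 0 :=
    (((hasDerivAt_id (0 : ℝ)).const_mul (-symp (X z) w)).const_add (F z)).add
      (((hasDerivAt_id (0 : ℝ)).pow 2).const_mul (F w))
  exact h.congr_deriv (by simp)

theorem IsHamiltonian.of_linear {c : AngularBC} {F : Config → ℝ} {X : Config}
    (hX : X ∈ phaseSpace c) (hF : ∀ z ∈ phaseSpace c, F z = -symp X z) :
    IsHamiltonian c F (fun _ => X) := by
  refine ⟨fun _ _ => hX, fun z hz w hw => ?_⟩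
  have e : ∀ t : ℝ, F (z + t • w) = F z + (-symp X w) * t := fun t => by
    rw [hF _ (add_mem_phaseSpace hz (smul_mem_phaseSpace t hw)), hF z hz,
      symp_add_right hz (smul_mem_phaseSpace t hw) hX, symp_smul_right t hw hX]
    ring
  rw [funext e]
  simpa using ((hasDerivAt_id (0 : ℝ)).const_mul (-symp X w)).const_add (F z)

theorem IsHamiltonian.add {c : AngularBC} {F G : Config → ℝ} {X Y : Config → Config}
    (hF : IsHamiltonian c F X) (hG : IsHamiltonian c G Y) :
    IsHamiltonian c (fun z => F z + G z) (fun z => X z + Y z) := by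
  refine ⟨fun z hz => add_mem_phaseSpace (hF.1 z hz) (hG.1 z hz), fun z hz w hw => ?_⟩
  have := (hF.2 z hz w hw).add (hG.2 z hz w hw)
  rwa [← neg_add, ← symp_add_left (hF.1 z hz) (hG.1 z hz) hw] at this

theorem IsHamiltonian.symp_eq {c : AngularBC} {F : Config → ℝ} {X Y : Config → Config}
    (hX : IsHamiltonian c F X) (hY : IsHamiltonian c F Y) {z w : Config} (hz : z ∈ phaseSpace c)
    (hw : w ∈ phaseSpace c) : symp (X z) w = symp (Y z) w :=
  neg_injective ((hX.2 z hz w hw).unique (hY.2 z hz w hw))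

/-- The bracket does not depend on the choice of Hamiltonian vector fields: two choices have the
same contraction with `Ω` on phase space directions, and the other argument is such a direction. One
pair of vector fields is therefore enough. -/
theorem PoissonEq.of_isHamiltonian {c : AngularBC} {F G H : Config → ℝ} {X Y : Config → Config}
    (hF : IsHamiltonian c F X) (hG : IsHamiltonian c G Y)
    (h : ∀ z ∈ phaseSpace c, symp (Y z) (X z) = H z) : PoissonEq c F G H := by
  refine ⟨⟨X, hF⟩, ⟨Y, hG⟩, fun X' Y' hX' hY' z hz => ?_⟩
  rw [← h z hz, hY'.symp_eq hG hz (hX'.1 z hz), symp_comm, hX'.symp_eq hF hz (hG.1 z hz),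
    symp_comm, neg_neg]

/-! ### Poincaré transformations -/

section Algebra

variable {R : Type*} [CommRing R] [Algebra ℝ R] {D : Fin 3 → Derivation ℝ R R}

theorem Killing.act_add (k : Killing D) (z w : Quad R) : k.act (z + w) = k.act z + k.act w := by
  refine Prod.ext (funext fun i => ?_) (Prod.ext (funext fun i => ?_) (Prod.ext ?_ ?_)) <;>
  · simp only [Killing.act, fs, Fin.sum_univ_three, Prod.fst_add, Prod.snd_add, Pi.add_apply,
      Derivation.leibniz, smul_eq_mul, map_add, map_sub]
    ring

theorem Killing.act_smul (k : Killing D) (t : ℝ) (z : Quad R) : k.act (t • z) = t • k.act z := by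
  refine Prod.ext (funext fun i => ?_) (Prod.ext (funext fun i => ?_) (Prod.ext ?_ ?_)) <;>
  · simp only [Killing.act, fs, Fin.sum_univ_three, Prod.smul_fst, Prod.smul_snd, Pi.smul_apply,
      Derivation.leibniz, smul_eq_mul, Derivation.map_smul, map_sub]
    simp only [Algebra.smul_def]
    ring

/-- The Killing field with normal component `β_i x^i + T` and tangential components
`w_{ij} x^i + a_j`. -/
def mkKilling (D : Fin 3 → Derivation ℝ R R) (X : Fin 3 → R)
    (hX : ∀ i j, D i (X j) = if i = j then 1 else 0) (β : Fin 3 → ℝ) (T : ℝ)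
    (w : Fin 3 → Fin 3 → ℝ) (a : Fin 3 → ℝ) (hsk : ∀ i j, w i j = -w j i) : Killing D where
  xi := ∑ i, X i * algebraMap ℝ R (β i) + algebraMap ℝ R T
  Y j := ∑ i, X i * algebraMap ℝ R (w i j) + algebraMap ℝ R (a j)
  beta i := algebraMap ℝ R (β i)
  om i j := algebraMap ℝ R (w i j)
  d_xi i := by simp [hX]
  d_Y i j := by simp [hX]
  d_beta i j := by simp
  d_om i j k := by simp
  om_skew i j := by rw [hsk, map_neg]
  om_diag i := by rw [show w i i = 0 by linarith [hsk i i], map_zero]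

end Algebra

theorem poincare_skew (p : poincareAlgebra) (i j : Fin 3) :
    p.1 (sp i) (sp j) = -p.1 (sp j) (sp i) := by
  have := p.2.2 (sp i) (sp j) (by simp) (by simp)
  simp only [eta] at this
  linarith

theorem poincare_time_space (p : poincareAlgebra) (j : Fin 3) : p.1 tm (sp j) = p.1 (sp j) tm := by
  have := p.2.2 tm (sp j) (by simp) (by simp)
  simp only [eta] at this
  linarith

theorem poincare_time_time (p : poincareAlgebra) : p.1 tm tm = 0 := by
  have := p.2.2 tm tm (by simp) (by simp)
  simp only [eta] at this
  linarith

theorem poincare_affine (p : poincareAlgebra) (i : PIdx) : p.1 i af = 0 := p.2.1 i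

/-- The Killing field on space of a Poincaré transformation. -/
def killing (p : poincareAlgebra) : Killing BD :=
  mkKilling BD BX BD_BX (fun i => p.1 (sp i) tm) (p.1 af tm) (fun i j => p.1 (sp i) (sp j))
    (fun j => p.1 af (sp j)) (poincare_skew p)

/-- The Lorentz part of the Killing field of a Poincaré transformation. -/
def lorentz (p : poincareAlgebra) : Killing FD :=
  mkKilling FD FX FD_FX (fun i => p.1 (sp i) tm) 0 (fun i j => p.1 (sp i) (sp j)) 0 (poincare_skew p)

theorem lorentz_mk (β : Fin 3 → ℝ) (w : Fin 3 → Fin 3 → ℝ) (hsk : ∀ i j, w i j = -w j i) :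
    Lorentz (mkKilling FD FX FD_FX β 0 w 0 hsk) where
  xi_eq := by simp [mkKilling]
  Y_eq j := by simp [mkKilling]
  beta_homog _ := Homog.const _
  om_homog _ _ := Homog.const _
  refl_beta _ := AlgHom.commutes refl _
  refl_om _ _ := AlgHom.commutes refl _

theorem lorentz_lorentz (p : poincareAlgebra) : Lorentz (lorentz p) := lorentz_mk _ _ _

theorem lapse_eq (p : poincareAlgebra) : lapse p = (killing p).xi.1 := funext fun x => by
  simp only [lapse, killing, mkKilling, Bulk.add_apply, Bulk.sum_apply, Bulk.mul_apply, BX_apply,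
    Bulk.algebraMap_apply]
  congr 1
  exact Finset.sum_congr rfl fun i _ => mul_comm _ _

theorem shift_apply (p : poincareAlgebra) (j : Fin 3) (x : E3) :
    shift p x j = ((killing p).Y j).1 x := by
  simp only [shift, killing, mkKilling, Bulk.add_apply, Bulk.sum_apply, Bulk.mul_apply, BX_apply,
    Bulk.algebraMap_apply]
  congr 1
  exact Finset.sum_congr rfl fun i _ => mul_comm _ _

/-- A Killing field with given leading term. -/
structure KillingLead (k : Killing BD) (k' : Killing FD) : Prop where
  lorentz : Lorentz k'
  xi : Lead1 (-1) (restr k.xi) k'.xi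
  Y : ∀ i, Lead1 (-1) (restr (k.Y i)) (k'.Y i)

theorem killingLead_mk (β : Fin 3 → ℝ) (T : ℝ) (w : Fin 3 → Fin 3 → ℝ) (a : Fin 3 → ℝ)
    (hsk : ∀ i j, w i j = -w j i) :
    KillingLead (mkKilling BD BX BD_BX β T w a hsk) (mkKilling FD FX FD_FX β 0 w 0 hsk) where
  lorentz := lorentz_mk _ _ _
  xi := by
    have h : Homog (-(-1)) (mkKilling FD FX FD_FX β 0 w 0 hsk).xi := (lorentz_mk _ _ _).homog_xi
    have h0 : Homog (-0) (algebraMap ℝ Far T) := Homog.const _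
    -- The translation has degree `0`, one order below the boost, and does not enter the leading
    -- term.
    have h1 := h.lead1.add (h0.lead1.shift (k := -1))
    rw [add_zero] at h1
    convert h1 using 1
    simp [mkKilling, FX]
  Y i := by
    have h : Homog (-(-1)) ((mkKilling FD FX FD_FX β 0 w 0 hsk).Y i) := (lorentz_mk _ _ _).homog_Y i
    have h0 : Homog (-0) (algebraMap ℝ Far (a i)) := Homog.const _
    have h1 := h.lead1.add (h0.lead1.shift (k := -1))
    rw [add_zero] at h1
    convert h1 using 1
    simp [mkKilling, FX]

theorem killingLead (p : poincareAlgebra) : KillingLead (killing p) (lorentz p) :=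
  killingLead_mk _ _ _ _ _

theorem HasLead.fs {b : Quad Bulk} {l : Quad Far} (h : HasLead b l) (i j : Fin 3) :
    Lead1 2 (restr (fs BD b.1 i j)) (fs FD l.1 i j) := by
  have := ((h.A j).deriv i (m := 2)).sub ((h.A i).deriv j)
  simpa only [EMInfinity.fs, map_sub, ← FD_restr] using this

theorem HasLead.div {b : Quad Bulk} {l : Quad Far} (h : HasLead b l) :
    Lead1 3 (restr (∑ i, BD i (b.2.1 i))) (∑ i, FD i (l.2.1 i)) := by
  have := Lead1.sum Finset.univ fun i _ => (h.P i).deriv i (m := 3)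
  simpa only [map_sum, ← FD_restr] using this

theorem HasLead.act {k : Killing BD} {k' : Killing FD} (hk : KillingLead k k') {b : Quad Bulk}
    {l : Quad Far} (h : HasLead b l) (hdiv : ∑ i, FD i (l.2.1 i) = 0) :
    HasLead (k.act b) (k'.act l) where
  A i := by
    have := ((hk.xi.mul (h.P i) (m := 1)).add ((hk.xi.mul h.Ψ (m := 0)).deriv i)).add
      (Lead1.sum Finset.univ fun j _ => ((hk.Y j).mul ((h.A i).deriv j (m := 2)) (m := 1)).add
        ((h.A j).mul ((hk.Y j).deriv i (m := 0))))
    simpa only [Killing.act, map_add, map_sum, map_mul, ← FD_restr] using this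
  P i := by
    obtain ⟨Q, hQ⟩ := h.Q
    have h1 := (hk.xi.lead0.mul (hQ.deriv i (m := 4)) (m := 3)).shift (k := 2)
    have := ((Lead1.sum Finset.univ fun m _ => (hk.xi.mul (h.fs m i) (m := 1)).deriv m
      (m := 2)).add h1).add (Lead1.sum Finset.univ fun m _ =>
        (((hk.Y m).mul (h.P i) (m := 1)).deriv m (m := 2)).sub
          (((hk.Y i).deriv m (m := 0)).mul (h.P m)))
    simpa only [Killing.act, map_add, map_sum, map_mul, map_sub, ← FD_restr, h.zero, map_zero,
      mul_zero] using this
  Ψ := by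
    have := (Lead1.sum Finset.univ fun i _ => (hk.xi.mul (h.A i) (m := 0)).deriv i (m := 1)).add
      (Lead1.sum Finset.univ fun i _ => (hk.Y i).mul (h.Ψ.deriv i (m := 2)))
    simpa only [Killing.act, map_add, map_sum, map_mul, ← FD_restr] using this
  Q := by
    obtain ⟨Q, hQ⟩ := h.Q
    have h1 := h.div
    rw [hdiv] at h1
    -- In general `ξ ∂ᵢ πⁱ` would be of order `r⁻²`. The asymptotic Gauss law makes the divergence
    -- of order `r⁻⁴`, as the required fall-off of `π_Ψ` demands.
    obtain ⟨F, hF⟩ := h1.of_zero (m := 4)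
    have := (hk.xi.lead0.mul hF (m := 3)).add
      (Lead0.sum Finset.univ fun i _ => (hQ.mul (hk.Y i).lead0 (m := 2)).deriv i (m := 3))
    exact ⟨_, by simpa only [Killing.act, map_add, map_sum, map_mul, ← FD_restr] using this⟩
  zero := by simp [Killing.act, hdiv, h.zero]

theorem Admissible.act {c : AngularBC} {k : Killing BD} {k' : Killing FD} (hk : KillingLead k k')
    {b : Quad Bulk} {l : Quad Far} (h : Admissible c b l) : Admissible c (k.act b) (k'.act l) :=
  ⟨h.lead.act hk h.cond.div, h.cond.act (sgn_mul_self c) hk.lorentz h.lead.homA h.lead.homΨ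
    h.lead.zero⟩

theorem HasLead.flux {k : Killing BD} {k' : Killing FD} (hk : KillingLead k k') {b b' : Quad Bulk}
    {l l' : Quad Far} (h : HasLead b l) (h' : HasLead b' l') (m : Fin 3) :
    Lead0 2 (restr (k.flux b b' m)) (k'.flux l l' m) := by
  obtain ⟨Q, hQ⟩ := h.Q
  obtain ⟨Q', hQ'⟩ := h'.Q
  have e1 := ((hk.xi.mul h.Ψ (m := 0)).mul (h'.P m) (m := 2)).lead0
  have e2 := ((hk.xi.mul (h.A m) (m := 0)).lead0.mul hQ' (m := 3)).shift_zero (k := 2)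
  have e3 := (hk.xi.mul (Lead1.sum Finset.univ fun i _ => (h.fs m i).mul (h'.A i) (m := 3))
    (m := 2)).lead0
  have e4 := ((Lead1.sum Finset.univ fun j _ => (hk.Y j).mul (h.A j) (m := 0)).mul (h'.P m)
    (m := 2)).lead0
  have e5 := ((hk.Y m).mul (Lead1.sum Finset.univ fun i _ => (h.P i).mul (h'.A i) (m := 3))
    (m := 2)).lead0
  have e6 := ((Lead1.sum Finset.univ fun j _ => (hk.Y j).mul (h'.A j) (m := 0)).mul (h.P m)
    (m := 2)).lead0
  have e7 := (((hk.Y m).lead0.mul hQ (m := 2)).mul h'.Ψ.lead0 (m := 3)).shift_zero (k := 2)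
  have := (((((e1.neg.sub e2).add e3).sub e4).add e5).sub e6).add e7
  simpa only [Killing.flux, map_add, map_sub, map_neg, map_sum, map_mul, h.zero, h'.zero, mul_zero,
    zero_mul] using this

/-- The bulk identity and the cancellation at infinity combined. The sphere integral that is left
over is the one supplied by the surface term of the generator. -/
theorem Admissible.polar {c : AngularBC} {k : Killing BD} {k' : Killing FD}
    (hk : KillingLead k k') {b b' : Quad Bulk} {l l' : Quad Far} (h : Admissible c b l)
    (h' : Admissible c b' l') : BulkTendsto (k.polar b b')
      (-EMInfinity.symp (toConfig (k.act b)) (toConfig b') - sInt (k'.surf l l')) := by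
  have h1 := (bulkTendsto_div (h.lead.flux hk h'.lead)).sub ((h.act hk).symp h')
  rw [← k.polar_eq BD_comm, add_sub_cancel_right] at h1
  have h2 := hk.lorentz.sInt_surface h.cond h'.cond h.lead.homA h'.lead.homA h.lead.homΨ
    h.lead.zero h'.lead.zero
  convert h1 using 1
  simp only [rad] at h2 ⊢
  linarith

/-- Both the polarized density and the polarized surface term are symmetric, hence so is what
remains in `Admissible.polar`. -/
theorem Admissible.symp_act_comm {c : AngularBC} {k : Killing BD} {k' : Killing FD}
    (hk : KillingLead k k') {b b' : Quad Bulk} {l l' : Quad Far} (h : Admissible c b l)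
    (h' : Admissible c b' l') :
    EMInfinity.symp (toConfig (k.act b)) (toConfig b') =
      EMInfinity.symp (toConfig (k.act b')) (toConfig b) := by
  have h1 := h.polar hk h'
  have h2 := h'.polar hk h
  rw [k.polar_comm] at h1
  have := h1.unique h2
  rw [k'.surf_comm] at this
  linarith

theorem poincareVF_toConfig (p : poincareAlgebra) (b : Quad Bulk) :
    poincareVF p (toConfig b) = toConfig ((killing p).act b) := by
  refine Prod.ext (funext fun x => ?_) (Prod.ext (funext fun x => ?_)
    (Prod.ext (funext fun x => ?_) (funext fun x => ?_)))
  · ext i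
    simp only [poincareVF, toConfig, Killing.act, lapse_eq, shift_apply, Bulk.add_apply,
      Bulk.sum_apply, Bulk.mul_apply, BD_apply]
    rfl
  · ext i
    simp only [poincareVF, toConfig, Killing.act, lapse_eq, shift_apply, Bulk.add_apply,
      Bulk.sum_apply, Bulk.mul_apply, Bulk.sub_apply, BD_apply]
    rfl
  · simp only [poincareVF, toConfig, Killing.act, lapse_eq, shift_apply, Bulk.add_apply,
      Bulk.sum_apply, Bulk.mul_apply, BD_apply, dvg]
    rfl
  · simp only [poincareVF, toConfig, Killing.act, lapse_eq, Bulk.add_apply,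
      Bulk.sum_apply, Bulk.mul_apply, BD_apply, dvg, PiLp.smul_apply, shift_apply]
    rfl

theorem poincareDensity_toConfig (p : poincareAlgebra) (b : Quad Bulk) :
    poincareDensity p (toConfig b) = ((1 / 2 : ℝ) • (killing p).polar b b).1 := funext fun x => by
  have e : ∀ i j, fstr (vecA (toConfig b)) i j x = (BD i (b.1 j)).1 x - (BD j (b.1 i)).1 x :=
    fun i j => rfl
  have e1 : dvg (momA (toConfig b)) x = ∑ i, (BD i (b.2.1 i)).1 x := rfl
  have e2 : ∀ i, pd i (momPsi (toConfig b)) x = (BD i b.2.2.2).1 x := fun _ => rfl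
  have e3 : ∀ i, pd i (psi (toConfig b)) x = (BD i b.2.2.1).1 x := fun _ => rfl
  simp only [poincareDensity, hamDensity, momDensity, Killing.polar, fs, lapse_eq, shift_apply,
    Fin.sum_univ_three, Bulk.add_apply, Bulk.mul_apply, Bulk.sub_apply, Bulk.neg_apply,
    Bulk.smul_apply, e, e1, e2, e3]
  simp only [toConfig, vecA, momA, psi, momPsi]
  ring

theorem bfun_eq (p : poincareAlgebra) : bfun p = sph (lorentz p).xi := funext fun n => by
  simp only [bfun, (lorentz_lorentz p).xi_eq, sph_sum, sph_mul, sph_FX]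
  exact Finset.sum_congr rfl fun i _ => mul_comm _ _

theorem yvec_apply (p : poincareAlgebra) (n : S2) (j : Fin 3) :
    yvec p n j = sph ((lorentz p).Y j) n := by
  simp only [yvec, (lorentz_lorentz p).Y_eq, sph_sum, sph_mul, sph_FX]
  exact Finset.sum_congr rfl fun i _ => mul_comm _ _

theorem inner_yvec_sgrad (p : poincareAlgebra) {F : Far} (hF : Homog 0 F) (n : S2) :
    inner ℝ (yvec p n) (sgrad (sph F) n) = sph ((lorentz p).along F) n := by
  simp only [PiLp.inner_apply, RCLike.inner_apply, conj_trivial, yvec_apply, sgrad_sph hF,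
    Killing.along, sph_sum, sph_mul]
  exact Finset.sum_congr rfl fun i _ => mul_comm _ _

theorem HasLead.poincareSurface {b : Quad Bulk} {l : Quad Far} (h : HasLead b l)
    (p : poincareAlgebra) :
    poincareSurface p (toConfig b) = sph ((1 / 2 : ℝ) • (lorentz p).surf l l) := funext fun n => by
  have ha : Homog 0 (rad l.1) := Homog.rad h.homA
  have e1 : ∑ i, FX i * FD i (rad l.1) = 0 := rad_grad ha
  have e2 : ∑ i, FX i * (lorentz p).Y i = 0 := (lorentz_lorentz p).rad_Y
  have h1 := congrArg (fun F => sph F n) e1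
  have h2 := congrArg (fun F => sph F n) e2
  simp only [EMInfinity.poincareSurface, h.barAr, h.barPr, h.barPsi, h.barAang,
    inner_yvec_sgrad p ha, bfun_eq, Killing.surf]
  simp only [PiLp.inner_apply, RCLike.inner_apply, conj_trivial, yvec_apply, sgrad_sph ha,
    sph_add, sph_mul, sph_smul, tan, sph_sub, sph_pow, sph_Fr, Fin.sum_univ_three,
    sph_FX, sph_zero] at h1 h2 ⊢
  linear_combination (-sph (lorentz p).xi n * sph (rad l.1) n) * h1
    - sph (rad l.1) n * sph (rad l.2.1) n * h2

theorem Admissible.poincareDensity {c : AngularBC} {b : Quad Bulk} {l : Quad Far}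
    (h : Admissible c b l) (p : poincareAlgebra) :
    BulkTendsto ((1 / 2 : ℝ) • (killing p).polar b b)
      (1 / 2 * (-EMInfinity.symp (toConfig ((killing p).act b)) (toConfig b)
        - sInt ((lorentz p).surf l l))) :=
  (h.polar (killingLead p) h).smul _

theorem poincare_finite {c : AngularBC} (p : poincareAlgebra) {z : Config}
    (hz : z ∈ phaseSpace c) :
    BulkConverges (poincareDensity p z) ∧ SphereIntegrable (poincareSurface p z) := by
  obtain ⟨b, l, rfl, h⟩ := exists_admissible hz
  rw [poincareDensity_toConfig, h.lead.poincareSurface]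
  exact ⟨(h.poincareDensity p).converges, sphereIntegrable_sph _⟩

/-- The surface term of the generator is half of `surf` on the diagonal and removes exactly the
boundary contribution of the bulk integral. -/
theorem poincareGen_eq {c : AngularBC} (p : poincareAlgebra) {z : Config} (hz : z ∈ phaseSpace c) :
    poincareGen p z = -(1 / 2) * symp (poincareVF p z) z := by
  obtain ⟨b, l, rfl, h⟩ := exists_admissible hz
  rw [poincareGen, poincareDensity_toConfig, h.lead.poincareSurface, ← sInt_apply,
    (h.poincareDensity p).bulkInt_eq, poincareVF_toConfig, map_smul, smul_eq_mul]
  ring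

theorem poincareVF_mem {c : AngularBC} (p : poincareAlgebra) {z : Config} (hz : z ∈ phaseSpace c) :
    poincareVF p z ∈ phaseSpace c := by
  obtain ⟨b, l, rfl, h⟩ := exists_admissible hz
  rw [poincareVF_toConfig]
  exact (h.act (killingLead p)).mem

theorem symp_poincareVF_comm {c : AngularBC} (p : poincareAlgebra) {z w : Config}
    (hz : z ∈ phaseSpace c) (hw : w ∈ phaseSpace c) :
    symp (poincareVF p z) w = symp (poincareVF p w) z := by
  obtain ⟨b, l, rfl, h⟩ := exists_admissible hz
  obtain ⟨b', l', rfl, h'⟩ := exists_admissible hw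
  rw [poincareVF_toConfig, poincareVF_toConfig]
  exact h.symp_act_comm (killingLead p) h'

theorem poincareVF_add_smul {c : AngularBC} (p : poincareAlgebra) {z w : Config}
    (hz : z ∈ phaseSpace c) (hw : w ∈ phaseSpace c) (t : ℝ) :
    poincareVF p (z + t • w) = poincareVF p z + t • poincareVF p w := by
  obtain ⟨b, l, rfl, h⟩ := exists_admissible hz
  obtain ⟨b', l', rfl, h'⟩ := exists_admissible hw
  rw [← toConfig_smul, ← toConfig_add, poincareVF_toConfig, poincareVF_toConfig,
    poincareVF_toConfig, Killing.act_add, Killing.act_smul, toConfig_add, toConfig_smul]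

theorem isHamiltonian_poincareGen (c : AngularBC) (p : poincareAlgebra) :
    IsHamiltonian c (poincareGen p) (poincareVF p) :=
  .of_quadratic (fun _ hz => poincareVF_mem p hz) (fun _ hz _ hw t => poincareVF_add_smul p hz hw t)
    (fun _ hz _ hw => symp_poincareVF_comm p hz hw) (fun _ hz => poincareGen_eq p hz)

/-- The Poincaré transformations are the usual ones up to a gauge transformation. -/
theorem poincareVF_usual {c : AngularBC} (p : poincareAlgebra) {z : Config}
    (hz : z ∈ phaseSpace c) :
    HasExpansion 0 1 (fun x => lapse p x * psi z x + inner ℝ (shift p x) (vecA z x)) ∧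
    (∀ x i, vecA (poincareVF p z) x i =
      lapse p x * momA z x i + ∑ j, shift p x j * fstr (vecA z) j i x
        + pd i (fun y => lapse p y * psi z y + inner ℝ (shift p y) (vecA z y)) x) ∧
    (OnShell z → ∀ x i, momA (poincareVF p z) x i =
      ∑ m, pd m (fun y => fstr (vecA z) m i y * lapse p y) x
        + ∑ m, pd m (fun y => shift p y m * momA z y i) x
        - ∑ m, pd m (fun y => shift p y i) x * momA z x m
        - shift p x i * dvg (momA z) x) := by
  obtain ⟨b, l, rfl, h⟩ := exists_admissible hz
  set k := killing p with hk
  set ζ : Bulk := k.xi * b.2.2.1 + ∑ j, k.Y j * b.1 j with hζ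
  have e : (fun x => lapse p x * psi (toConfig b) x + inner ℝ (shift p x) (vecA (toConfig b) x))
      = ζ.1 := funext fun x => by
    simp only [hζ, Bulk.add_apply, Bulk.mul_apply, Bulk.sum_apply, lapse_eq, PiLp.inner_apply,
      RCLike.inner_apply, conj_trivial, shift_apply]
    exact congrArg _ (Finset.sum_congr rfl fun i _ => mul_comm _ _)
  rw [e]
  refine ⟨hasExpansion_one_iff.2 ?_, fun x i => ?_, fun hon x i => ?_⟩
  · have hl := killingLead p
    have := (hl.xi.mul h.lead.Ψ (m := 0)).add
      (Lead1.sum Finset.univ fun j _ => (hl.Y j).mul (h.lead.A j) (m := 0))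
    have e0 : ∃ F0, Lead1 0 (restr ζ) F0 :=
      ⟨_, by simpa only [hζ, map_add, map_sum, map_mul] using this⟩
    exact e0
  · have h1 : (k.act b).1 i = k.xi * b.2.1 i + ∑ j, k.Y j * fs BD b.1 j i + BD i ζ := by
      simp only [Killing.act, hζ, fs, map_add, Fin.sum_univ_three, Derivation.leibniz, smul_eq_mul]
      ring
    rw [poincareVF_toConfig, lapse_eq]
    simp only [shift_apply]
    have h2 := congrArg (fun f => f.1 x) h1
    simp only [Bulk.add_apply, Bulk.mul_apply, Bulk.sum_apply] at h2
    exact h2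
  · have h3 : b.2.2.2 = 0 := Bulk.ext_apply hon.1
    rw [poincareVF_toConfig, hon.2 x, mul_zero, sub_zero]
    simp only [lapse_eq, shift_apply]
    have h1 : (k.act b).2.1 i = ∑ m, BD m (fs BD b.1 m i * k.xi)
        + ∑ m, BD m (k.Y m * b.2.1 i) - ∑ m, BD m (k.Y i) * b.2.1 m := by
      simp only [Killing.act, h3, map_zero, Finset.sum_sub_distrib,
        mul_comm k.xi]
      ring
    have h2 := congrArg (fun f => f.1 x) h1
    simp only [Bulk.add_apply, Bulk.sub_apply, Bulk.mul_apply, Bulk.sum_apply] at h2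
    exact h2

/-! ### Gauge transformations -/

/-- Gauge parameters with given leading terms. -/
structure GaugeLead (m e : Bulk) (m0 e0 : Far) : Prop where
  mu : Lead1 1 (restr m) m0
  eps : Lead1 0 (restr e) e0

theorem exists_gaugeLead {μ ε : E3 → ℝ} (h : IsGaugeParam μ ε) :
    ∃ m e m0 e0, μ = m.1 ∧ ε = e.1 ∧ GaugeLead m e m0 e0 := by
  obtain ⟨m0, hm⟩ := hasExpansion_one_iff (f := Bulk.of μ h.1.1) |>.1 h.1
  obtain ⟨e0, he⟩ := hasExpansion_one_iff (f := Bulk.of ε h.2.1) |>.1 h.2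
  exact ⟨_, _, m0, e0, rfl, rfl, hm, he⟩

theorem GaugeLead.isGaugeParam {m e : Bulk} {m0 e0 : Far} (h : GaugeLead m e m0 e0) :
    IsGaugeParam m.1 e.1 :=
  ⟨hasExpansion_one_iff.2 ⟨_, h.mu⟩, hasExpansion_one_iff.2 ⟨_, h.eps⟩⟩

theorem GaugeLead.lead_mu {m e : Bulk} {m0 e0 : Far} (h : GaugeLead m e m0 e0) :
    lead 1 m.1 = sph m0 := Lead0.lead_eq h.mu.lead0

theorem GaugeLead.lead_eps {m e : Bulk} {m0 e0 : Far} (h : GaugeLead m e m0 e0) :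
    lead 0 e.1 = sph e0 := Lead0.lead_eq h.eps.lead0

theorem GaugeLead.neg {m e : Bulk} {m0 e0 : Far} (h : GaugeLead m e m0 e0) :
    GaugeLead (-m) (-e) (-m0) (-e0) :=
  ⟨by simpa only [map_neg] using h.mu.neg, by simpa only [map_neg] using h.eps.neg⟩

theorem GaugeLead.sub {m e m' e' : Bulk} {m0 e0 m0' e0' : Far} (h : GaugeLead m e m0 e0)
    (h' : GaugeLead m' e' m0' e0') : GaugeLead (m - m') (e - e') (m0 - m0') (e0 - e0') :=
  ⟨by simpa only [map_sub] using h.mu.sub h'.mu, by simpa only [map_sub] using h.eps.sub h'.eps⟩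

theorem GaugeLead.homog_mu {m e : Bulk} {m0 e0 : Far} (h : GaugeLead m e m0 e0) : Homog (-1) m0 :=
  h.mu.homog

theorem GaugeLead.homog_eps {m e : Bulk} {m0 e0 : Far} (h : GaugeLead m e m0 e0) : Homog 0 e0 := by
  simpa using h.eps.homog

theorem GaugeLead.gauge {k : Killing BD} {k' : Killing FD} (hk : KillingLead k k') {m e : Bulk}
    {m0 e0 : Far} (h : GaugeLead m e m0 e0) :
    GaugeLead (k.gauge (m, e)).1 (k.gauge (m, e)).2 (k'.gauge (m0, e0)).1 (k'.gauge (m0, e0)).2 where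
  mu := by
    have := (Lead1.sum Finset.univ fun i _ => (hk.xi.mul (h.eps.deriv i (m := 1))
      (m := 0)).deriv i (m := 1)).add
      (Lead1.sum Finset.univ fun i _ => (hk.Y i).mul (h.mu.deriv i (m := 2)))
    simpa only [Killing.gauge, map_add, map_sum, map_mul, ← FD_restr] using this
  eps := by
    have := (hk.xi.mul h.mu (m := 0)).add
      (Lead1.sum Finset.univ fun i _ => (hk.Y i).mul (h.eps.deriv i (m := 1)))
    simpa only [Killing.gauge, map_add, map_sum, map_mul, ← FD_restr] using this

theorem gaugeVF_eq (m e : Bulk) (z : Config) :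
    gaugeVF m.1 e.1 z = toConfig (gaugeQuad BD m e) := rfl

theorem GaugeLead.admissible {m e : Bulk} {m0 e0 : Far} (h : GaugeLead m e m0 e0) (c : AngularBC) :
    Admissible c (gaugeQuad BD m e) (gaugeQuad FD m0 e0) where
  lead :=
    { A := fun i => by simpa only [gaugeQuad, ← FD_restr] using h.eps.deriv i (m := 1)
      P := fun i => by simpa [gaugeQuad] using Lead1.zero 2
      Ψ := h.mu
      Q := ⟨0, by simpa [gaugeQuad] using Lead0.zero 3⟩
      zero := rfl }
  cond := by
    have h0 := h.homog_eps
    have hz : rad (0 : Fin 3 → Far) = 0 := by simp [rad]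
    have hg : rad (gaugeQuad FD m0 e0).1 = 0 := rad_grad h0
    have ht : ∀ i, tan (gaugeQuad FD m0 e0).1 i = FD i e0 := tan_grad h0
    -- The gradient of `e0` reflects to minus the gradient of its reflection, and this witness
    -- absorbs the difference. Hence every `ε̄`, of whatever parity, preserves the boundary
    -- conditions.
    refine ⟨by rw [hg]; simp, by simp [gaugeQuad, hz], ⟨-refl e0 - sgn c • e0,
      h0.refl.neg.sub (h0.smul _), ?_, fun i => ?_⟩, fun i => ?_, by simp [gaugeQuad]⟩
    · simp only [map_sub, map_neg, map_smul, refl_refl, smul_sub, smul_neg, smul_smul,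
        sgn_mul_self, one_smul]
      ring
    · rw [ht, map_sub, map_neg, Derivation.map_smul, FD_refl]; ring
    · simp [gaugeQuad, tan, hz]

theorem gaugeDensity_toConfig (m e : Bulk) (b : Quad Bulk) :
    gaugeDensity m.1 e.1 (toConfig b) = (m * b.2.2.2 - e * ∑ i, BD i (b.2.1 i)).1 := funext fun x => by
  have e1 : dvg (momA (toConfig b)) x = ∑ i, (BD i (b.2.1 i)).1 x := rfl
  simp only [gaugeDensity, e1, Bulk.sub_apply, Bulk.mul_apply, Bulk.sum_apply]
  simp only [toConfig, momPsi]
  ring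

theorem HasLead.chargeDensity {b : Quad Bulk} {l : Quad Far} (h : HasLead b l) (m0 e0 : Far) :
    chargeDensity (sph m0) (sph e0) (toConfig b) = sph (e0 * rad l.2.1 - m0 * rad l.1) :=
  funext fun n => by
    simp [EMInfinity.chargeDensity, h.barPr, h.barAr]

/-- Integration by parts turns `-ε ∂ᵢ πⁱ` into the symplectic pairing with the gradient of `ε` minus
a flux. The flux accounts for the `ε̄` part of the charge, and the surface term of `Ω` for the `μ̄`
part, since a gradient has no leading radial component. -/
theorem GaugeLead.density {c : AngularBC} {m e : Bulk} {m0 e0 : Far} (h : GaugeLead m e m0 e0)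
    {b : Quad Bulk} {l : Quad Far} (hb : Admissible c b l) :
    BulkTendsto (m * b.2.2.2 - e * ∑ i, BD i (b.2.1 i))
      (-symp (toConfig (gaugeQuad BD m e)) (toConfig b) - sInt (e0 * rad l.2.1 - m0 * rad l.1)) := by
  have h1 := (h.admissible c).symp hb
  have h2 := bulkTendsto_div (V := fun i => e * b.2.1 i) (V0 := fun i => e0 * l.2.1 i) fun i => by
    simpa only [map_mul] using (h.eps.mul (hb.lead.P i) (m := 2)).lead0
  have h3 := (h1.add h2).neg
  have hg : rad (gaugeQuad FD m0 e0).1 = 0 := rad_grad h.homog_eps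
  have e1 : ∑ i, FX i * (e0 * l.2.1 i) = e0 * rad l.2.1 := rad_mul e0 l.2.1
  rw [hg, e1] at h3
  convert h3 using 1
  · simp only [EMInfinity.kd, gaugeQuad, Fin.sum_univ_three, Derivation.leibniz, smul_eq_mul,
      Pi.zero_apply]
    ring
  · simp only [gaugeQuad, zero_mul, zero_sub, map_neg, map_sub]
    rw [mul_comm (rad l.1)]
    ring

section

variable {c : AngularBC} {m e : Bulk} {m0 e0 : Far} (h : GaugeLead m e m0 e0)

theorem GaugeLead.finite (h : GaugeLead m e m0 e0) {z : Config} (hz : z ∈ phaseSpace c) :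
    BulkConverges (gaugeDensity m.1 e.1 z) ∧
      SphereIntegrable (chargeDensity (lead 1 m.1) (lead 0 e.1) z) := by
  obtain ⟨b, l, rfl, hb⟩ := exists_admissible hz
  rw [gaugeDensity_toConfig, h.lead_mu, h.lead_eps, hb.lead.chargeDensity]
  exact ⟨(h.density hb).converges, sphereIntegrable_sph _⟩

theorem GaugeLead.gaugeGen_eq (h : GaugeLead m e m0 e0) {z : Config} (hz : z ∈ phaseSpace c) :
    gaugeGen m.1 e.1 z = -symp (toConfig (gaugeQuad BD m e)) z := by
  obtain ⟨b, l, rfl, hb⟩ := exists_admissible hz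
  rw [gaugeGen, gaugeDensity_toConfig, h.lead_mu, h.lead_eps, charge, hb.lead.chargeDensity,
    (h.density hb).bulkInt_eq, ← sInt_apply]
  ring

theorem GaugeLead.isHamiltonian (h : GaugeLead m e m0 e0) (c : AngularBC) :
    IsHamiltonian c (gaugeGen m.1 e.1) (gaugeVF m.1 e.1) :=
  .of_linear (h.admissible c).mem fun _ hz => h.gaugeGen_eq hz

theorem gaugeGen_of_onShell (μ ε : E3 → ℝ) {z : Config} (hz : OnShell z) :
    gaugeGen μ ε z = charge (lead 1 μ) (lead 0 ε) z := by
  have e : gaugeDensity μ ε z = (0 : Bulk).1 := funext fun x => by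
    simp [gaugeDensity, hz.1 x, hz.2 x]
  rw [gaugeGen, e, BulkTendsto.zero.bulkInt_eq, zero_add]

/-- Pure gauge directions have neither momenta nor a leading radial potential, so bulk and surface
parts of `Ω` both vanish and no central term arises. -/
theorem GaugeLead.symp_gauge (h : GaugeLead m e m0 e0) {m' e' : Bulk} {m0' e0' : Far}
    (h' : GaugeLead m' e' m0' e0') :
    symp (toConfig (gaugeQuad BD m e)) (toConfig (gaugeQuad BD m' e')) = 0 := by
  -- The symplectic form does not refer to the boundary conditions, and gauge directions are
  -- admissible for both, so either one may be used.
  have h1 := (h.admissible .twisted).symp (h'.admissible .twisted)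
  have hg : rad (gaugeQuad FD m0 e0).1 = 0 := rad_grad h.homog_eps
  have hg' : rad (gaugeQuad FD m0' e0').1 = 0 := rad_grad h'.homog_eps
  have e1 : kd (gaugeQuad BD m e) (gaugeQuad BD m' e') -
      kd (gaugeQuad BD m' e') (gaugeQuad BD m e) = 0 := by simp [kd, gaugeQuad]
  rw [hg, hg', e1] at h1
  simpa using h1.unique BulkTendsto.zero

theorem toConfig_neg (b : Quad Bulk) : toConfig (-b) = -toConfig b := by
  rw [← neg_one_smul ℝ b, toConfig_smul, neg_one_smul]

theorem gaugeQuad_neg (m e : Bulk) : gaugeQuad BD (-m) (-e) = -gaugeQuad BD m e :=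
  Prod.ext (funext fun i => map_neg (BD i) e) (Prod.ext neg_zero.symm (Prod.ext rfl neg_zero.symm))

theorem gaugeQuad_add (m e m' e' : Bulk) :
    gaugeQuad BD (m + m') (e + e') = gaugeQuad BD m e + gaugeQuad BD m' e' :=
  Prod.ext (funext fun i => map_add (BD i) e e') (Prod.ext (add_zero _).symm
    (Prod.ext rfl (add_zero _).symm))

theorem GaugeLead.gaugeGen_neg (h : GaugeLead m e m0 e0) {z : Config} (hz : z ∈ phaseSpace c) :
    gaugeGen (-m).1 (-e).1 z = -gaugeGen m.1 e.1 z := by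
  rw [h.neg.gaugeGen_eq hz, h.gaugeGen_eq hz, gaugeQuad_neg, toConfig_neg]
  have := symp_smul_left (-1) (h.admissible c).mem hz
  rw [neg_one_smul] at this
  linarith

theorem GaugeLead.gaugeGen_sub (h : GaugeLead m e m0 e0) {m' e' : Bulk} {m0' e0' : Far}
    (h' : GaugeLead m' e' m0' e0') {z : Config} (hz : z ∈ phaseSpace c) :
    gaugeGen (m - m').1 (e - e').1 z = gaugeGen m.1 e.1 z - gaugeGen m'.1 e'.1 z := by
  have h1 := h'.gaugeGen_neg hz
  rw [h'.neg.gaugeGen_eq hz] at h1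
  rw [(h.sub h').gaugeGen_eq hz, h.gaugeGen_eq hz, sub_eq_add_neg, sub_eq_add_neg, gaugeQuad_add,
    toConfig_add, symp_add_left (h.admissible c).mem (h'.neg.admissible c).mem hz]
  linarith

/-- Symmetry moves the Poincaré transformation from the configuration to the gauge direction, where
it acts on the parameters. -/
theorem GaugeLead.symp_poincareVF (h : GaugeLead m e m0 e0) (p : poincareAlgebra) {z : Config}
    (hz : z ∈ phaseSpace c) : symp (poincareVF p z) (toConfig (gaugeQuad BD m e)) =
      -gaugeGen ((killing p).gauge (m, e)).1.1 ((killing p).gauge (m, e)).2.1 z := by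
  rw [symp_poincareVF_comm p hz (h.admissible c).mem, poincareVF_toConfig,
    Killing.act_gaugeQuad BD_comm, (h.gauge (killingLead p)).gaugeGen_eq hz, neg_neg]

theorem GaugeLead.poisson_poincare (h : GaugeLead m e m0 e0) (c : AngularBC) (p : poincareAlgebra) :
    PoissonEq c (gaugeGen m.1 e.1) (poincareGen p)
      (gaugeGen (-((killing p).gauge (m, e)).1).1 (-((killing p).gauge (m, e)).2).1) :=
  .of_isHamiltonian (h.isHamiltonian c) (isHamiltonian_poincareGen c p) fun z hz => by
    rw [gaugeVF_eq, h.symp_poincareVF p hz, (h.gauge (killingLead p)).gaugeGen_neg hz]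

theorem GaugeLead.poisson_gauge (h : GaugeLead m e m0 e0) {m' e' : Bulk} {m0' e0' : Far}
    (h' : GaugeLead m' e' m0' e0') (c : AngularBC) :
    PoissonEq c (gaugeGen m.1 e.1) (gaugeGen m'.1 e'.1) (fun _ => 0) :=
  .of_isHamiltonian (h.isHamiltonian c) (h'.isHamiltonian c) fun _ _ => h'.symp_gauge h

theorem dxd_eq (p : poincareAlgebra) (e : Bulk) (x : E3) :
    dxd (lapse p) e.1 x = (∑ i, BD i ((killing p).xi * BD i e)).1 x := by
  rw [Bulk.sum_apply, dxd, lapse_eq]; rfl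

theorem along_eq (p : poincareAlgebra) (f : Bulk) (x : E3) :
    along (shift p) f.1 x = (∑ i, (killing p).Y i * BD i f).1 x := by
  simp only [Bulk.sum_apply, along, shift_apply, Bulk.mul_apply, BD_apply]

theorem GaugeLead.poisson_poincare' (h : GaugeLead m e m0 e0) (c : AngularBC)
    (p : poincareAlgebra) :
    PoissonEq c (gaugeGen m.1 e.1) (poincareGen p)
        (gaugeGen (fun x => -dxd (lapse p) e.1 x - along (shift p) m.1 x)
          (fun x => -(lapse p x * m.1 x) - along (shift p) e.1 x)) := by
  have e1 : (fun x => -dxd (lapse p) e.1 x - along (shift p) m.1 x) =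
      (-((killing p).gauge (m, e)).1).1 := funext fun x => by
    rw [dxd_eq, along_eq]
    simp only [Killing.gauge, Bulk.neg_apply, Bulk.add_apply]
    ring
  have e2 : (fun x => -(lapse p x * m.1 x) - along (shift p) e.1 x) =
      (-((killing p).gauge (m, e)).2).1 := funext fun x => by
    rw [along_eq, lapse_eq]
    simp only [Killing.gauge, Bulk.neg_apply, Bulk.add_apply, Bulk.mul_apply]
    ring
  rw [e1, e2]
  exact h.poisson_poincare c p

theorem along_neg (v : E3 → E3) (f : Bulk) (x : E3) :
    along v (fun x => -f.1 x) x = -along v f.1 x := by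
  have : ∀ i, pd i (fun x => -f.1 x) x = -pd i f.1 x := fun i =>
    congrArg (fun f => f.1 x) (map_neg (BD i) f)
  simp only [along, this, mul_neg, Finset.sum_neg_distrib]

theorem GaugeLead.neg_left (h : GaugeLead m e m0 e0) : GaugeLead (-m) e (-m0) e0 :=
  ⟨h.neg.mu, h.eps⟩

theorem GaugeLead.poisson_poincare_neg (h : GaugeLead m e m0 e0) (c : AngularBC)
    (p : poincareAlgebra) :
    PoissonEq c (gaugeGen (fun x => -m.1 x) e.1) (poincareGen p)
        (gaugeGen (fun x => -(dxd (lapse p) e.1 x - along (shift p) m.1 x))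
          (fun x => lapse p x * m.1 x - along (shift p) e.1 x)) := by
  have := h.neg_left.poisson_poincare' c p
  have e0 : ((-m : Bulk).1) = fun x => -m.1 x := rfl
  rw [e0] at this
  simp only [along_neg] at this
  convert this using 2 <;>
  · funext x; ring

/-- The gauge generators are conserved on the constraint surface. -/
theorem GaugeLead.poisson_time (h : GaugeLead m e m0 e0) (c : AngularBC) (p : poincareAlgebra)
    (hp : ∀ x, lapse p x = 1) (hp' : ∀ x, shift p x = 0) :
    ∃ H : Config → ℝ, PoissonEq c (gaugeGen m.1 e.1) (poincareGen p) H ∧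
      ∀ z ∈ phaseSpace c, OnShell z → H z = 0 := by
  refine ⟨_, h.poisson_poincare c p, fun z hz hon => ?_⟩
  have h1 := (h.gauge (killingLead p)).neg
  have k1 : (killing p).xi = 1 := Bulk.ext_apply fun x => by rw [← lapse_eq, hp]; rfl
  have k2 : ∀ i, (killing p).Y i = 0 := fun i => Bulk.ext_apply fun x => by
    rw [← shift_apply, hp']; rfl
  have b1 : ∀ i, algebraMap ℝ Bulk (p.1 (sp i) tm) = 0 := fun i => by
    have := (killing p).d_xi i
    rw [k1, Derivation.map_one_eq_zero] at this
    exact this.symm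
  have b2 : ∀ i j, algebraMap ℝ Bulk (p.1 (sp i) (sp j)) = 0 := fun i j => by
    have := (killing p).d_Y i j
    rw [k2, map_zero] at this
    exact this.symm
  have c1 : ∀ i, p.1 (sp i) tm = 0 := fun i => by simpa using congrArg (fun f => f.1 0) (b1 i)
  have c2 : ∀ i j, p.1 (sp i) (sp j) = 0 := fun i j => by
    simpa using congrArg (fun f => f.1 0) (b2 i j)
  -- A time translation has no Lorentz part. The transformed parameters thus vanish to leading
  -- order, and on the constraint surface the generator sees only the leading order.
  have l1 : (lorentz p).xi = 0 := by simp [lorentz, mkKilling, c1]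
  have l2 : ∀ i, (lorentz p).Y i = 0 := fun i => by
    simp [lorentz, mkKilling, c2]
  rw [gaugeGen_of_onShell _ _ hon, h1.lead_mu, h1.lead_eps]
  have d1 : -((lorentz p).gauge (m0, e0)).1 = 0 := by simp [Killing.gauge, l1, l2]
  have d2 : -((lorentz p).gauge (m0, e0)).2 = 0 := by simp [Killing.gauge, l1, l2]
  have : chargeDensity (sph 0) (sph 0) z = fun _ => 0 := funext fun n => by simp [chargeDensity]
  rw [d1, d2, charge, this, sphereInt, integral_zero]

end

/-! ### The energy -/

/-- The hamiltonian vector field of the electromagnetic energy. -/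
def energyQuad (b : Quad Bulk) : Quad Bulk :=
  (b.2.1, fun i => ∑ m, BD m (fs BD b.1 m i), 0, 0)

/-- The polarization of twice the energy density. -/
def energyPolar (b b' : Quad Bulk) : Bulk :=
  ∑ i, b.2.1 i * b'.2.1 i + (fs BD b.1 0 1 * fs BD b'.1 0 1 + fs BD b.1 0 2 * fs BD b'.1 0 2
    + fs BD b.1 1 2 * fs BD b'.1 1 2)

theorem energyPolar_eq (b b' : Quad Bulk) :
    energyPolar b b' + (kd (energyQuad b) b' - kd b' (energyQuad b)) =
      ∑ m, BD m (∑ i, fs BD b.1 m i * b'.1 i) := by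
  simp only [energyPolar, energyQuad, kd, fs, Fin.sum_univ_three, map_add, map_sub,
    Derivation.leibniz, smul_eq_mul, BD_comm 1 0, BD_comm 2 0, BD_comm 2 1]
  ring

theorem LeadCond.zero (s : ℝ) : LeadCond s 0 0 := by
  have hz : rad (0 : Fin 3 → Far) = 0 := by simp [rad]
  refine ⟨by simp [hz], by simp [hz], ⟨0, Homog.zero _, by simp, fun i => by simp [tan, hz]⟩,
    fun i => by simp [tan, hz], by simp⟩

/-- The time derivative falls off one order faster than the fields themselves, so all leading terms
vanish and parity is preserved trivially. -/
theorem Admissible.energyQuad {c : AngularBC} {b : Quad Bulk} {l : Quad Far}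
    (h : Admissible c b l) : Admissible c (energyQuad b) 0 where
  lead :=
    { A := fun i => (h.lead.P i).shift (k := 1)
      P := fun i => by
        have := (Lead1.sum Finset.univ fun m _ => (h.lead.fs m i).deriv m (m := 3)).shift (k := 2)
        change Lead1 2 (restr (∑ m, BD m (fs BD b.1 m i))) 0
        simpa only [map_sum, ← FD_restr] using this
      Ψ := by simpa [EMInfinity.energyQuad] using Lead1.zero 1
      Q := ⟨0, by simpa [EMInfinity.energyQuad] using Lead0.zero 3⟩
      zero := rfl }
  cond := LeadCond.zero _

/-- The flux is of order `r⁻³` and disappears at infinity, so the energy needs no surface term. -/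
theorem Admissible.energyPolar {c : AngularBC} {b b' : Quad Bulk} {l l' : Quad Far}
    (h : Admissible c b l) (h' : Admissible c b' l') : BulkTendsto (energyPolar b b')
      (-EMInfinity.symp (toConfig (EMInfinity.energyQuad b)) (toConfig b')) := by
  have h1 := bulkTendsto_div (V := fun m => ∑ i, fs BD b.1 m i * b'.1 i) (V0 := fun _ => 0) fun m => by
    have := (Lead1.sum Finset.univ fun i _ => (h.lead.fs m i).mul (h'.lead.A i)
      (m := 3)).lead0.shift_zero (k := 2)
    simpa only [map_sum, map_mul] using this
  have h2 := h1.sub (h.energyQuad.symp h')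
  rw [← energyPolar_eq, add_sub_cancel_right] at h2
  convert h2 using 1
  simp [rad]

theorem energyDensity_toConfig (b : Quad Bulk) :
    energyDensity (toConfig b) = ((1 / 2 : ℝ) • energyPolar b b).1 := funext fun x => by
  have e : ∀ i j, fstr (vecA (toConfig b)) i j x = (BD i (b.1 j)).1 x - (BD j (b.1 i)).1 x :=
    fun i j => rfl
  simp only [energyDensity, energyPolar, fs, Fin.sum_univ_three, Bulk.add_apply, Bulk.mul_apply,
    Bulk.sub_apply, Bulk.smul_apply, e]
  simp only [toConfig, momA]
  ring

theorem energy_finite {c : AngularBC} {z : Config} (hz : z ∈ phaseSpace c) :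
    BulkConverges (energyDensity z) := by
  obtain ⟨b, l, rfl, h⟩ := exists_admissible hz
  rw [energyDensity_toConfig]
  exact ((h.energyPolar h).smul _).converges

/-- The hamiltonian vector field of the electromagnetic energy, on configurations. -/
def energyVF (z : Config) : Config :=
  (momA z, fun x => WithLp.toLp 2 fun i => ∑ m, pd m (fstr (vecA z) m i) x, fun _ => 0, fun _ => 0)

theorem energyVF_toConfig (b : Quad Bulk) : energyVF (toConfig b) = toConfig (energyQuad b) := by
  refine Prod.ext rfl (Prod.ext (funext fun x => ?_) rfl)
  ext i
  exact (Bulk.sum_apply Finset.univ (fun m => BD m (fs BD b.1 m i)) x).symm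

theorem energyQuad_add_smul (b b' : Quad Bulk) (t : ℝ) :
    energyQuad (b + t • b') = energyQuad b + t • energyQuad b' := by
  refine Prod.ext rfl (Prod.ext (funext fun i => ?_) (Prod.ext ?_ ?_))
  · simp only [energyQuad, fs, Prod.fst_add, Prod.smul_fst, Prod.snd_add, Prod.smul_snd,
      Pi.add_apply, Pi.smul_apply, map_add, map_sub, Derivation.map_smul, Fin.sum_univ_three,
      smul_add, smul_sub]
    ring
  · simp [energyQuad]
  · simp [energyQuad]

theorem energyPolar_comm (b b' : Quad Bulk) : energyPolar b b' = energyPolar b' b := by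
  simp only [energyPolar, Fin.sum_univ_three]; ring

theorem symp_energyVF_comm {c : AngularBC} {z w : Config} (hz : z ∈ phaseSpace c)
    (hw : w ∈ phaseSpace c) : symp (energyVF z) w = symp (energyVF w) z := by
  obtain ⟨b, l, rfl, h⟩ := exists_admissible hz
  obtain ⟨b', l', rfl, h'⟩ := exists_admissible hw
  have h1 := h.energyPolar h'
  rw [energyPolar_comm] at h1
  rw [energyVF_toConfig, energyVF_toConfig]
  linarith [h1.unique (h'.energyPolar h)]

theorem energyVF_mem {c : AngularBC} {z : Config} (hz : z ∈ phaseSpace c) :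
    energyVF z ∈ phaseSpace c := by
  obtain ⟨b, l, rfl, h⟩ := exists_admissible hz
  rw [energyVF_toConfig]
  exact h.energyQuad.mem

theorem isHamiltonian_energy (c : AngularBC) :
    IsHamiltonian c (fun z => bulkInt (energyDensity z)) energyVF := by
  refine .of_quadratic (fun _ hz => energyVF_mem hz) (fun z hz w hw t => ?_)
    (fun _ hz _ hw => symp_energyVF_comm hz hw) fun z hz => ?_
  · obtain ⟨b, l, rfl, h⟩ := exists_admissible hz
    obtain ⟨b', l', rfl, h'⟩ := exists_admissible hw
    rw [← toConfig_smul, ← toConfig_add, energyVF_toConfig, energyVF_toConfig, energyVF_toConfig,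
      energyQuad_add_smul, toConfig_add, toConfig_smul]
  · obtain ⟨b, l, rfl, h⟩ := exists_admissible hz
    rw [energyDensity_toConfig, ((h.energyPolar h).smul _).bulkInt_eq, energyVF_toConfig]
    ring

theorem GaugeLead.poisson_hamiltonian {m e : Bulk} {m0 e0 : Far} (h : GaugeLead m e m0 e0)
    {m' e' : Bulk} {m0' e0' : Far} (h' : GaugeLead m' e' m0' e0') (c : AngularBC) :
    PoissonEq c (gaugeGen m.1 e.1) (hamiltonian m'.1 e'.1) (fun _ => 0) := by
  refine .of_isHamiltonian (h.isHamiltonian c) ((isHamiltonian_energy c).add (h'.isHamiltonian c))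
    fun z hz => ?_
  have hg := (h.admissible c).mem
  -- Gauge invariance of the energy: a gradient has no field strength. Writing zero as a multiple
  -- lets linearity of `symp` finish the argument.
  have e1 : energyQuad (gaugeQuad BD m e) = (0 : ℝ) • gaugeQuad BD m e := by
    rw [zero_smul]
    refine Prod.ext rfl (Prod.ext (funext fun i => ?_) rfl)
    change ∑ m, BD m (fs BD (fun i => BD i e) m i) = 0
    simp only [fs, BD_comm i, sub_self, map_zero, Finset.sum_const_zero]
  rw [gaugeVF_eq, gaugeVF_eq, symp_add_left (energyVF_mem hz) (h'.admissible c).mem hg,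
    h'.symp_gauge h, symp_energyVF_comm hz hg, energyVF_toConfig, e1, toConfig_smul,
    symp_smul_left _ hg hz]
  ring

/-! ### The Poincaré algebra -/

theorem coe_bracket (p q : poincareAlgebra) : (⁅p, q⁆ : poincareAlgebra).1 = p.1 * q.1 - q.1 * p.1 :=
  rfl

theorem sum_pIdx (f : PIdx → ℝ) : ∑ a, f a = f tm + (∑ i, f (sp i) + f af) := by
  rw [Fintype.sum_sum_type, Fintype.sum_sum_type]; simp

theorem bracket_sp_tm (p q : poincareAlgebra) (i : Fin 3) :
    (⁅p, q⁆ : poincareAlgebra).1 (sp i) tm =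
      ∑ j, p.1 (sp i) (sp j) * q.1 (sp j) tm - ∑ j, q.1 (sp i) (sp j) * p.1 (sp j) tm := by
  simp only [coe_bracket, Matrix.sub_apply, Matrix.mul_apply, sum_pIdx, poincare_time_time,
    poincare_affine]
  ring

theorem bracket_af_tm (p q : poincareAlgebra) :
    (⁅p, q⁆ : poincareAlgebra).1 af tm =
      ∑ j, p.1 af (sp j) * q.1 (sp j) tm - ∑ j, q.1 af (sp j) * p.1 (sp j) tm := by
  simp only [coe_bracket, Matrix.sub_apply, Matrix.mul_apply, sum_pIdx, poincare_time_time,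
    poincare_affine]
  ring

/-- Intermediate indices split into spatial and time ones. The time index contributes the rotation
generated by two boosts, with the sign fixed by the Minkowski signature through
`poincare_time_space`. -/
theorem bracket_sp_sp (p q : poincareAlgebra) (i j : Fin 3) :
    (⁅p, q⁆ : poincareAlgebra).1 (sp i) (sp j) =
      ∑ k, p.1 (sp i) (sp k) * q.1 (sp k) (sp j) - ∑ k, q.1 (sp i) (sp k) * p.1 (sp k) (sp j)
        + (p.1 (sp i) tm * q.1 (sp j) tm - q.1 (sp i) tm * p.1 (sp j) tm) := by
  simp only [coe_bracket, Matrix.sub_apply, Matrix.mul_apply, sum_pIdx, poincare_time_space,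
    poincare_affine]
  ring

theorem bracket_af_sp (p q : poincareAlgebra) (j : Fin 3) :
    (⁅p, q⁆ : poincareAlgebra).1 af (sp j) =
      ∑ k, p.1 af (sp k) * q.1 (sp k) (sp j) - ∑ k, q.1 af (sp k) * p.1 (sp k) (sp j)
        + (p.1 af tm * q.1 (sp j) tm - q.1 af tm * p.1 (sp j) tm) := by
  simp only [coe_bracket, Matrix.sub_apply, Matrix.mul_apply, sum_pIdx, poincare_time_space,
    poincare_affine]
  ring

theorem isBracket_killing (p q : poincareAlgebra) :
    (killing p).IsBracket (killing q) (killing ⁅p, q⁆) where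
  xi_eq := by
    simp only [killing, mkKilling, bracket_sp_tm, bracket_af_tm, Fin.sum_univ_three, map_add,
      map_sub, map_mul]
    ring
  Y_eq i := by
    simp only [killing, mkKilling, bracket_sp_sp, bracket_af_sp, Fin.sum_univ_three, map_add,
      map_sub, map_mul]
    ring

theorem isBracket_lorentz (p q : poincareAlgebra) :
    (lorentz p).IsBracket (lorentz q) (lorentz ⁅p, q⁆) where
  xi_eq := by
    simp only [lorentz, mkKilling, bracket_sp_tm, Fin.sum_univ_three, map_add, map_zero,
      map_sub, map_mul, Pi.zero_apply]
    ring
  Y_eq i := by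
    simp only [lorentz, mkKilling, bracket_sp_sp, Fin.sum_univ_three, map_add, map_zero,
      map_sub, map_mul, Pi.zero_apply]
    ring

theorem lapse_bracket (p q : poincareAlgebra) (x : E3) :
    lapse ⁅p, q⁆ x = along (shift p) (lapse q) x - along (shift q) (lapse p) x := by
  rw [lapse_eq, lapse_eq, lapse_eq, along_eq, along_eq, (isBracket_killing p q).xi_eq]
  simp only [Killing.d_xi, Bulk.sub_apply]

theorem shift_bracket (p q : poincareAlgebra) (x : E3) (i : Fin 3) :
    shift ⁅p, q⁆ x i =
      along (shift p) (fun y => shift q y i) x - along (shift q) (fun y => shift p y i) x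
        + (lapse p x * pd i (lapse q) x - lapse q x * pd i (lapse p) x) := by
  simp only [shift_apply]
  rw [along_eq, along_eq, lapse_eq, lapse_eq, ← BD_apply, ← BD_apply,
    (isBracket_killing p q).Y_eq]
  simp only [Killing.d_xi, Killing.d_Y, Bulk.sub_apply, Bulk.add_apply, Bulk.mul_apply]

theorem symp_sub_left {c : AngularBC} {z w v : Config} (hz : z ∈ phaseSpace c)
    (hw : w ∈ phaseSpace c) (hv : v ∈ phaseSpace c) : symp (z - w) v = symp z v - symp w v := by
  rw [sub_eq_add_neg, ← neg_one_smul ℝ w, symp_add_left hz (smul_mem_phaseSpace _ hw) hv,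
    symp_smul_left _ hw hv]
  ring

theorem poincareVF_bracket {c : AngularBC} (p q : poincareAlgebra) {z : Config}
    (hz : z ∈ phaseSpace c) :
    poincareVF ⁅p, q⁆ z = poincareVF p (poincareVF q z) - poincareVF q (poincareVF p z) := by
  obtain ⟨b, l, rfl, h⟩ := exists_admissible hz
  simp only [poincareVF_toConfig]
  rw [← (isBracket_killing p q).act_eq BD_comm, sub_eq_add_neg, toConfig_add, toConfig_neg,
    sub_eq_add_neg]

/-- Formal consequence of symmetry: `-½ Ω(X_p X_q z - X_q X_p z, z)` equals `-½ (Ω(X_p z, X_q z) -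
Ω(X_q z, X_p z))`, which is `Ω(X_q z, X_p z)`. No central extension can appear, since the generators
are purely quadratic. -/
theorem symp_poincareVF_poincareVF {c : AngularBC} (p q : poincareAlgebra) {z : Config}
    (hz : z ∈ phaseSpace c) : symp (poincareVF q z) (poincareVF p z) = poincareGen ⁅p, q⁆ z := by
  have hp := poincareVF_mem p hz
  have hq := poincareVF_mem q hz
  rw [poincareGen_eq _ hz, poincareVF_bracket p q hz,
    symp_sub_left (poincareVF_mem p hq) (poincareVF_mem q hp) hz, symp_poincareVF_comm p hq hz,
    symp_poincareVF_comm q hp hz, symp_comm (poincareVF p z)]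
  ring

theorem poisson_poincare_poincare (c : AngularBC) (p q : poincareAlgebra) :
    PoissonEq c (poincareGen p) (poincareGen q) (poincareGen ⁅p, q⁆) :=
  .of_isHamiltonian (isHamiltonian_poincareGen c p) (isHamiltonian_poincareGen c q) fun _ hz =>
    symp_poincareVF_poincareVF p q hz

/-- Bilinearity gives four terms; the gauge-gauge term vanishes and the two mixed ones combine into
the difference of transformed parameters. -/
theorem poisson_semidirect (c : AngularBC) (p q : poincareAlgebra) {m e m' e' : Bulk}
    {m0 e0 m0' e0' : Far} (h : GaugeLead m e m0 e0) (h' : GaugeLead m' e' m0' e0') :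
    PoissonEq c (fun z => poincareGen p z + gaugeGen m.1 e.1 z)
      (fun z => poincareGen q z + gaugeGen m'.1 e'.1 z)
      (fun z => poincareGen ⁅p, q⁆ z +
        gaugeGen (((killing p).gauge (m', e')).1 - ((killing q).gauge (m, e)).1).1
          (((killing p).gauge (m', e')).2 - ((killing q).gauge (m, e)).2).1 z) := by
  refine .of_isHamiltonian ((isHamiltonian_poincareGen c p).add (h.isHamiltonian c))
    ((isHamiltonian_poincareGen c q).add (h'.isHamiltonian c)) fun z hz => ?_
  have hp := poincareVF_mem p hz
  have hq := poincareVF_mem q hz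
  have hg := (h.admissible c).mem
  have hg' := (h'.admissible c).mem
  rw [gaugeVF_eq, gaugeVF_eq, symp_add_left hq hg' (add_mem_phaseSpace hp hg),
    symp_add_right hp hg hq, symp_add_right hp hg hg', symp_poincareVF_poincareVF p q hz,
    h.symp_poincareVF q hz, symp_comm _ (poincareVF p z), h'.symp_poincareVF p hz,
    h'.symp_gauge h, (h'.gauge (killingLead p)).gaugeGen_sub (h.gauge (killingLead q)) hz]
  ring

/-! ### The charges -/

theorem charge_eq_zero {c : AngularBC} {εbar μbar : S2 → ℝ} (hε : ∀ n, εbar (-n) = -εbar n)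
    (hμ : ∀ n, μbar (-n) = μbar n) {z : Config} (hz : z ∈ phaseSpace c) :
    charge μbar εbar z = 0 := by
  rw [phaseSpace, Set.mem_ofPred] at hz
  refine sphereInt_eq_zero_of_odd fun n => ?_
  rw [chargeDensity, chargeDensity, hε, hμ, hz.2.2.2.2.1, hz.2.2.2.2.2.1]
  ring

theorem HasLead.charge {b : Quad Bulk} {l : Quad Far} (h : HasLead b l) (m0 e0 : Far) :
    charge (sph m0) (sph e0) (toConfig b) = sInt (e0 * rad l.2.1 - m0 * rad l.1) := by
  rw [EMInfinity.charge, h.chargeDensity, sInt_apply]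

theorem rad_radial (f : Far) : rad (fun i => f * FX i * Fr ^ 2) = f := by
  simp only [rad, Fin.sum_univ_three]
  linear_combination f * Fr_sq'

theorem tan_radial (f : Far) (i : Fin 3) : tan (fun i => f * FX i * Fr ^ 2) i = 0 := by
  rw [tan, rad_radial, sub_self]

theorem rad_zero : rad (0 : Fin 3 → Far) = 0 := by simp [rad]

theorem tan_zero (i : Fin 3) : tan (0 : Fin 3 → Far) i = 0 := by simp [tan, rad_zero]

/-! ### Configurations with non-zero charges. -/

/-- The leading terms of a radial vector potential. -/
def radialLead (f : Far) : Quad Far := (fun i => f * FX i * Fr ^ 2, 0, 0, 0)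

/-- A configuration with a radial vector potential at infinity. -/
def radialQuad (f : Far) : Quad Bulk := (fun i => fill (f * FX i * Fr ^ 2), 0, 0, 0)

theorem admissible_radialQuad (c : AngularBC) {f : Far} (hf : Homog 0 f) (hodd : refl f = -f) :
    Admissible c (radialQuad f) (radialLead f) where
  lead :=
    { A := fun i => lead1_fill ((hf.mul (Homog.coord i) (k := 1)).mul Homog.inv_norm_sq)
      P := fun i => by simpa [radialQuad, radialLead] using Lead1.zero 2
      Ψ := by simpa [radialQuad, radialLead] using Lead1.zero 1
      Q := ⟨0, by simpa [radialQuad] using Lead0.zero 3⟩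
      zero := rfl }
  cond := by
    refine ⟨?_, ?_, ⟨0, Homog.zero _, by simp, fun i => ?_⟩, fun i => ?_, ?_⟩
    · simp only [radialLead, rad_radial, hodd]
    · simp [radialLead, rad_zero]
    · simp [radialLead, tan_radial]
    · simp [radialLead, tan_zero]
    · simp [radialLead]

theorem onShell_iff (b : Quad Bulk) :
    OnShell (toConfig b) ↔ b.2.2.2 = 0 ∧ ∑ i, BD i (b.2.1 i) = 0 := by
  refine ⟨fun h => ⟨Bulk.ext_apply h.1, Bulk.ext_apply fun x => ?_⟩, fun h => ⟨fun x => ?_,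
    fun x => ?_⟩⟩
  · rw [Bulk.sum_apply]; exact h.2 x
  · change b.2.2.2.1 x = 0
    rw [h.1]; rfl
  · have := congrArg (fun f => f.1 x) h.2
    simp only [Bulk.sum_apply] at this
    exact this

theorem onShell_radialQuad (f : Far) : OnShell (toConfig (radialQuad f)) :=
  (onShell_iff _).2 ⟨rfl, by simp [radialQuad]⟩

/-- Poincaré transformations are linear maps tangent to the linear constraint surface, so an
infinitesimal boost of a solution of the constraints is again a solution. -/
theorem OnShell.act {k : Killing BD} {b : Quad Bulk} (h : OnShell (toConfig b)) :
    OnShell (toConfig (k.act b)) := by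
  obtain ⟨h1, h2⟩ := (onShell_iff b).1 h
  refine (onShell_iff _).2 ⟨?_, ?_⟩
  · simp [Killing.act, h1, h2]
  · rw [k.div_act BD_comm, h1, h2]; simp

/-- A configuration with electric charge density in a ball. -/
def coulombQuad (f : Far) : Quad Bulk := (0, fun i => fill (f * Fr * FX i * Fr ^ 2), 0, 0)

/-- The leading terms of a radial electric field. -/
def coulombLead (f : Far) : Quad Far := (0, fun i => f * Fr * FX i * Fr ^ 2, 0, 0)

/-- The field is `x` times a function of degree `-3`, so the angular profile of a Coulomb-like field
is unrestricted. -/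
theorem div_coulomb {f : Far} (hf : Homog 0 f) : ∑ i, FD i (f * Fr * FX i * Fr ^ 2) = 0 := by
  have h := sum_mul_FD_mul ((hf.mul Homog.inv_norm (k := -1)).mul Homog.inv_norm_sq (k := -3))
  have e : ∀ i, f * Fr * FX i * Fr ^ 2 = f * Fr * Fr ^ 2 * FX i := fun i => by ring
  rw [Finset.sum_congr rfl fun i _ => by rw [e i], h]
  push_cast; ring

theorem admissible_coulombQuad (c : AngularBC) {f : Far} (hf : Homog 0 f) (heven : refl f = f) :
    Admissible c (coulombQuad f) (coulombLead f) where
  lead :=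
    { A := fun i => by simpa [coulombQuad, coulombLead] using Lead1.zero 1
      P := fun i => lead1_fill (((hf.mul Homog.inv_norm (k := -1)).mul (Homog.coord i)
        (k := 0)).mul Homog.inv_norm_sq)
      Ψ := by simpa [coulombQuad, coulombLead] using Lead1.zero 1
      Q := ⟨0, by simpa [coulombQuad] using Lead0.zero 3⟩
      zero := rfl }
  cond := by
    refine ⟨?_, ?_, ⟨0, Homog.zero _, by simp, fun i => ?_⟩, fun i => ?_, ?_⟩
    · simp [coulombLead, rad_zero]
    · simp only [coulombLead, rad_radial, map_mul, heven, refl_Fr]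
    · simp [coulombLead, tan_zero]
    · simp [coulombLead, tan_radial]
    · exact div_coulomb hf

theorem dvg_coulombQuad {f : Far} (hf : Homog 0 f) {x : E3} (hx : 2 < ‖x‖) :
    dvg (momA (toConfig (coulombQuad f))) x = 0 := by
  have h0 : x ≠ 0 := norm_pos_iff.1 (by linarith)
  have h1 := congrArg (fun F => F.1 ⟨x, h0⟩) (div_coulomb hf)
  simp only [Far.sum_apply, Far.zero_apply] at h1
  rw [← h1]
  refine Finset.sum_congr rfl fun i _ => ?_
  rw [← FD_eq_of_eq_far (F := restr (fill (f * Fr * FX i * Fr ^ 2)))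
    (fun y hy => fill_apply_of_ge _ y hy.le) i ⟨x, h0⟩ hx, FD_restr]
  rfl

/-- A homogeneous function of degree zero that is not constant is not annihilated by all boosts. -/
theorem exists_boost_ne {f : Far} (hf : Homog 0 f) (hne : ∃ n n', sph f n ≠ sph f n') :
    ∃ i n, sph (∑ m, FD m (FX i * FD m f)) n ≠ 0 := by
  by_contra! hcon
  have e : ∀ i, ∑ m, FD m (FX i * FD m f) = FX i * ∑ m, FD m (FD m f) + FD i f := fun i => by
    simp [Derivation.leibniz, FD_FX, Finset.sum_add_distrib, Finset.mul_sum, mul_ite]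
  -- If all three boosts annihilate `f`, then `xᵢ Δf + ∂ᵢ f = 0`. Contraction with `xᵢ` and Euler's
  -- relation give `Δf = 0`, hence all derivatives vanish, and `f` is constant because punctured
  -- space is connected.
  have h1 : ∀ i, FX i * ∑ m, FD m (FD m f) + FD i f = 0 := fun i => by
    rw [← e]
    refine Homog.ext_sph (Homog.sum _ fun m _ => ((Homog.coord i).mul (hf.deriv m (k := -1))
      (k := 0)).deriv m (k := -1)) (Homog.zero _) fun n => ?_
    rw [hcon, sph_zero]
  have h2 : ∑ i, FX i * FD i f = 0 := rad_grad hf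
  have h3 : ∑ m, FD m (FD m f) = 0 := by
    have e0 := h1 0
    have e1 := h1 1
    have e2 := h1 2
    rw [Fin.sum_univ_three] at h2
    linear_combination (-(∑ m, FD m (FD m f))) * Fr_sq' + Fr ^ 2 * (FX 0 * e0 + FX 1 * e1
      + FX 2 * e2 - h2)
  have h4 : ∀ i, FD i f = 0 := fun i => by simpa [h3] using h1 i
  have hconst : ∀ x ∈ ({0}ᶜ : Set E3), ∀ y ∈ ({0}ᶜ : Set E3), f.ex x = f.ex y := by
    have hconn : IsConnected ({0}ᶜ : Set E3) :=
      isConnected_compl_singleton_of_one_lt_rank (by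
        rw [← Module.finrank_eq_rank]; simp) 0
    intro x hx y hy
    refine isOpen_punctured.is_const_of_fderiv_eq_zero (𝕜 := ℝ) hconn.isPreconnected
      (f.contDiffOn.differentiableOn (by simp)) (fun w hw => ?_) hx hy
    ext v
    rw [fderiv_eq_sum]
    refine Finset.sum_eq_zero fun i _ => ?_
    have := congrArg (fun F => F.1 ⟨w, hw⟩) (h4 i)
    simp only [FD_apply, Far.zero_apply] at this
    rw [this, mul_zero]
  obtain ⟨n, n', h⟩ := hne
  refine h ?_
  have := hconst n (sphere_ne_zero n) n' (sphere_ne_zero n')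
  rwa [f.ex_of_ne (sphere_ne_zero n), f.ex_of_ne (sphere_ne_zero n')] at this

/-- Boosts of radial vector potentials detect non-constant `ε̄` on the constraint surface. -/
theorem exists_onShell_charge_ne (c : AngularBC) {f : Far} (hf : Homog 0 f) (heven : refl f = f)
    (hne : ∃ n n', sph f n ≠ sph f n') :
    ∃ z ∈ phaseSpace c, OnShell z ∧ charge (sph 0) (sph f) z ≠ 0 := by
  obtain ⟨i, n, hn⟩ := exists_boost_ne hf hne
  set β : Fin 3 → ℝ := Pi.single i 1 with hβ
  set k := mkKilling BD BX BD_BX β 0 0 0 (fun _ _ => by simp)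
  set k' := mkKilling FD FX FD_FX β 0 0 0 (fun _ _ => by simp) with hk'
  have hk : KillingLead k k' := killingLead_mk _ _ _ _ _
  have hxi : k'.xi = FX i := by
    simp [hk', mkKilling, hβ, Pi.single_apply, apply_ite (algebraMap ℝ Far)]
  have hY : ∀ i, k'.Y i = 0 := fun i => by simp [hk', mkKilling]
  set N := ∑ m, FD m (FX i * FD m f) with hN
  have hNh : Homog (-1) N := Homog.sum _ fun m _ =>
    ((Homog.coord i).mul (hf.deriv m (k := -1)) (k := 0)).deriv m
  have hNodd : refl N = -N := by
    have := hk.lorentz.refl_div (fun m => FD m f)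
    rw [hxi] at this
    rw [hN, this, ← Finset.sum_neg_distrib]
    refine Finset.sum_congr rfl fun m _ => ?_
    rw [← neg_eq_iff_eq_neg.2 (FD_refl m f), heven, Far.mul_neg, map_neg]
  -- The profile of the radial potential to be boosted is chosen equal to `N` on the sphere, so that
  -- the charge becomes the squared norm of `N`.
  set v := hom 0 (sph N) (sphereSmooth_sph N)
  have hv : Homog 0 v := homog_hom 0 _
  have hvodd : refl v = -v := Homog.ext_sph hv.refl hv.neg fun n => by
    rw [sph_refl, sph_neg, sph_hom, ← sph_refl, hNodd, sph_neg]
  have h := admissible_radialQuad c hv hvodd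
  have h' := h.act hk
  refine ⟨_, h'.mem, (onShell_radialQuad v).act, ?_⟩
  rw [h'.lead.charge]
  have e1 : rad (k'.act (radialLead v)).2.1 = ∑ m, FD m (FX i * FD m v) := by
    rw [k'.act_snd_eq _ rfl, rad_add, rad_div_fs h.lead.homA, hk.lorentz.rad_lie, hxi]
    simp [radialLead, rad_radial, rad_zero, Killing.along]
  -- Self-adjointness of `v ↦ ∂ₘ (xᵢ ∂ₘ v)`: the difference consists of two divergences. Each
  -- integrates to zero, since a function of degree `0` has no radial derivative.
  have e2 : f * ∑ m, FD m (FX i * FD m v) = v * N + (∑ m, FD m (f * (FX i * FD m v)) -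
      ∑ m, FD m (v * (FX i * FD m f))) := by
    simp only [hN, Fin.sum_univ_three, Derivation.leibniz, smul_eq_mul]
    ring
  have e3 : ∀ {g g' : Far}, Homog 0 g → Homog 0 g' →
      sInt (∑ m, FD m (g * (FX i * FD m g'))) = 0 := fun {g g'} hg hg' => by
    have e : (fun m => g * (FX i * FD m g')) = fun m => g * FX i * FD m g' :=
      funext fun m => by ring
    rw [sInt_dv fun m => hg.mul ((Homog.coord i).mul (hg'.deriv m (k := -1)) (k := 0)), e,
      rad_mul, rad_grad hg']
    simp
  have e4 : sInt (v * N) = sInt (N * N) := sInt_congr_sph fun n => by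
    rw [sph_mul, sph_mul, sph_hom]
  rw [e1, zero_mul, sub_zero, e2, map_add, map_sub, e3 hf hv, e3 hv hf, e4, sub_zero, add_zero]
  exact (sInt_sq_pos hn).ne'

theorem u1_ext {k : u1Algebra} (h1 : k.1.1 = 0) (h2 : k.1.2 = 0) : k = 0 :=
  Subtype.ext (Prod.ext h1 h2)

theorem u1_smooth_eps (k : u1Algebra) : SphereSmooth k.1.1 := k.2.1

theorem u1_smooth_mu (k : u1Algebra) : SphereSmooth k.1.2 := k.2.2.1

theorem u1_even (k : u1Algebra) (n : S2) : k.1.1 (-n) = k.1.1 n := k.2.2.2.1 n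

theorem u1_odd (k : u1Algebra) (n : S2) : k.1.2 (-n) = -k.1.2 n := k.2.2.2.2 n

/-- Each charge is paired with its own profile and becomes the integral of a square. Sources are
admitted in the first claim because a constant `ε̄` measures the total flux, which vanishes when the
divergence is zero everywhere. -/
theorem charges_nontrivial (c : AngularBC) (k : u1Algebra) (hk : k ≠ 0) :
    (∃ z ∈ phaseSpace c, (∀ x, momPsi z x = 0) ∧
      (∃ R : ℝ, ∀ x, R < ‖x‖ → dvg (momA z) x = 0) ∧ charge k.1.2 k.1.1 z ≠ 0) ∧
    ((k.1.2 ≠ 0 ∨ ∃ n n', k.1.1 n ≠ k.1.1 n') →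
      ∃ z ∈ phaseSpace c, OnShell z ∧ charge k.1.2 k.1.1 z ≠ 0) := by
  set f := hom 0 _ (u1_smooth_eps k) with hfdef
  set g := hom 0 _ (u1_smooth_mu k) with hgdef
  have hf : Homog 0 f := homog_hom 0 _
  have hg : Homog 0 g := homog_hom 0 _
  have sf : sph f = k.1.1 := sph_hom 0 _
  have sg : sph g = k.1.2 := sph_hom 0 _
  have hfe : refl f = f := Homog.ext_sph hf.refl hf fun n => by rw [sph_refl, sf, u1_even]
  have hgo : refl g = -g := Homog.ext_sph hg.refl hg.neg fun n => by
    rw [sph_refl, sph_neg, sg, u1_odd]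
  rw [← sf, ← sg]
  have hmu : sph g ≠ 0 → ∃ z ∈ phaseSpace c, OnShell z ∧ charge (sph g) (sph f) z ≠ 0 := fun h => by
    obtain ⟨n, hn⟩ := Function.ne_iff.1 h
    have ha := admissible_radialQuad c hg hgo
    refine ⟨_, ha.mem, onShell_radialQuad g, ?_⟩
    rw [ha.lead.charge]
    have : f * rad (radialLead g).2.1 - g * rad (radialLead g).1 = -(g * g) := by
      simp [radialLead, rad_zero, rad_radial]
    rw [this, map_neg]
    exact neg_ne_zero.2 (sInt_sq_pos hn).ne'
  refine ⟨?_, fun h => ?_⟩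
  · by_cases h : sph g = 0
    · have hf0 : sph f ≠ 0 := fun h' => hk (u1_ext (sf ▸ h') (sg ▸ h))
      obtain ⟨n, hn⟩ := Function.ne_iff.1 hf0
      -- With `μ̄ = 0` the radial electric field of profile `ε̄` is used; smoothing it near the
      -- origin puts its sources inside the ball of radius `2`.
      have ha := admissible_coulombQuad c hf hfe
      refine ⟨_, ha.mem, fun x => rfl, ⟨2, fun x hx => dvg_coulombQuad hf hx⟩, ?_⟩
      rw [ha.lead.charge]
      have : sInt (f * rad (coulombLead f).2.1 - g * rad (coulombLead f).1) = sInt (f * f) :=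
        sInt_congr_sph fun n => by simp [coulombLead, rad_zero, rad_radial]
      rw [this]
      exact (sInt_sq_pos hn).ne'
    · obtain ⟨z, hz, hon, hc⟩ := hmu h
      exact ⟨z, hz, hon.1, ⟨0, fun x _ => hon.2 x⟩, hc⟩
  · by_cases h0 : sph g = 0
    · rw [h0]
      exact exists_onShell_charge_ne c hf hfe (h.resolve_left (not_not.2 h0))
    · exact hmu h0

/-! ### The semidirect sum -/

theorem Killing.gauge_add_smul (k : Killing FD) (a b : Far × Far) (t : ℝ) :
    k.gauge (a + t • b) = k.gauge a + t • k.gauge b := by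
  refine Prod.ext ?_ ?_ <;>
  · simp only [Killing.gauge, Prod.fst_add, Prod.snd_add, Prod.smul_fst, Prod.smul_snd, map_add,
      Derivation.map_smul, Fin.sum_univ_three, mul_add, mul_smul_comm, smul_add]
    ring

theorem lorentz_gauge_add_smul (p q : poincareAlgebra) (t : ℝ) (a : Far × Far) :
    (lorentz (p + t • q)).gauge a = (lorentz p).gauge a + t • (lorentz q).gauge a := by
  have hc : ∀ a b, (p + t • q).1 a b = p.1 a b + t * q.1 a b := fun _ _ => rfl
  have h1 : (lorentz (p + t • q)).xi = (lorentz p).xi + algebraMap ℝ Far t * (lorentz q).xi := by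
    simp only [lorentz, mkKilling, hc, map_add, map_mul, Fin.sum_univ_three, map_zero]
    ring
  have h2 : ∀ i, (lorentz (p + t • q)).Y i =
      (lorentz p).Y i + algebraMap ℝ Far t * (lorentz q).Y i := fun i => by
    simp only [lorentz, mkKilling, hc, map_add, map_mul, Fin.sum_univ_three, map_zero, Pi.zero_apply]
    ring
  refine Prod.ext ?_ ?_ <;>
  · simp only [Killing.gauge, h1, h2, Prod.fst_add, Prod.snd_add, Prod.smul_fst, Prod.smul_snd,
      map_add, Fin.sum_univ_three, Derivation.leibniz, Derivation.map_algebraMap, smul_eq_mul,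
      mul_zero, add_zero, add_mul]
    simp only [Algebra.smul_def]
    ring

/-- The homogeneous extensions of a pair `(ε̄, μ̄)`. -/
def u1Far (k : u1Algebra) : Far × Far :=
  (hom 1 _ (u1_smooth_mu k), hom 0 _ (u1_smooth_eps k))

theorem homog_u1Far (k : u1Algebra) : Homog (-1) (u1Far k).1 ∧ Homog 0 (u1Far k).2 :=
  ⟨homog_hom 1 (u1_smooth_mu k), homog_hom 0 (u1_smooth_eps k)⟩

theorem sph_u1Far (k : u1Algebra) : sph (u1Far k).1 = k.1.2 ∧ sph (u1Far k).2 = k.1.1 :=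
  ⟨sph_hom 1 (u1_smooth_mu k), sph_hom 0 (u1_smooth_eps k)⟩

theorem u1Far_add_smul (k k' : u1Algebra) (t : ℝ) :
    u1Far (k + t • k') = u1Far k + t • u1Far k' :=
  Prod.ext
    (Homog.ext_sph (homog_u1Far _).1 ((homog_u1Far k).1.add ((homog_u1Far k').1.smul t)) fun n => by
      change _ = sph (u1Far k).1 n + t * sph (u1Far k').1 n
      rw [(sph_u1Far _).1, (sph_u1Far k).1, (sph_u1Far k').1]; rfl)
    (Homog.ext_sph (homog_u1Far _).2 ((homog_u1Far k).2.add ((homog_u1Far k').2.smul t)) fun n => by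
      change _ = sph (u1Far k).2 n + t * sph (u1Far k').2 n
      rw [(sph_u1Far _).2, (sph_u1Far k).2, (sph_u1Far k').2]; rfl)

theorem u1Far_sub (k k' : u1Algebra) : u1Far (k - k') = u1Far k - u1Far k' :=
  Prod.ext
    (Homog.ext_sph (homog_u1Far _).1 ((homog_u1Far k).1.sub (homog_u1Far k').1) fun n => by
      change _ = sph (u1Far k).1 n - sph (u1Far k').1 n
      rw [(sph_u1Far _).1, (sph_u1Far k).1, (sph_u1Far k').1]; rfl)
    (Homog.ext_sph (homog_u1Far _).2 ((homog_u1Far k).2.sub (homog_u1Far k').2) fun n => by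
      change _ = sph (u1Far k).2 n - sph (u1Far k').2 n
      rw [(sph_u1Far _).2, (sph_u1Far k).2, (sph_u1Far k').2]; rfl)

theorem refl_u1Far (k : u1Algebra) :
    refl (u1Far k).1 = -(u1Far k).1 ∧ refl (u1Far k).2 = (u1Far k).2 :=
  ⟨Homog.ext_sph (homog_u1Far k).1.refl (homog_u1Far k).1.neg fun n => by
      rw [sph_refl, sph_neg, (sph_u1Far k).1, u1_odd],
    Homog.ext_sph (homog_u1Far k).2.refl (homog_u1Far k).2 fun n => by
      rw [sph_refl, (sph_u1Far k).2, u1_even]⟩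

theorem Lorentz.homog_gauge {k : Killing FD} (hk : Lorentz k) {a : Far × Far} (h1 : Homog (-1) a.1)
    (h2 : Homog 0 a.2) : Homog (-1) (k.gauge a).1 ∧ Homog 0 (k.gauge a).2 :=
  ⟨(Homog.sum _ fun i _ => (hk.homog_xi.mul (h2.deriv i (k := -1)) (k := 0)).deriv i).add
      (hk.homog_along h1), (hk.homog_xi.mul h1).add (hk.homog_along h2)⟩

theorem Lorentz.refl_gauge {k : Killing FD} (hk : Lorentz k) {a : Far × Far} (h1 : refl a.1 = -a.1)
    (h2 : refl a.2 = a.2) : refl (k.gauge a).1 = -(k.gauge a).1 ∧ refl (k.gauge a).2 = (k.gauge a).2 := by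
  have e1 : ∀ f, ∑ i, k.Y i * FD i f = k.along f := fun _ => rfl
  have e2 : k.along (-a.1) = -k.along a.1 := by
    simp only [Killing.along, map_neg, Far.mul_neg, Finset.sum_neg_distrib]
  constructor
  · simp only [Killing.gauge, e1]
    rw [map_add, hk.refl_div, hk.refl_along, h1, e2, neg_add, ← Finset.sum_neg_distrib]
    congr 1
    refine Finset.sum_congr rfl fun i _ => ?_
    rw [← neg_eq_iff_eq_neg.2 (FD_refl i a.2), h2, Far.mul_neg, map_neg]
  · simp only [Killing.gauge, e1]
    rw [map_add, map_mul, hk.refl_xi, h1, hk.refl_along, h2]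
    ring

/-- The action of a Poincaré transformation on the pairs `(ε̄, μ̄)`. -/
def u1Act (p : poincareAlgebra) (k : u1Algebra) : u1Algebra :=
  ⟨(sph ((lorentz p).gauge (u1Far k)).2, sph ((lorentz p).gauge (u1Far k)).1),
    sphereSmooth_sph ((lorentz p).gauge (u1Far k)).2,
    sphereSmooth_sph ((lorentz p).gauge (u1Far k)).1, fun n => by
      change sph ((lorentz p).gauge (u1Far k)).2 (-n) = sph ((lorentz p).gauge (u1Far k)).2 n
      rw [← sph_refl, ((lorentz_lorentz p).refl_gauge (refl_u1Far k).1 (refl_u1Far k).2).2],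
    fun n => by
      change sph ((lorentz p).gauge (u1Far k)).1 (-n) = -sph ((lorentz p).gauge (u1Far k)).1 n
      rw [← sph_refl, ((lorentz_lorentz p).refl_gauge (refl_u1Far k).1 (refl_u1Far k).2).1]
      rfl⟩

theorem u1Act_fst (p : poincareAlgebra) (k : u1Algebra) :
    (u1Act p k).1.1 = sph ((lorentz p).gauge (u1Far k)).2 := rfl

theorem u1Act_snd (p : poincareAlgebra) (k : u1Algebra) :
    (u1Act p k).1.2 = sph ((lorentz p).gauge (u1Far k)).1 := rfl

/-- The action is intertwined with `Killing.gauge` on homogeneous functions. Since `u1Far` is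
injective, linearity and the bracket relation are inherited from there. -/
theorem u1Far_u1Act (p : poincareAlgebra) (k : u1Algebra) :
    u1Far (u1Act p k) = (lorentz p).gauge (u1Far k) := by
  have h := (lorentz_lorentz p).homog_gauge (homog_u1Far k).1 (homog_u1Far k).2
  exact Prod.ext (Homog.ext_sph (homog_u1Far _).1 h.1 fun n => by rw [(sph_u1Far _).1, u1Act_snd])
    (Homog.ext_sph (homog_u1Far _).2 h.2 fun n => by rw [(sph_u1Far _).2, u1Act_fst])

theorem u1Far_injective {k k' : u1Algebra} (h : u1Far k = u1Far k') : k = k' :=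
  Subtype.ext (Prod.ext (by rw [← (sph_u1Far k).2, h, (sph_u1Far k').2])
    (by rw [← (sph_u1Far k).1, h, (sph_u1Far k').1]))

theorem u1Act_add_smul_right (p : poincareAlgebra) (k k' : u1Algebra) (t : ℝ) :
    u1Act p (k + t • k') = u1Act p k + t • u1Act p k' := u1Far_injective (by
  simp only [u1Far_u1Act, u1Far_add_smul, Killing.gauge_add_smul])

theorem u1Act_add_smul_left (p q : poincareAlgebra) (k : u1Algebra) (t : ℝ) :
    u1Act (p + t • q) k = u1Act p k + t • u1Act q k := u1Far_injective (by
  simp only [u1Far_u1Act, u1Far_add_smul, lorentz_gauge_add_smul])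

theorem map_add_of_add_smul {M N : Type*} [AddCommGroup M] [Module ℝ M] [AddCommGroup N]
    [Module ℝ N] {f : M → N} (h : ∀ x y (t : ℝ), f (x + t • y) = f x + t • f y) (x y : M) :
    f (x + y) = f x + f y := by simpa using h x y 1

theorem map_smul_of_add_smul {M N : Type*} [AddCommGroup M] [Module ℝ M] [AddCommGroup N]
    [Module ℝ N] {f : M → N} (h : ∀ x y (t : ℝ), f (x + t • y) = f x + t • f y) (t : ℝ) (x : M) :
    f (t • x) = t • f x := by
  have h0 : f 0 = 0 := by simpa using h 0 0 1
  simpa [h0] using h 0 x t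

theorem u1_bracket (a b : u1Algebra) : ⁅a, b⁆ = 0 := rfl

/-- The derivation of the abelian algebra of the pairs `(ε̄, μ̄)` given by a Poincaré
transformation. -/
def u1Derivation (p : poincareAlgebra) : LieDerivation ℝ u1Algebra u1Algebra where
  toFun := u1Act p
  map_add' := map_add_of_add_smul (u1Act_add_smul_right p)
  map_smul' := map_smul_of_add_smul (u1Act_add_smul_right p)
  leibniz' a b := by
    have : u1Act p 0 = 0 := by
      simpa using map_smul_of_add_smul (u1Act_add_smul_right p) 0 0
    simp [u1_bracket, this]

/-- The action of the Poincaré algebra on the abelian algebra of the pairs `(ε̄, μ̄)`. -/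
def u1Hom : poincareAlgebra →ₗ⁅ℝ⁆ LieDerivation ℝ u1Algebra u1Algebra where
  toFun := u1Derivation
  map_add' p q := LieDerivation.ext fun k =>
    map_add_of_add_smul (f := fun p => u1Act p k) (fun p q t => u1Act_add_smul_left p q k t) p q
  map_smul' t p := LieDerivation.ext fun k =>
    map_smul_of_add_smul (f := fun p => u1Act p k) (fun p q t => u1Act_add_smul_left p q k t) t p
  map_lie' {p q} := LieDerivation.ext fun k => by
    rw [LieDerivation.commutator_apply]
    change u1Act ⁅p, q⁆ k = u1Act p (u1Act q k) - u1Act q (u1Act p k)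
    refine u1Far_injective ?_
    rw [u1Far_sub]
    simp only [u1Far_u1Act]
    rw [(isBracket_lorentz p q).gauge_eq FD_comm]

theorem u1Hom_apply (p : poincareAlgebra) (k : u1Algebra) : u1Hom p k = u1Act p k := rfl

theorem u1Hom_formula (p : poincareAlgebra) (k : u1Algebra) (n : S2) :
    (u1Hom p k).1.1 n = inner ℝ (yvec p n) (sgrad k.1.1 n) + bfun p n * k.1.2 n ∧
    (u1Hom p k).1.2 n = inner ℝ (yvec p n) (sgrad k.1.2 n)
      + sdiv (fun m => bfun p m • sgrad k.1.1 m) n := by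
  have hk := lorentz_lorentz p
  have he := (homog_u1Far k).2
  constructor
  · rw [u1Hom_apply, u1Act_fst, ← (sph_u1Far k).2, ← (sph_u1Far k).1, inner_yvec_sgrad p he, bfun_eq,
      Killing.gauge, sph_add, sph_mul, add_comm]
    rfl
  · set g := hom 0 _ (u1_smooth_mu k) with hgdef
    have hg : Homog 0 g := homog_hom 0 _
    -- The parameter `μ̄` is extended with degree `-1`, whereas the gradient on the sphere uses
    -- degree `0`; the factor `r⁻¹` between them is invariant under rotations.
    have e0 : (u1Far k).1 = Fr * g := Homog.ext_sph (homog_u1Far k).1 (Homog.inv_norm.mul hg)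
      fun n => by rw [(sph_u1Far k).1, sph_mul, sph_Fr, sph_hom, one_mul]
    have e1 : (lorentz p).along (u1Far k).1 = Fr * (lorentz p).along g := by
      rw [e0, Killing.along_mul, hk.along_Fr, mul_zero, add_zero]
    have e2 : k.1.2 = sph g := (sph_hom 0 _).symm
    have e3 : (fun m => bfun p m • sgrad k.1.1 m) =
        fun m => WithLp.toLp 2 fun i => sph ((lorentz p).xi * FD i (u1Far k).2) m :=
      funext fun m => by
        ext i
        rw [PiLp.smul_apply, ← (sph_u1Far k).2, sgrad_sph he, bfun_eq]
        rfl
    rw [u1Hom_apply, u1Act_snd, e2, inner_yvec_sgrad p hg, e3,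
      sdiv_toLp (d := 0) (V := fun i => (lorentz p).xi * FD i (u1Far k).2)
        (fun i => by simpa using hk.homog_xi.mul (he.deriv i (k := -1)) (k := 0))
        (by rw [rad_mul, rad_grad he, mul_zero])]
    change sph (_ + (lorentz p).along (u1Far k).1) n = _
    rw [e1, sph_add, sph_mul, sph_Fr, one_mul, add_comm]

theorem sgrad_neg (c : S2 → ℝ) (hc : SphereSmooth c) (n : S2) : sgrad (-c) n = -sgrad c n := by
  have h := homog_hom 0 hc
  have e : -c = sph (-hom 0 c hc) := funext fun n => by rw [sph_neg, sph_hom]; rfl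
  ext i
  rw [e, sgrad_sph (by simpa using h.neg), map_neg, sph_neg, ← sgrad_sph (by simpa using h), sph_hom]
  rfl

theorem u1Hom_formula_neg (p : poincareAlgebra) {k k' : u1Algebra} (h1 : k'.1.1 = k.1.1)
    (h2 : k'.1.2 = -k.1.2) (n : S2) :
    (u1Hom p k).1.1 n = inner ℝ (yvec p n) (sgrad k'.1.1 n) - bfun p n * k'.1.2 n ∧
    -((u1Hom p k).1.2 n) = inner ℝ (yvec p n) (sgrad k'.1.2 n)
      - sdiv (fun m => bfun p m • sgrad k'.1.1 m) n := by
  rw [(u1Hom_formula p k n).1, (u1Hom_formula p k n).2, h1, h2, sgrad_neg _ (u1_smooth_mu k),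
    inner_neg_right, Pi.neg_apply]
  constructor <;> ring

theorem exists_gaugeLead_of_hasBoundaryValue {μ ε : E3 → ℝ} {k : u1Algebra}
    (h : HasBoundaryValue μ ε k) :
    ∃ m e, μ = m.1 ∧ ε = e.1 ∧ GaugeLead m e (u1Far k).1 (u1Far k).2 := by
  obtain ⟨m, e, m0, e0, rfl, rfl, hl⟩ := exists_gaugeLead h.1
  have h1 : m0 = (u1Far k).1 := Homog.ext_sph hl.homog_mu (homog_u1Far k).1 fun n => by
    rw [(sph_u1Far k).1, ← hl.lead_mu, h.2.2]
  have h2 : e0 = (u1Far k).2 := Homog.ext_sph hl.homog_eps (homog_u1Far k).2 fun n => by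
    rw [(sph_u1Far k).2, ← hl.lead_eps, h.2.1]
  subst h1 h2
  exact ⟨m, e, rfl, rfl, hl⟩

theorem GaugeLead.hasBoundaryValue {m e : Bulk} {k : u1Algebra}
    (h : GaugeLead m e (u1Far k).1 (u1Far k).2) : HasBoundaryValue m.1 e.1 k :=
  ⟨h.isGaugeParam, by rw [h.lead_eps, (sph_u1Far k).2], by rw [h.lead_mu, (sph_u1Far k).1]⟩

/-- The bulk parameters of the bracket come from `poisson_semidirect`. Their leading terms are the
Lorentz action on the leading terms of the given parameters, which is the first component of the
bracket in the semidirect sum because the pairs commute among themselves. -/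
theorem semidirect_poisson (c : AngularBC) (s₁ s₂ : u1Algebra ⋊⁅u1Hom⁆ poincareAlgebra)
    (μ₁ ε₁ μ₂ ε₂ : E3 → ℝ) (h₁ : HasBoundaryValue μ₁ ε₁ s₁.left)
    (h₂ : HasBoundaryValue μ₂ ε₂ s₂.left) :
    ∃ μ ε : E3 → ℝ, HasBoundaryValue μ ε ⁅s₁, s₂⁆.left ∧
      PoissonEq c (fun z => poincareGen s₁.right z + gaugeGen μ₁ ε₁ z)
        (fun z => poincareGen s₂.right z + gaugeGen μ₂ ε₂ z)
        (fun z => poincareGen ⁅s₁, s₂⁆.right z + gaugeGen μ ε z) := by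
  obtain ⟨m, e, rfl, rfl, hl⟩ := exists_gaugeLead_of_hasBoundaryValue h₁
  obtain ⟨m', e', rfl, rfl, hl'⟩ := exists_gaugeLead_of_hasBoundaryValue h₂
  have hs := (hl'.gauge (killingLead s₁.right)).sub (hl.gauge (killingLead s₂.right))
  have e1 : ⁅s₁, s₂⁆.left = u1Act s₁.right s₂.left - u1Act s₂.right s₁.left := by
    rw [SemiDirectSum.lie_eq_mk]
    simp [u1_bracket, u1Hom_apply]
  have e2 : u1Far ⁅s₁, s₂⁆.left = (lorentz s₁.right).gauge (u1Far s₂.left) -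
      (lorentz s₂.right).gauge (u1Far s₁.left) := by
    rw [e1, u1Far_sub, u1Far_u1Act, u1Far_u1Act]
  have e3 : ⁅s₁, s₂⁆.right = ⁅s₁.right, s₂.right⁆ := by rw [SemiDirectSum.lie_eq_mk]
  refine ⟨_, _, GaugeLead.hasBoundaryValue (by rw [e2]; exact hs), ?_⟩
  rw [e3]
  exact poisson_semidirect c s₁.right s₂.right hl hl'

theorem symplectic_finite {c : AngularBC} {z w : Config} (hz : z ∈ phaseSpace c)
    (hw : w ∈ phaseSpace c) : BulkConverges (kinDensity z w) ∧
      SphereIntegrable (fun n => barAr z n * barPsi w n) := by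
  obtain ⟨b, l, rfl, h⟩ := exists_admissible hz
  obtain ⟨b', l', rfl, h'⟩ := exists_admissible hw
  obtain ⟨L, hL⟩ := h.kd h'
  rw [kinDensity_toConfig, h.lead.barAr, h'.lead.barPsi]
  exact ⟨hL.converges, sphereIntegrable_sph (rad l.1 * l'.2.2.1)⟩

end EMInfinity

end

theorem mainTheorem2 (c : AngularBC) :
    -- the symplectic form is finite
    (∀ z ∈ phaseSpace c, ∀ w ∈ phaseSpace c, BulkConverges (kinDensity z w) ∧
      SphereIntegrable (fun n => barAr z n * barPsi w n)) ∧
    -- Poincaré transformations: finite and differentiable generators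
    (∀ p : poincareAlgebra,
      (∀ z ∈ phaseSpace c, BulkConverges (poincareDensity p z) ∧
        SphereIntegrable (poincareSurface p z)) ∧
      IsHamiltonian c (poincareGen p) (poincareVF p) ∧
      -- they are the usual ones, up to a gauge transformation and to the constraints
      ∀ z ∈ phaseSpace c,
        HasExpansion 0 1 (fun x => lapse p x * psi z x + inner ℝ (shift p x) (vecA z x)) ∧
        (∀ x i, vecA (poincareVF p z) x i =
          lapse p x * momA z x i + ∑ j, shift p x j * fstr (vecA z) j i x
            + pd i (fun y => lapse p y * psi z y + inner ℝ (shift p y) (vecA z y)) x) ∧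
        (OnShell z → ∀ x i, momA (poincareVF p z) x i =
          ∑ m, pd m (fun y => fstr (vecA z) m i y * lapse p y) x
            + ∑ m, pd m (fun y => shift p y m * momA z y i) x
            - ∑ m, pd m (fun y => shift p y i) x * momA z x m
            - shift p x i * dvg (momA z) x)) ∧
    -- u(1) transformations: finite, differentiable and conserved generators
    (∀ μ ε : E3 → ℝ, IsGaugeParam μ ε →
      (∀ z ∈ phaseSpace c, BulkConverges (gaugeDensity μ ε z) ∧
        SphereIntegrable (chargeDensity (lead 1 μ) (lead 0 ε) z)) ∧
      IsHamiltonian c (gaugeGen μ ε) (gaugeVF μ ε) ∧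
      (∀ z ∈ phaseSpace c, OnShell z → gaugeGen μ ε z = charge (lead 1 μ) (lead 0 ε) z) ∧
      (∀ z ∈ phaseSpace c, BulkConverges (energyDensity z)) ∧
      (∀ lam At : E3 → ℝ, IsGaugeParam lam At →
        PoissonEq c (gaugeGen μ ε) (hamiltonian lam At) (fun _ => 0)) ∧
      (∀ p : poincareAlgebra, (∀ x, lapse p x = 1) → (∀ x, shift p x = 0) →
        ∃ H : Config → ℝ, PoissonEq c (gaugeGen μ ε) (poincareGen p) H ∧
          ∀ z ∈ phaseSpace c, OnShell z → H z = 0)) ∧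
    -- the charges see only the even part of `ε̄` and the odd part of `μ̄` ...
    (∀ εbar μbar : S2 → ℝ, SphereSmooth εbar → SphereSmooth μbar →
      (∀ n, εbar (-n) = -εbar n) → (∀ n, μbar (-n) = μbar n) →
      ∀ z ∈ phaseSpace c, charge μbar εbar z = 0) ∧
    -- ... and are non-trivial for each non-zero pair (even, odd)
    (∀ k : u1Algebra, k ≠ 0 →
      (∃ z ∈ phaseSpace c, (∀ x, momPsi z x = 0) ∧
        (∃ R : ℝ, ∀ x, R < ‖x‖ → dvg (momA z) x = 0) ∧ charge k.1.2 k.1.1 z ≠ 0) ∧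
      ((k.1.2 ≠ 0 ∨ ∃ n n', k.1.1 n ≠ k.1.1 n') →
        ∃ z ∈ phaseSpace c, OnShell z ∧ charge k.1.2 k.1.1 z ≠ 0)) ∧
    -- the Poisson algebra of the generators
    (∀ p₁ p₂ : poincareAlgebra,
      PoissonEq c (poincareGen p₁) (poincareGen p₂) (poincareGen ⁅p₁, p₂⁆) ∧
      (∀ x, lapse ⁅p₁, p₂⁆ x = along (shift p₁) (lapse p₂) x - along (shift p₂) (lapse p₁) x) ∧
      (∀ x i, shift ⁅p₁, p₂⁆ x i =
        along (shift p₁) (fun y => shift p₂ y i) x - along (shift p₂) (fun y => shift p₁ y i) x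
          + (lapse p₁ x * pd i (lapse p₂) x - lapse p₂ x * pd i (lapse p₁) x))) ∧
    (∀ (p : poincareAlgebra) (μ ε : E3 → ℝ), IsGaugeParam μ ε →
      PoissonEq c (gaugeGen μ ε) (poincareGen p)
        (gaugeGen (fun x => -dxd (lapse p) ε x - along (shift p) μ x)
          (fun x => -(lapse p x * μ x) - along (shift p) ε x)) ∧
      -- the same relation for `G_{-μ, ε}`
      PoissonEq c (gaugeGen (fun x => -μ x) ε) (poincareGen p)
        (gaugeGen (fun x => -(dxd (lapse p) ε x - along (shift p) μ x))
          (fun x => lapse p x * μ x - along (shift p) ε x))) ∧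
    (∀ μ₁ ε₁ μ₂ ε₂ : E3 → ℝ, IsGaugeParam μ₁ ε₁ → IsGaugeParam μ₂ ε₂ →
      PoissonEq c (gaugeGen μ₁ ε₁) (gaugeGen μ₂ ε₂) (fun _ => 0)) ∧
    -- semidirect sum of the Poincaré algebra and the abelian algebra of the pairs `(ε̄, μ̄)`
    (∃ ψ : poincareAlgebra →ₗ⁅ℝ⁆ LieDerivation ℝ u1Algebra u1Algebra,
      (∀ (p : poincareAlgebra) (k : u1Algebra) (n : S2),
        (ψ p k).1.1 n = inner ℝ (yvec p n) (sgrad k.1.1 n) + bfun p n * k.1.2 n ∧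
        (ψ p k).1.2 n = inner ℝ (yvec p n) (sgrad k.1.2 n)
          + sdiv (fun m => bfun p m • sgrad k.1.1 m) n) ∧
      -- the same action in terms of `(ε̄, μ̄')` with `μ̄' = -μ̄`
      (∀ (p : poincareAlgebra) (k k' : u1Algebra), k'.1.1 = k.1.1 → k'.1.2 = -k.1.2 →
        ∀ n : S2,
        (ψ p k).1.1 n = inner ℝ (yvec p n) (sgrad k'.1.1 n) - bfun p n * k'.1.2 n ∧
        -((ψ p k).1.2 n) = inner ℝ (yvec p n) (sgrad k'.1.2 n)
          - sdiv (fun m => bfun p m • sgrad k'.1.1 m) n) ∧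
      ∀ (s₁ s₂ : u1Algebra ⋊⁅ψ⁆ poincareAlgebra) (μ₁ ε₁ μ₂ ε₂ : E3 → ℝ),
        HasBoundaryValue μ₁ ε₁ s₁.left → HasBoundaryValue μ₂ ε₂ s₂.left →
        ∃ μ ε : E3 → ℝ, HasBoundaryValue μ ε ⁅s₁, s₂⁆.left ∧
          PoissonEq c (fun z => poincareGen s₁.right z + gaugeGen μ₁ ε₁ z)
            (fun z => poincareGen s₂.right z + gaugeGen μ₂ ε₂ z)
            (fun z => poincareGen ⁅s₁, s₂⁆.right z + gaugeGen μ ε z)) := by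
  refine ⟨fun z hz w hw => symplectic_finite hz hw, fun p => ⟨fun z hz => poincare_finite p hz,
    isHamiltonian_poincareGen c p, fun z hz => poincareVF_usual p hz⟩, fun μ ε hg => ?_,
    fun εbar μbar _ _ hε hμ z hz => charge_eq_zero hε hμ hz, charges_nontrivial c,
    fun p q => ⟨poisson_poincare_poincare c p q, lapse_bracket p q, shift_bracket p q⟩,
    fun p μ ε hg => ?_, fun μ₁ ε₁ μ₂ ε₂ h₁ h₂ => ?_,
    u1Hom, u1Hom_formula, fun p k k' h1 h2 => u1Hom_formula_neg p h1 h2, semidirect_poisson c⟩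
  · obtain ⟨m, e, m0, e0, rfl, rfl, h⟩ := exists_gaugeLead hg
    refine ⟨fun z hz => h.finite hz, h.isHamiltonian c, fun z _ hon => gaugeGen_of_onShell _ _ hon,
      fun z hz => energy_finite hz, fun lam At hl => ?_, h.poisson_time c⟩
    obtain ⟨m', e', m0', e0', rfl, rfl, h'⟩ := exists_gaugeLead hl
    exact h.poisson_hamiltonian h' c
  · obtain ⟨m, e, m0, e0, rfl, rfl, h⟩ := exists_gaugeLead hg
    exact ⟨h.poisson_poincare' c p, h.poisson_poincare_neg c p⟩
  · obtain ⟨m, e, m0, e0, rfl, rfl, h⟩ := exists_gaugeLead h₁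
    obtain ⟨m', e', m0', e0', rfl, rfl, k⟩ := exists_gaugeLead h₂
    exact h.poisson_gauge k c
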